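/- Let $\mathbb{D}$ be the open unit disc in $\mathbb{C}$ and $\mathbb{T}$ its boundary. For $p\in[1,\infty)$ and $\beta\in\mathbb{R}$ let $\mathcal{H}^p(\mathbb{T},|z-1|^{\beta})$ be the space of all holomorphic functions $f$ on $\mathbb{D}$ with $$\|f\|^p=\sup_{0\le r<1}\int_0^{2\pi}|f(re^{i\theta})|^p\,|re^{i\theta}-1|^{\beta}\,d\theta<\infty ,$$ normed by $\|f\|$. **Theorem.** Let $\alpha\ge 0$, $p\in(1,\infty)$ and $\frac1p+\frac1q=1$. Every $f\in\mathcal{H}^p(\mathbb{T},|z-1|^{\alpha p})$ and every $h\in\mathcal{H}^q(\mathbb{T},|z-1|^{\alpha q})$ has radial boundary limits $f(e^{i\theta})=\lim_{r\to1^-}f(re^{i\theta})$ and $h(e^{i\theta})=\lim_{r\to1^-}h(re^{i\theta})$ for almost every $\theta$; with these boundary values the integral $$\langle f,h\rangle=\int_0^{2\pi} f(e^{i\theta})\,\overline{h(e^{i\theta})}\,|e^{i\theta}-1|^{2\alpha}\,d\theta$$ converges absolutely; and $h\mapsto\langle\,\cdot\,,h\rangle$ is a conjugate-linear bijection of $\mathcal{H}^q(\mathbb{T},|z-1|^{\alpha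 q})$ onto the dual space of bounded linear functionals on $\mathcal{H}^p(\mathbb{T},|z-1|^{\alpha p})$, which is continuous with continuous inverse. -/

import Mathlib

open MeasureTheory Set Filter Topology
open scoped ENNReal

noncomputable section

namespace WeightedHardy

/-- The mean `∫_0^{2π} |f(re^{iθ})|^p |re^{iθ} - 1|^β dθ` over the circle of radius `r`. -/
def circleMean (p β : ℝ) (f : ℂ → ℂ) (r : ℝ) : ℝ≥0∞ :=
  ∫⁻ θ in Ioc 0 (2 * Real.pi),
    ‖f (circleMap 0 r θ)‖ₑ ^ p * ENNReal.ofReal (‖circleMap 0 r θ - 1‖ ^ β)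

/-- The (possibly infinite) Hardy norm for the weight `|z - 1|^β`, the supremum of the
circle means over `0 ≤ r < 1`, to the power `1 / p`. -/
def hardyENorm (p β : ℝ) (f : ℂ → ℂ) : ℝ≥0∞ :=
  (⨆ r ∈ Ico (0 : ℝ) 1, circleMean p β f r) ^ (1 / p)

theorem circleMap_mem {r : ℝ} (hr : r ∈ Ico (0 : ℝ) 1) (θ : ℝ) :
    circleMap 0 r θ ∈ Metric.ball (0 : ℂ) 1 := by
  simp [abs_of_nonneg hr.1, hr.2]

theorem continuous_comp_circleMap {f : ℂ → ℂ} (hf : DifferentiableOn ℂ f (Metric.ball 0 1))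
    {r : ℝ} (hr : r ∈ Ico (0 : ℝ) 1) : Continuous fun θ => f (circleMap 0 r θ) :=
  hf.continuousOn.comp_continuous (continuous_circleMap 0 r) (circleMap_mem hr)

theorem weight_pos (β : ℝ) {r : ℝ} (hr : r ∈ Ico (0 : ℝ) 1) (θ : ℝ) :
    0 < ‖circleMap 0 r θ - 1‖ ^ β := by
  apply Real.rpow_pos_of_pos
  rw [norm_pos_iff, sub_ne_zero]
  intro h
  have := circleMap_mem hr θ
  rw [h] at this
  simp at this

theorem hardyENorm_le_iff {p β : ℝ} (hp : 0 < p) {f : ℂ → ℂ} {C : ℝ≥0∞} :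
    hardyENorm p β f ≤ C ↔ ∀ r ∈ Ico (0 : ℝ) 1, circleMean p β f r ^ (1 / p) ≤ C := by
  have h (a : ℝ≥0∞) : a ^ (1 / p) ≤ C ↔ a ≤ C ^ p := by
    rw [one_div, ENNReal.rpow_inv_le_iff hp]
  simp only [hardyENorm, h, iSup_le_iff]

theorem circleMean_eq {p : ℝ} (hp : 0 < p) (β : ℝ) (f : ℂ → ℂ) (r : ℝ) :
    circleMean p β f r = ∫⁻ θ in Ioc 0 (2 * Real.pi), (‖f (circleMap 0 r θ)‖ₑ *
      ENNReal.ofReal (‖circleMap 0 r θ - 1‖ ^ β) ^ (1 / p)) ^ p := by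
  refine lintegral_congr fun θ => ?_
  rw [ENNReal.mul_rpow_of_nonneg _ _ hp.le, ← ENNReal.rpow_mul, one_div_mul_cancel hp.ne',
    ENNReal.rpow_one]

theorem hardyENorm_zero {p : ℝ} (hp : 0 < p) (β : ℝ) : hardyENorm p β 0 = 0 := by
  rw [← nonpos_iff_eq_zero, hardyENorm_le_iff hp]
  intro r _
  simp [circleMean, hp]

theorem hardyENorm_add_le {p : ℝ} (hp : 1 ≤ p) (β : ℝ) {f g : ℂ → ℂ}
    (hf : DifferentiableOn ℂ f (Metric.ball 0 1)) (hg : DifferentiableOn ℂ g (Metric.ball 0 1)) :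
    hardyENorm p β (f + g) ≤ hardyENorm p β f + hardyENorm p β g := by
  have hp0 : 0 < p := by linarith
  rw [hardyENorm_le_iff hp0]
  intro r hr
  have hw : Measurable fun θ : ℝ => ENNReal.ofReal (‖circleMap 0 r θ - 1‖ ^ β) ^ (1 / p) := by
    have := (continuous_circleMap 0 r).measurable
    fun_prop
  have key : ∀ {F : ℂ → ℂ}, DifferentiableOn ℂ F (Metric.ball 0 1) →
      AEMeasurable (fun θ : ℝ => ‖F (circleMap 0 r θ)‖ₑ *
        ENNReal.ofReal (‖circleMap 0 r θ - 1‖ ^ β) ^ (1 / p))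
        (volume.restrict (Ioc 0 (2 * Real.pi))) := fun hF =>
    ((continuous_comp_circleMap hF hr).measurable.enorm.mul hw).aemeasurable
  calc circleMean p β (f + g) r ^ (1 / p)
      ≤ (∫⁻ θ in Ioc 0 (2 * Real.pi), (((fun θ : ℝ => ‖f (circleMap 0 r θ)‖ₑ *
        ENNReal.ofReal (‖circleMap 0 r θ - 1‖ ^ β) ^ (1 / p)) +
        fun θ : ℝ => ‖g (circleMap 0 r θ)‖ₑ *
        ENNReal.ofReal (‖circleMap 0 r θ - 1‖ ^ β) ^ (1 / p)) θ) ^ p) ^ (1 / p) := by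
        rw [circleMean_eq hp0]
        gcongr with θ
        simp only [Pi.add_apply, ← add_mul]
        gcongr
        exact enorm_add_le _ _
    _ ≤ circleMean p β f r ^ (1 / p) + circleMean p β g r ^ (1 / p) := by
        rw [circleMean_eq hp0 β f, circleMean_eq hp0 β g]
        exact ENNReal.lintegral_Lp_add_le (key hf) (key hg) hp
    _ ≤ _ := add_le_add ((hardyENorm_le_iff hp0).1 le_rfl r hr)
        ((hardyENorm_le_iff hp0).1 le_rfl r hr)

theorem hardyENorm_smul {p : ℝ} (hp : 0 < p) (β : ℝ) (c : ℂ) (f : ℂ → ℂ) :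
    hardyENorm p β (c • f) = ‖c‖ₑ * hardyENorm p β f := by
  have h (r : ℝ) : circleMean p β (c • f) r = ‖c‖ₑ ^ p * circleMean p β f r := by
    unfold circleMean
    rw [← lintegral_const_mul' _ _ (by simp [hp.le])]
    refine lintegral_congr fun θ => ?_
    rw [Pi.smul_apply, enorm_smul, ENNReal.mul_rpow_of_nonneg _ _ hp.le, mul_assoc]
  simp only [hardyENorm, h, ← ENNReal.mul_iSup]
  rw [ENNReal.mul_rpow_of_nonneg _ _ (by positivity), ← ENNReal.rpow_mul,
    mul_one_div_cancel hp.ne', ENNReal.rpow_one]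

theorem eqOn_zero_of_hardyENorm_eq_zero {p : ℝ} (hp : 0 < p) (β : ℝ) {f : ℂ → ℂ}
    (hf : DifferentiableOn ℂ f (Metric.ball 0 1)) (h : hardyENorm p β f = 0) :
    ∀ z ∈ Metric.ball (0 : ℂ) 1, f z = 0 := by
  have hcirc : ∀ r ∈ Ico (0 : ℝ) 1, ∀ θ ∈ Ioc 0 (2 * Real.pi), f (circleMap 0 r θ) = 0 := by
    intro r hr
    have hc := continuous_comp_circleMap hf hr
    have h0 : circleMean p β f r = 0 := by
      have := (hardyENorm_le_iff hp).1 h.le r hr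
      simpa [hp, hp.le, not_lt.2 hp.le] using this
    have hm : Measurable fun θ : ℝ => ‖f (circleMap 0 r θ)‖ₑ ^ p *
        ENNReal.ofReal (‖circleMap 0 r θ - 1‖ ^ β) := by
      have := (continuous_circleMap 0 r).measurable
      exact (hc.measurable.enorm.pow_const p).mul (by fun_prop)
    rw [circleMean, lintegral_eq_zero_iff hm] at h0
    have h1 : (fun θ => f (circleMap 0 r θ)) =ᵐ[volume.restrict (Ioc 0 (2 * Real.pi))]
        fun _ => 0 := by
      filter_upwards [h0] with θ hθ
      have hw := weight_pos β hr θ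
      simpa [hp, hp.le, not_lt.2 hp.le, not_le.2 hw] using hθ
    exact Measure.eqOn_Ioc_of_ae_eq _ h1 hc.continuousOn continuousOn_const
  intro z hz
  have hr : ‖z‖ ∈ Ico (0 : ℝ) 1 := ⟨norm_nonneg z, by simpa using hz⟩
  have hz' : z ∈ circleMap 0 ‖z‖ '' Ioc 0 (2 * Real.pi) := by
    rw [image_circleMap_Ioc, abs_norm]
    simp
  obtain ⟨θ, hθ, hzθ⟩ := hz'
  rw [← hzθ]
  exact hcirc _ hr θ hθ

/-- The holomorphic functions `f` on the open unit disc with finite Hardy norm for the weight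
`|z - 1|^β`. A function on the disc is represented by its extension by `0` to `ℂ`. -/
def hardySubmodule (p β : ℝ) [hp : Fact (1 ≤ p)] : Submodule ℂ (ℂ → ℂ) where
  carrier := {f | DifferentiableOn ℂ f (Metric.ball 0 1) ∧
    (∀ z ∉ Metric.ball (0 : ℂ) 1, f z = 0) ∧ hardyENorm p β f < ∞}
  zero_mem' := ⟨differentiableOn_const 0, fun _ _ => rfl, by
    rw [hardyENorm_zero (by linarith [hp.out])]; simp⟩
  add_mem' := fun {f g} hf hg => ⟨hf.1.add hg.1, fun z hz => by
    simp [hf.2.1 z hz, hg.2.1 z hz],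
    (hardyENorm_add_le hp.out β hf.1 hg.1).trans_lt (ENNReal.add_lt_top.2 ⟨hf.2.2, hg.2.2⟩)⟩
  smul_mem' := fun c f hf => ⟨hf.1.const_smul c, fun z hz => by simp [hf.2.1 z hz], by
    rw [hardyENorm_smul (by linarith [hp.out])]
    exact ENNReal.mul_lt_top enorm_lt_top hf.2.2⟩

/-- The weighted Hardy space `H^p(𝕋, |z - 1|^β)`. It is a type of its own, so that its topology is
that of the Hardy norm and not that of pointwise convergence. -/
def HardySpace (p β : ℝ) [Fact (1 ≤ p)] : Type := hardySubmodule p β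

variable (p β : ℝ) [hp : Fact (1 ≤ p)]

instance : AddCommGroup (HardySpace p β) :=
  inferInstanceAs (AddCommGroup (hardySubmodule p β))

instance : Module ℂ (HardySpace p β) :=
  inferInstanceAs (Module ℂ (hardySubmodule p β))

instance : CoeFun (HardySpace p β) fun _ => ℂ → ℂ := ⟨fun f => f.1⟩

instance : Norm (HardySpace p β) := ⟨fun f => (hardyENorm p β f).toReal⟩

theorem normCore : NormedSpace.Core ℂ (HardySpace p β) where
  norm_nonneg _ := ENNReal.toReal_nonneg
  norm_smul c f := by
    change (hardyENorm p β (c • f.1)).toReal = ‖c‖ * (hardyENorm p β f.1).toReal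
    rw [hardyENorm_smul (by linarith [hp.out]), ENNReal.toReal_mul, toReal_enorm]
  norm_triangle f g := by
    change (hardyENorm p β (f.1 + g.1)).toReal ≤
      (hardyENorm p β f.1).toReal + (hardyENorm p β g.1).toReal
    rw [← ENNReal.toReal_add f.2.2.2.ne g.2.2.2.ne]
    exact ENNReal.toReal_mono (ENNReal.add_ne_top.2 ⟨f.2.2.2.ne, g.2.2.2.ne⟩)
      (hardyENorm_add_le hp.out β f.2.1 g.2.1)
  norm_eq_zero_iff f := by
    have hp0 : 0 < p := by linarith [hp.out]
    constructor
    · intro h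
      have h0 : hardyENorm p β f.1 = 0 :=
        ((ENNReal.toReal_eq_zero_iff _).1 h).resolve_right f.2.2.2.ne
      refine Subtype.ext (funext fun z => ?_)
      by_cases hz : z ∈ Metric.ball (0 : ℂ) 1
      · exact eqOn_zero_of_hardyENorm_eq_zero hp0 β f.2.1 h0 z hz
      · exact f.2.2.1 z hz
    · rintro rfl
      change (hardyENorm p β 0).toReal = 0
      rw [hardyENorm_zero hp0, ENNReal.toReal_zero]

instance : NormedAddCommGroup (HardySpace p β) := NormedAddCommGroup.ofCore (normCore p β)

instance : NormedSpace ℂ (HardySpace p β) := NormedSpace.ofCore (normCore p β)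

/-- `f` has a radial limit at the boundary point `e^{iθ}`. -/
def HasRadialLimit (f : ℂ → ℂ) (θ : ℝ) : Prop :=
  ∃ l : ℂ, Tendsto (fun r : ℝ => f (circleMap 0 r θ)) (𝓝[<] 1) (𝓝 l)

/-- The boundary value of `f` at `e^{iθ}`: its radial limit there. -/
def boundaryValue (f : ℂ → ℂ) (θ : ℝ) : ℂ :=
  limUnder (𝓝[<] (1 : ℝ)) fun r : ℝ => f (circleMap 0 r θ)

/-- The integrand `f(z) * conj (h(z)) * |z - 1|^{2α}` at `z = e^{iθ}`. -/
def pairingIntegrand (α : ℝ) (f h : ℂ → ℂ) (θ : ℝ) : ℂ :=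
  boundaryValue f θ * starRingEnd ℂ (boundaryValue h θ) *
    ((‖circleMap 0 1 θ - 1‖ ^ (2 * α) : ℝ) : ℂ)

end WeightedHardy

end

open MeasureTheory Set Filter Topology
open scoped ENNReal

noncomputable section

namespace WeightedHardy

/-! ### Radial limits of Poisson integrals -/

/-! The function $(1-z)^\alpha$ is holomorphic and zero-free on the disc and has modulus
$|z-1|^\alpha$. Multiplication by it is therefore an isometry of the weighted space onto the
unweighted $H^p$ (`removeWeight`). It also absorbs the weight of the pairing, since
$|z-1|^{2\alpha}=(1-z)^\alpha\overline{(1-z)^\alpha}$. So everything reduces to $\alpha=0$.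

Boundary values for $\alpha=0$: the restrictions of $F$ to circles of radius $r\to1$ are Cauchy in
$L^p$. This follows from uniform convexity (`exists_norm_sub_rpow_le`), because the $L^p$ means of
$F$, and those of the midpoints of two of its dilates, increase with the radius. The function is
then the Poisson integral of its $L^p$ limit, and Fatou's theorem (`ae_tendsto_poissonIntegral`)
identifies that limit with the radial limits almost everywhere (`exists_boundary`).

Duality for $\alpha=0$: Hölder's inequality makes every $h\in H^q$ a bounded functional. The inverse
is explicit: `representer` sends $\varphi$ to $(2\pi)^{-1}\sum_n\overline{\varphi(z^n)}\,z^n$. To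
bound its $L^q$ mean on a circle, it is integrated against a continuous $k$; the result is the
conjugate of $\varphi$ at a dilated Cauchy transform of $k$ (`apply_eq_integral_representer`). M.
Riesz's theorem (`exists_radNorm_cauchyTransform_le`) bounds the $H^p$ norm of that transform by the
$L^p$ norm of $k$.

Riesz's theorem for $p\le2$ comes from a pointwise inequality between $|z|^p$,
$(\operatorname{Re}z)^p$ and $\operatorname{Re}z^p$ on the right half-plane, integrated along a
Herglotz transform. For $p\ge2$ it follows since the Cauchy transform is formally self-adjoint.
Finally, Cauchy's formula shows that $h$ represents its own functional, and approximation by dilates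
shows that $\varphi$ is the pairing with its representer. -/

theorem lintegral_Ioi_two_mul_mul_div_sq {η a : ℝ} (hη : 0 < η) (ha : 0 ≤ a) :
    ∫⁻ s in Ioi a, ENNReal.ofReal (2 * s * η / (η ^ 2 + s ^ 2) ^ 2) =
      ENNReal.ofReal (η / (η ^ 2 + a ^ 2)) := by
  have hpos : ∀ s : ℝ, 0 < η ^ 2 + s ^ 2 := fun s => by positivity
  have hd : ∀ x ∈ Ici a, HasDerivAt (fun s : ℝ => -(η / (η ^ 2 + s ^ 2)))
      (2 * x * η / (η ^ 2 + x ^ 2) ^ 2) x := by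
    intro x _
    have h1 : HasDerivAt (fun s : ℝ => η ^ 2 + s ^ 2) (2 * x) x := by
      simpa using (hasDerivAt_pow 2 x).const_add (η ^ 2)
    convert! ((hasDerivAt_const x η).div h1 (hpos x).ne').neg using 1
    ring
  have hnn : ∀ x ∈ Ioi a, 0 ≤ 2 * x * η / (η ^ 2 + x ^ 2) ^ 2 := by
    intro x hx
    have : 0 ≤ x := ha.trans (le_of_lt hx)
    positivity
  have hl : Tendsto (fun s : ℝ => -(η / (η ^ 2 + s ^ 2))) atTop (𝓝 0) := by
    rw [← neg_zero]
    refine (Tendsto.div_atTop tendsto_const_nhds ?_).neg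
    exact tendsto_atTop_add_const_left _ _ (tendsto_pow_atTop two_ne_zero)
  rw [← ofReal_integral_eq_lintegral_ofReal (integrableOn_Ioi_deriv_of_nonneg' hd hnn hl)
    ((ae_restrict_iff' measurableSet_Ioi).2 (Eventually.of_forall hnn)),
    integral_Ioi_of_hasDerivAt_of_nonneg' hd hnn hl]
  simp

/-- The value does not depend on $\eta$. This makes the Cauchy kernel a superposition of averages
over intervals with bounded total weight as $\eta\to0$. -/
theorem lintegral_Ioi_two_mul_mul_div_sq_mul_self {η : ℝ} (hη : 0 < η) :
    ∫⁻ s in Ioi (0 : ℝ), ENNReal.ofReal (2 * s * η / (η ^ 2 + s ^ 2) ^ 2) * ENNReal.ofReal s =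
      ENNReal.ofReal (Real.pi / 2) := by
  have hpos : ∀ s : ℝ, 0 < η ^ 2 + s ^ 2 := fun s => by positivity
  -- Antiderivative obtained by parts from that of the previous lemma, $-\eta/(\eta^2+s^2)$.
  have hd : ∀ x ∈ Ici (0 : ℝ), HasDerivAt (fun s : ℝ => Real.arctan (s / η) -
      s * η / (η ^ 2 + s ^ 2)) (2 * x * η / (η ^ 2 + x ^ 2) ^ 2 * x) x := by
    intro x _
    have h1 : HasDerivAt (fun s : ℝ => η ^ 2 + s ^ 2) (2 * x) x := by
      simpa using (hasDerivAt_pow 2 x).const_add (η ^ 2)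
    have h2 : HasDerivAt (fun s : ℝ => s * η) η x := by
      simpa using (hasDerivAt_id x).mul_const η
    have h3 : HasDerivAt (fun s : ℝ => s / η) (1 / η) x := (hasDerivAt_id x).div_const η
    convert! h3.arctan.sub (h2.div h1 (hpos x).ne') using 1
    have := (hpos x).ne'
    field_simp
    ring
  have hnn : ∀ x ∈ Ioi (0 : ℝ), 0 ≤ 2 * x * η / (η ^ 2 + x ^ 2) ^ 2 * x := by
    intro x hx
    have : 0 ≤ x := le_of_lt hx
    positivity
  have hl : Tendsto (fun s : ℝ => Real.arctan (s / η) - s * η / (η ^ 2 + s ^ 2)) atTop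
      (𝓝 (Real.pi / 2 - 0)) := by
    refine Tendsto.sub ?_ ?_
    · exact (Real.tendsto_arctan_atTop.mono_right nhdsWithin_le_nhds).comp
        (tendsto_id.atTop_div_const hη)
    · refine squeeze_zero' (g := fun s : ℝ => η / s) ?_ ?_
        (tendsto_const_nhds.div_atTop tendsto_id)
      · filter_upwards [eventually_gt_atTop 0] with s hs
        positivity
      · filter_upwards [eventually_gt_atTop 0] with s hs
        rw [div_le_div_iff₀ (hpos s) hs]
        nlinarith [mul_pos hη (pow_pos hη 2)]
  have := ofReal_integral_eq_lintegral_ofReal (integrableOn_Ioi_deriv_of_nonneg' hd hnn hl)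
    ((ae_restrict_iff' measurableSet_Ioi).2 (Eventually.of_forall hnn))
  rw [integral_Ioi_of_hasDerivAt_of_nonneg' hd hnn hl] at this
  simp only [sub_zero, zero_div, Real.arctan_zero, zero_mul] at this
  rw [this]
  refine setLIntegral_congr_fun measurableSet_Ioi fun s hs => ?_
  have hs' : 0 < s := hs
  exact (ENNReal.ofReal_mul (by positivity)).symm

/-- Layer-cake formula: the kernel at $t$ is the integral of minus its radial derivative over all
$s>|t-\theta|$, and Tonelli exchanges the two integrations. -/
theorem lintegral_cauchyKernel_mul {η : ℝ} (hη : 0 < η) {u : ℝ → ℝ≥0∞} (hu : AEMeasurable u)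
    (θ : ℝ) :
    ∫⁻ t, ENNReal.ofReal (η / (η ^ 2 + (t - θ) ^ 2)) * u t =
      ∫⁻ s in Ioi (0 : ℝ), ENNReal.ofReal (2 * s * η / (η ^ 2 + s ^ 2) ^ 2) *
        ∫⁻ t in Metric.ball θ s, u t := by
  let k : ℝ → ℝ≥0∞ := fun s => ENNReal.ofReal (2 * s * η / (η ^ 2 + s ^ 2) ^ 2)
  have hk : Measurable k := by fun_prop
  have hS : MeasurableSet {x : ℝ × ℝ | x.1 ∈ Metric.ball θ x.2} := by
    simp only [Metric.mem_ball]
    exact measurableSet_lt (by fun_prop) (by fun_prop)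
  calc ∫⁻ t, ENNReal.ofReal (η / (η ^ 2 + (t - θ) ^ 2)) * u t
      = ∫⁻ t, ∫⁻ s in Ioi (0 : ℝ),
          {x : ℝ × ℝ | x.1 ∈ Metric.ball θ x.2}.indicator (fun x => k x.2 * u x.1) (t, s) := by
        refine lintegral_congr fun t => ?_
        rw [← sq_abs (t - θ), ← lintegral_Ioi_two_mul_mul_div_sq hη (abs_nonneg (t - θ)),
          ← lintegral_mul_const _ hk, ← lintegral_indicator measurableSet_Ioi,
          ← lintegral_indicator measurableSet_Ioi]
        refine lintegral_congr fun s => ?_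
        by_cases hs : |t - θ| < s
        · have : 0 < s := (abs_nonneg _).trans_lt hs
          simp [indicator, hs, this, Real.dist_eq, k]
        · simp [indicator, hs, Real.dist_eq]
    _ = ∫⁻ s in Ioi (0 : ℝ), ∫⁻ t,
          {x : ℝ × ℝ | x.1 ∈ Metric.ball θ x.2}.indicator (fun x => k x.2 * u x.1) (t, s) := by
        refine lintegral_lintegral_swap ?_
        refine AEMeasurable.indicator ?_ hS
        exact (hk.comp measurable_snd).aemeasurable.mul
          (hu.comp_quasiMeasurePreserving Measure.quasiMeasurePreserving_fst)
    _ = _ := by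
        refine lintegral_congr fun s => ?_
        rw [← lintegral_const_mul'' _ hu.restrict,
          ← lintegral_indicator Metric.isOpen_ball.measurableSet]
        rfl

/-- In the layer-cake formula, radii $s\le\delta$ contribute little because the averages of $u$
there are at most $\varepsilon$ and the total weight is bounded. Radii $s>\delta$ see at most the
whole mass $M$, against a kernel tail that vanishes with $\eta$. -/
theorem tendsto_lintegral_cauchyKernel_mul {u : ℝ → ℝ≥0∞} (hu : AEMeasurable u)
    (hfin : ∫⁻ t, u t ≠ ∞) {θ : ℝ}
    (h : Tendsto (fun s => (∫⁻ t in Metric.closedBall θ s, u t) /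
      volume (Metric.closedBall θ s)) (𝓝[>] 0) (𝓝 0)) :
    Tendsto (fun η : ℝ => ∫⁻ t, ENNReal.ofReal (η / (η ^ 2 + (t - θ) ^ 2)) * u t)
      (𝓝[>] 0) (𝓝 0) := by
  set M := ∫⁻ t, u t
  have key : ∀ ε : ℝ≥0∞, 0 < ε → ∃ δ > 0, ∀ η : ℝ, 0 < η →
      ∫⁻ t, ENNReal.ofReal (η / (η ^ 2 + (t - θ) ^ 2)) * u t ≤
        ε * 2 * ENNReal.ofReal (Real.pi / 2) + ENNReal.ofReal (η / (η ^ 2 + δ ^ 2)) * M := by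
    intro ε hε
    have h1 := ENNReal.tendsto_nhds_zero.1 h ε hε
    obtain ⟨δ, hδ, hδ'⟩ := mem_nhdsGT_iff_exists_Ioc_subset.1 h1
    refine ⟨δ, hδ, fun η hη => ?_⟩
    have he : ∫⁻ s in Ioi δ, ENNReal.ofReal (2 * s * η / (η ^ 2 + s ^ 2) ^ 2) * M =
        ∫⁻ s in Ioi (0 : ℝ), (Ioi δ).indicator (fun s =>
          ENNReal.ofReal (2 * s * η / (η ^ 2 + s ^ 2) ^ 2) * M) s := by
      rw [lintegral_indicator measurableSet_Ioi, Measure.restrict_restrict measurableSet_Ioi,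
        inter_eq_self_of_subset_left (Ioi_subset_Ioi (mem_Ioi.1 hδ).le)]
    rw [lintegral_cauchyKernel_mul hη hu, ← lintegral_Ioi_two_mul_mul_div_sq_mul_self hη,
      ← lintegral_Ioi_two_mul_mul_div_sq hη (le_of_lt hδ),
      ← lintegral_const_mul _ (by fun_prop), ← lintegral_mul_const _ (by fun_prop),
      he, ← lintegral_add_left (by fun_prop)]
    refine setLIntegral_mono' measurableSet_Ioi fun s hs => ?_
    by_cases hsδ : s ≤ δ
    · have h2 : (∫⁻ t in Metric.closedBall θ s, u t) / volume (Metric.closedBall θ s) ≤ ε :=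
        hδ' ⟨hs, hsδ⟩
      rw [Real.volume_closedBall, ENNReal.div_le_iff (by simpa using hs) ENNReal.ofReal_ne_top] at h2
      have h3 : ∫⁻ t in Metric.ball θ s, u t ≤ ε * ENNReal.ofReal (2 * s) :=
        (lintegral_mono_set Metric.ball_subset_closedBall).trans h2
      refine le_add_right ?_
      calc _ ≤ ENNReal.ofReal (2 * s * η / (η ^ 2 + s ^ 2) ^ 2) *
            (ε * ENNReal.ofReal (2 * s)) := by gcongr
        _ = _ := by
          rw [ENNReal.ofReal_mul (p := 2) (by norm_num), ENNReal.ofReal_ofNat]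
          ring
    · refine le_add_left ?_
      rw [indicator_of_mem (mem_Ioi.2 (not_le.1 hsδ))]
      gcongr
      exact setLIntegral_le_lintegral _ _
  rw [ENNReal.tendsto_nhds_zero]
  intro ε hε
  have hc : ENNReal.ofReal (Real.pi / 2) ≤ 2 := by
    rw [← ENNReal.ofReal_ofNat]
    exact ENNReal.ofReal_le_ofReal (by linarith [Real.pi_le_four])
  -- With $\pi/2\le2$ the near part is at most $(\varepsilon/8)\cdot2\cdot2=\varepsilon/2$.
  obtain ⟨δ, hδ, hη⟩ := key (ε / 8) (ENNReal.div_pos hε.ne' (by norm_num))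
  have hlim : Tendsto (fun η : ℝ => ENNReal.ofReal (η / (η ^ 2 + δ ^ 2)) * M)
      (𝓝[>] 0) (𝓝 0) := by
    have h1 : Continuous fun η : ℝ => η / (η ^ 2 + δ ^ 2) := by
      refine continuous_id.div (by fun_prop) fun x => ?_
      have : 0 < δ := hδ
      positivity
    have h2 : Tendsto (fun η : ℝ => ENNReal.ofReal (η / (η ^ 2 + δ ^ 2))) (𝓝[>] 0) (𝓝 0) := by
      have := ((ENNReal.continuous_ofReal.comp h1).tendsto 0).mono_left
        (nhdsWithin_le_nhds (s := Ioi 0))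
      simpa [Function.comp_def] using this
    simpa using ENNReal.Tendsto.mul_const h2 (Or.inr hfin)
  filter_upwards [ENNReal.tendsto_nhds_zero.1 hlim (ε / 2) (ENNReal.half_pos hε.ne'),
    self_mem_nhdsWithin] with η h1 h2
  calc _ ≤ ε / 8 * 2 * ENNReal.ofReal (Real.pi / 2) +
        ENNReal.ofReal (η / (η ^ 2 + δ ^ 2)) * M := hη η h2
    _ ≤ ε / 8 * 2 * 2 + ε / 2 := by gcongr
    _ = ε / 2 + ε / 2 := by
      congr 1
      rw [mul_assoc, ENNReal.div_eq_inv_mul, ENNReal.div_eq_inv_mul, mul_right_comm]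
      congr 1
      rw [show (8 : ℝ≥0∞) = 2 * 4 by norm_num, ENNReal.mul_inv (by simp) (by simp), mul_assoc,
        show (2 : ℝ≥0∞) * 2 = 4 by norm_num, ENNReal.inv_mul_cancel (by simp) (by simp), mul_one]
    _ = ε := ENNReal.add_halves ε

/-- The arc length measure on `(0, 2π]`, the parameter interval of the circle. -/
abbrev circ : Measure ℝ := volume.restrict (Ioc 0 (2 * Real.pi))

/-! ### The Poisson kernel in polar coordinates. -/

theorem circleAverage_eq_integral_circ {E : Type*} [NormedAddCommGroup E] [NormedSpace ℝ E]
    (f : ℂ → E) (c : ℂ) (R : ℝ) :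
    Real.circleAverage f c R = (2 * Real.pi)⁻¹ • ∫ θ, f (circleMap c R θ) ∂circ := by
  rw [Real.circleAverage_def, intervalIntegral.integral_of_le Real.two_pi_pos.le]

theorem norm_circleMap_sub_circleMap (r s θ t : ℝ) :
    ‖circleMap 0 r θ - circleMap 0 s t‖ ^ 2 = r ^ 2 + s ^ 2 - 2 * r * s * Real.cos (θ - t) := by
  rw [← Complex.normSq_eq_norm_sq, Complex.normSq_apply]
  simp only [circleMap_zero, Complex.exp_mul_I, ← Complex.ofReal_cos, ← Complex.ofReal_sin,
    Complex.sub_re, Complex.sub_im, Complex.mul_re, Complex.mul_im, Complex.add_re, Complex.add_im,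
    Complex.ofReal_re, Complex.ofReal_im, Complex.I_re, Complex.I_im, Real.cos_sub]
  nlinarith [Real.sin_sq_add_cos_sq θ, Real.sin_sq_add_cos_sq t]

theorem poissonKernel_circleMap (r θ t : ℝ) :
    poissonKernel 0 (circleMap 0 r θ) (circleMap 0 1 t) =
      (1 - r ^ 2) / (1 + r ^ 2 - 2 * r * Real.cos (θ - t)) := by
  rw [poissonKernel_def]
  simp only [sub_zero, norm_circleMap_zero, sq_abs, one_pow]
  rw [norm_circleMap_sub_circleMap, ← Real.cos_neg, neg_sub]
  ring_nf

theorem one_sub_sq_le_poisson_denom (r x : ℝ) (hr : 0 ≤ r) :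
    (1 - r) ^ 2 ≤ 1 + r ^ 2 - 2 * r * Real.cos x := by
  nlinarith [Real.cos_le_one x]

theorem poissonKernel_circleMap_nonneg {r : ℝ} (hr : r ∈ Ico (0 : ℝ) 1) (θ t : ℝ) :
    0 ≤ poissonKernel 0 (circleMap 0 r θ) (circleMap 0 1 t) := by
  rw [poissonKernel_circleMap]
  have h1 := one_sub_sq_le_poisson_denom r (θ - t) hr.1
  have h2 : 0 < (1 - r) ^ 2 := pow_pos (by linarith [hr.2]) 2
  exact div_nonneg (by nlinarith [hr.1, hr.2]) (by linarith)

theorem continuous_poissonKernel_circleMap {r : ℝ} (hr : r ∈ Ico (0 : ℝ) 1) :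
    Continuous fun x : ℝ × ℝ => poissonKernel 0 (circleMap 0 r x.1) (circleMap 0 1 x.2) := by
  simp only [poissonKernel_circleMap]
  refine continuous_const.div (by fun_prop) fun x => ?_
  have h1 := one_sub_sq_le_poisson_denom r (x.1 - x.2) hr.1
  have h2 : 0 < (1 - r) ^ 2 := pow_pos (by linarith [hr.2]) 2
  linarith

theorem poissonKernel_circleMap_swap (r θ t : ℝ) :
    poissonKernel 0 (circleMap 0 r θ) (circleMap 0 1 t) =
      poissonKernel 0 (circleMap 0 r t) (circleMap 0 1 θ) := by
  rw [poissonKernel_circleMap, poissonKernel_circleMap, ← Real.cos_neg, neg_sub]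

theorem integral_poissonKernel_circleMap {r : ℝ} (hr : r ∈ Ico (0 : ℝ) 1) (θ : ℝ) :
    (2 * Real.pi)⁻¹ * ∫ t, poissonKernel 0 (circleMap 0 r θ) (circleMap 0 1 t) ∂circ = 1 := by
  have h := (diffContOnCl_const (c := (1 : ℂ))).circleAverage_poissonKernel_smul
    (circleMap_mem hr θ)
  rw [circleAverage_eq_integral_circ] at h
  have h2 : ∀ t, (poissonKernel 0 (circleMap 0 r θ) • fun _ => (1 : ℂ)) (circleMap 0 1 t) =
    ((poissonKernel 0 (circleMap 0 r θ) (circleMap 0 1 t) : ℝ) : ℂ) := fun t => by simp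
  simp only [h2] at h
  rw [integral_complex_ofReal, Complex.real_smul, ← Complex.ofReal_mul] at h
  exact_mod_cast h

/-- Sine is concave on $[0,\pi]$, so on $[0,a]$ its graph lies above the chord from $0$ to $(a,\sin
a)$. -/
theorem exists_mul_abs_le_abs_sin {a : ℝ} (ha : 0 < a) (ha' : a < Real.pi) :
    ∃ c > 0, ∀ x, |x| ≤ a → c * |x| ≤ |Real.sin x| := by
  refine ⟨Real.sin a / a, div_pos (Real.sin_pos_of_pos_of_lt_pi ha ha') ha, fun x hx => ?_⟩
  have hs : |Real.sin x| = Real.sin |x| := by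
    rcases abs_cases x with ⟨h, h'⟩ | ⟨h, h'⟩
    · rw [h, abs_of_nonneg (Real.sin_nonneg_of_nonneg_of_le_pi h' (by linarith))]
    · rw [h, Real.sin_neg, abs_of_nonpos]
      exact Real.sin_nonpos_of_nonpos_of_neg_pi_le h'.le (by linarith)
  rw [hs]
  have hc := strictConcaveOn_sin_Icc.concaveOn.2
    (show (0 : ℝ) ∈ Icc 0 Real.pi from ⟨le_rfl, Real.pi_pos.le⟩)
    (show a ∈ Icc 0 Real.pi from ⟨ha.le, ha'.le⟩)
    (show 0 ≤ 1 - |x| / a by rw [sub_nonneg, div_le_one ha]; exact hx)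
    (show 0 ≤ |x| / a by positivity) (by ring)
  simp only [smul_eq_mul, Real.sin_zero, mul_zero, zero_add, div_mul_cancel₀ _ ha.ne'] at hc
  exact (le_of_eq (by ring)).trans hc

/-- The denominator is $(1-r)^2+4r\sin^2((\theta-t)/2)$. For interior $\theta$ the half-difference
stays away from $\pm\pi$ for all $t$ in the interval, so its sine is comparable to $|t-\theta|$. The
constant degenerates as $\theta$ approaches an endpoint. -/
theorem exists_poissonKernel_le {θ : ℝ} (hθ : θ ∈ Ioo 0 (2 * Real.pi)) :
    ∃ C > 0, ∀ r ∈ Ico (0 : ℝ) 1, ∀ t ∈ Ioc 0 (2 * Real.pi),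
      poissonKernel 0 (circleMap 0 r θ) (circleMap 0 1 t) ≤
        C * ((1 - r) / ((1 - r) ^ 2 + (t - θ) ^ 2)) := by
  obtain ⟨c, hc, hsin⟩ := exists_mul_abs_le_abs_sin (a := max θ (2 * Real.pi - θ) / 2)
    (by have := hθ.1; have := le_max_left θ (2 * Real.pi - θ); linarith)
    (by
      have : max θ (2 * Real.pi - θ) < 2 * Real.pi := max_lt hθ.2 (by linarith [hθ.1])
      linarith)
  refine ⟨2 * (2 + 4 / c ^ 2), by positivity, fun r hr t ht => ?_⟩
  rw [poissonKernel_circleMap]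
  set η := 1 - r with hη
  have hη0 : 0 < η := by linarith [hr.2]
  have hr' : r = 1 - η := by ring
  set D := 1 + r ^ 2 - 2 * r * Real.cos (θ - t) with hD
  have h1 : η ^ 2 ≤ D := one_sub_sq_le_poisson_denom r (θ - t) hr.1
  have hD0 : 0 < D := (pow_pos hη0 2).trans_le h1
  have habs : |(θ - t) / 2| ≤ max θ (2 * Real.pi - θ) / 2 := by
    rw [abs_div, abs_two]
    gcongr
    rw [abs_le]
    constructor
    · linarith [le_max_right θ (2 * Real.pi - θ), ht.2]
    · linarith [le_max_left θ (2 * Real.pi - θ), ht.1]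
  have h2 := hsin _ habs
  have h3 : c ^ 2 * ((θ - t) / 2) ^ 2 ≤ Real.sin ((θ - t) / 2) ^ 2 := by
    have := pow_le_pow_left₀ (by positivity) h2 2
    rwa [mul_pow, sq_abs, sq_abs] at this
  have hcos : Real.cos (θ - t) = 1 - 2 * Real.sin ((θ - t) / 2) ^ 2 := by
    rw [← Real.cos_two_mul_eq_one_sub]
    congr 1
    ring
  -- Replacing $(1-r)^2$ by $(1-r)^2\sin^2$ leaves $(1+r)^2\sin^2$, with no loss as $r\to0$.
  have h4 : Real.sin ((θ - t) / 2) ^ 2 ≤ D := by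
    rw [hD, hcos]
    have h0 : 0 ≤ Real.sin ((θ - t) / 2) ^ 2 := sq_nonneg _
    have h1 : Real.sin ((θ - t) / 2) ^ 2 ≤ 1 := Real.sin_sq_le_one _
    nlinarith [mul_nonneg (sq_nonneg (1 - r)) (sub_nonneg.2 h1), mul_nonneg hr.1 h0,
      mul_nonneg (sq_nonneg r) h0]
  have h5 : (t - θ) ^ 2 ≤ 4 / c ^ 2 * D := by
    rw [div_mul_eq_mul_div, le_div_iff₀ (by positivity)]
    nlinarith
  rw [mul_div_assoc', div_le_div_iff₀ hD0 (by positivity)]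
  have h6 : η ^ 2 + (t - θ) ^ 2 ≤ (2 + 4 / c ^ 2) * D := by nlinarith
  have h7 : 1 - r ^ 2 ≤ 2 * η := by nlinarith [hr.1, hr.2]
  calc (1 - r ^ 2) * (η ^ 2 + (t - θ) ^ 2) ≤ 2 * η * ((2 + 4 / c ^ 2) * D) := by gcongr
    _ = _ := by ring

theorem integrable_poissonKernel_smul {r : ℝ} (hr : r ∈ Ico (0 : ℝ) 1) (θ : ℝ) {g : ℝ → ℂ}
    (hg : Integrable g circ) :
    Integrable (fun t => poissonKernel 0 (circleMap 0 r θ) (circleMap 0 1 t) • g t) circ := by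
  have hcont : Continuous fun t => poissonKernel 0 (circleMap 0 r θ) (circleMap 0 1 t) :=
    Continuous.comp
      (g := fun x : ℝ × ℝ => poissonKernel 0 (circleMap 0 r x.1) (circleMap 0 1 x.2))
      (f := fun t => (θ, t)) (continuous_poissonKernel_circleMap hr) (by fun_prop)
  obtain ⟨B, hB⟩ := (isCompact_Icc (a := (0 : ℝ)) (b := 2 * Real.pi)).exists_bound_of_continuousOn
    hcont.continuousOn
  exact hg.bdd_smul (φ := fun t => poissonKernel 0 (circleMap 0 r θ) (circleMap 0 1 t)) B
    hcont.aestronglyMeasurable ((ae_restrict_iff' measurableSet_Ioc).2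
    (Eventually.of_forall fun t ht => hB t (Ioc_subset_Icc_self ht)))

/-- **Fatou's theorem** for Poisson integrals of integrable functions. -/
theorem ae_tendsto_poissonIntegral {g : ℝ → ℂ} (hg : Integrable g circ) :
    ∀ᵐ θ ∂circ, Tendsto (fun r : ℝ => (2 * Real.pi)⁻¹ •
      ∫ t, poissonKernel 0 (circleMap 0 r θ) (circleMap 0 1 t) • g t ∂circ)
      (𝓝[<] 1) (𝓝 (g θ)) := by
  have hG : Integrable ((Ioc 0 (2 * Real.pi)).indicator g) :=
    (integrable_indicator_iff measurableSet_Ioc).2 hg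
  -- Almost every point is a Lebesgue point of the extension of $g$ by zero.
  have hleb := (Besicovitch.vitaliFamily (volume : Measure ℝ)).ae_tendsto_lintegral_enorm_sub_div
    hG.locallyIntegrable
  -- The kernel bound needs $\theta$ in the open interval.
  have hne : ∀ᵐ θ : ℝ, θ ≠ 2 * Real.pi := by
    simp [ae_iff]
  rw [ae_restrict_iff' measurableSet_Ioc]
  filter_upwards [hleb, hne] with θ hL hne hθ
  have hθ' : θ ∈ Ioo 0 (2 * Real.pi) := ⟨hθ.1, lt_of_le_of_ne hθ.2 hne⟩
  obtain ⟨C, hC, hP⟩ := exists_poissonKernel_le hθ'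
  set u : ℝ → ℝ≥0∞ := (Ioc 0 (2 * Real.pi)).indicator fun t => ‖g t - g θ‖ₑ with hu_def
  have hum : AEMeasurable u :=
    (aemeasurable_indicator_iff measurableSet_Ioc).2
      (hg.aestronglyMeasurable.sub aestronglyMeasurable_const).enorm
  have hufin : ∫⁻ t, u t ≠ ∞ := by
    rw [lintegral_indicator measurableSet_Ioc]
    exact (hg.sub (integrable_const (g θ))).2.ne
  have hlim := tendsto_lintegral_cauchyKernel_mul (θ := θ) hum hufin (by
    refine tendsto_of_tendsto_of_tendsto_of_le_of_le tendsto_const_nhds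
      (hL.comp (Besicovitch.tendsto_filterAt volume θ)) (fun _ => zero_le) fun s => ?_
    refine ENNReal.div_le_div_right (lintegral_mono fun t => ?_) _
    by_cases ht : t ∈ Ioc 0 (2 * Real.pi)
    · simp [hu_def, ht, hθ]
    · simp [hu_def, ht])
  have hlim1 : Tendsto (fun r : ℝ => ∫⁻ t, ENNReal.ofReal
      ((1 - r) / ((1 - r) ^ 2 + (t - θ) ^ 2)) * u t) (𝓝[<] 1) (𝓝 0) := by
    refine hlim.comp (tendsto_nhdsWithin_iff.2 ⟨?_, ?_⟩)
    · have : Continuous fun r : ℝ => 1 - r := by fun_prop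
      simpa using (this.tendsto 1).mono_left (nhdsWithin_le_nhds (s := Iio 1))
    · filter_upwards [self_mem_nhdsWithin] with r hr
      exact sub_pos.2 (mem_Iio.1 hr)
  have hlim2 : Tendsto (fun r : ℝ => ENNReal.ofReal C * ∫⁻ t, ENNReal.ofReal
      ((1 - r) / ((1 - r) ^ 2 + (t - θ) ^ 2)) * u t) (𝓝[<] 1) (𝓝 0) := by
    simpa using ENNReal.Tendsto.const_mul hlim1 (Or.inr ENNReal.ofReal_ne_top)
  -- The kernel has mean one, so it suffices that the Poisson integral of $g-g(\theta)$ tends to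
  -- zero at $\theta$.
  have hlim3 : Tendsto (fun r : ℝ => (2 * Real.pi)⁻¹ • ∫ t,
      poissonKernel 0 (circleMap 0 r θ) (circleMap 0 1 t) • (g t - g θ) ∂circ)
      (𝓝[<] 1) (𝓝 0) := by
    suffices h : Tendsto (fun r : ℝ => ∫ t, poissonKernel 0 (circleMap 0 r θ) (circleMap 0 1 t) •
        (g t - g θ) ∂circ) (𝓝[<] 1) (𝓝 0) by
      have := h.const_smul (2 * Real.pi)⁻¹
      rwa [smul_zero] at this
    rw [tendsto_zero_iff_enorm_tendsto_zero]
    refine tendsto_of_tendsto_of_tendsto_of_le_of_le' tendsto_const_nhds hlim2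
      (Eventually.of_forall fun _ => zero_le) ?_
    filter_upwards [Ioo_mem_nhdsLT (zero_lt_one (α := ℝ))] with r hr
    have hr' : r ∈ Ico (0 : ℝ) 1 := ⟨hr.1.le, hr.2⟩
    refine (enorm_integral_le_lintegral_enorm _).trans ?_
    rw [← lintegral_const_mul' _ _ ENNReal.ofReal_ne_top, ← lintegral_indicator measurableSet_Ioc]
    refine lintegral_mono fun t => ?_
    by_cases ht : t ∈ Ioc 0 (2 * Real.pi)
    · rw [indicator_of_mem ht, hu_def, indicator_of_mem ht, enorm_smul, ← mul_assoc,
        ← ENNReal.ofReal_mul hC.le, Real.enorm_of_nonneg (poissonKernel_circleMap_nonneg hr' θ t)]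
      gcongr
      exact hP r hr' t ht
    · simp [ht]
  have hlim4 := hlim3.add_const (g θ)
  rw [zero_add] at hlim4
  refine hlim4.congr' ?_
  filter_upwards [Ioo_mem_nhdsLT (zero_lt_one (α := ℝ))] with r hr
  have hr' : r ∈ Ico (0 : ℝ) 1 := ⟨hr.1.le, hr.2⟩
  have hi1 := integrable_poissonKernel_smul hr' θ hg
  have hi2 := integrable_poissonKernel_smul hr' θ (integrable_const (g θ))
  simp only [smul_sub]
  rw [integral_sub hi1 hi2, integral_smul_const, smul_sub, smul_smul,
    integral_poissonKernel_circleMap hr', one_smul, sub_add_cancel]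

/-! ### Norms on circles -/

theorem ennreal_ofReal_ne_zero_of_pos {p : ℝ} (hp : 0 < p) : ENNReal.ofReal p ≠ 0 := by
  simpa using hp

/-- The `L^p` norm of `F` on the circle of radius `r`. -/
def radNorm (p : ℝ) (F : ℂ → ℂ) (r : ℝ) : ℝ≥0∞ :=
  eLpNorm (fun θ => F (circleMap 0 r θ)) (ENNReal.ofReal p) circ

theorem eLpNorm_circ_rpow {p : ℝ} (hp : 0 < p) (g : ℝ → ℂ) :
    eLpNorm g (ENNReal.ofReal p) circ ^ p = ∫⁻ θ, ‖g θ‖ₑ ^ p ∂circ := by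
  rw [eLpNorm_eq_lintegral_rpow_enorm_toReal (ennreal_ofReal_ne_zero_of_pos hp) ENNReal.ofReal_ne_top,
    ENNReal.toReal_ofReal hp.le, ← ENNReal.rpow_mul, one_div_mul_cancel hp.ne', ENNReal.rpow_one]

theorem circleMean_zero_weight {p : ℝ} (hp : 0 < p) (F : ℂ → ℂ) (r : ℝ) :
    circleMean p 0 F r ^ (1 / p) = radNorm p F r := by
  have : circleMean p 0 F r = radNorm p F r ^ p := by
    rw [radNorm, eLpNorm_circ_rpow hp]
    simp [circleMean]
  rw [this, ← ENNReal.rpow_mul, mul_one_div_cancel hp.ne', ENNReal.rpow_one]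

theorem hardyENorm_zero_weight_le_iff {p : ℝ} (hp : 0 < p) {F : ℂ → ℂ} {C : ℝ≥0∞} :
    hardyENorm p 0 F ≤ C ↔ ∀ r ∈ Ico (0 : ℝ) 1, radNorm p F r ≤ C := by
  simp only [hardyENorm_le_iff hp, circleMean_zero_weight hp]

theorem memLp_circ_of_continuous {g : ℝ → ℂ} (hg : Continuous g) (p : ℝ≥0∞) :
    MemLp g p circ := by
  obtain ⟨B, hB⟩ := (isCompact_Icc (a := (0 : ℝ)) (b := 2 * Real.pi)).exists_bound_of_continuousOn
    hg.continuousOn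
  exact MemLp.of_bound hg.aestronglyMeasurable B ((ae_restrict_iff' measurableSet_Ioc).2
    (Eventually.of_forall fun t ht => hB t (Ioc_subset_Icc_self ht)))

theorem continuous_comp_circleMap_one {G : ℂ → ℂ} (hG : ContinuousOn G (Metric.sphere 0 1)) :
    Continuous fun θ => G (circleMap 0 1 θ) :=
  hG.comp_continuous (continuous_circleMap 0 1) fun θ => circleMap_mem_sphere 0 zero_le_one θ

/-- Jensen's inequality for averages against a doubly stochastic kernel. -/
theorem lintegral_kernel_rpow_le {α : Type*} [MeasurableSpace α] {μ : Measure α} [SFinite μ]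
    {p : ℝ} (hp : 1 < p) {K : α → α → ℝ≥0∞} (hKm : Measurable fun x : α × α => K x.1 x.2)
    (hK1 : ∀ θ, ∫⁻ t, K θ t ∂μ = 1) (hK2 : ∀ t, ∫⁻ θ, K θ t ∂μ = 1) {g : α → ℝ≥0∞}
    (hg : Measurable g) :
    ∫⁻ θ, (∫⁻ t, K θ t * g t ∂μ) ^ p ∂μ ≤ ∫⁻ t, g t ^ p ∂μ := by
  have hKm1 : ∀ θ, Measurable (K θ) := fun θ => hKm.comp measurable_prodMk_left
  have hp0 : 0 < p := by linarith
  have hpq := Real.HolderConjugate.conjExponent hp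
  set q := p.conjExponent
  -- Hölder applied to $K g=(K^{1/p}g)\cdot K^{1/q}$; the second factor has norm one.
  have hpt : ∀ θ, (∫⁻ t, K θ t * g t ∂μ) ^ p ≤ ∫⁻ t, K θ t * g t ^ p ∂μ := by
    intro θ
    have h1 := ENNReal.lintegral_mul_le_Lp_mul_Lq μ hpq
      (f := fun t => K θ t ^ (1 / p) * g t) (g := fun t => K θ t ^ (1 / q))
      (((hKm1 θ).pow_const _).mul hg).aemeasurable ((hKm1 θ).pow_const _).aemeasurable
    have e1 : ∀ t, ((fun t => K θ t ^ (1 / p) * g t) * fun t => K θ t ^ (1 / q)) t =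
        K θ t * g t := by
      intro t
      simp only [Pi.mul_apply]
      rw [mul_right_comm, ← ENNReal.rpow_add_of_nonneg _ _ (one_div_nonneg.2 hp0.le)
        (one_div_nonneg.2 hpq.symm.nonneg), one_div, one_div, hpq.inv_add_inv_eq_one,
        ENNReal.rpow_one]
    have e2 : ∀ t, (K θ t ^ (1 / p) * g t) ^ p = K θ t * g t ^ p := by
      intro t
      rw [ENNReal.mul_rpow_of_nonneg _ _ hp0.le, ← ENNReal.rpow_mul, one_div_mul_cancel hp0.ne',
        ENNReal.rpow_one]
    have e3 : ∀ t, (K θ t ^ (1 / q)) ^ q = K θ t := by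
      intro t
      rw [← ENNReal.rpow_mul, one_div_mul_cancel hpq.symm.ne_zero, ENNReal.rpow_one]
    simp only [e1, e2, e3, hK1, ENNReal.one_rpow, mul_one] at h1
    calc _ ≤ ((∫⁻ t, K θ t * g t ^ p ∂μ) ^ (1 / p)) ^ p := by gcongr
      _ = _ := by rw [← ENNReal.rpow_mul, one_div_mul_cancel hp0.ne', ENNReal.rpow_one]
  calc _ ≤ ∫⁻ θ, ∫⁻ t, K θ t * g t ^ p ∂μ ∂μ := lintegral_mono hpt
    _ = ∫⁻ t, ∫⁻ θ, K θ t * g t ^ p ∂μ ∂μ :=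
      lintegral_lintegral_swap (hKm.mul ((hg.pow_const p).comp measurable_snd)).aemeasurable
    _ = ∫⁻ t, g t ^ p ∂μ := by
      refine lintegral_congr fun t => ?_
      rw [lintegral_mul_const (f := fun θ => K θ t) _ (hKm.comp measurable_prodMk_right), hK2,
        one_mul]

theorem lintegral_poissonKernel {r : ℝ} (hr : r ∈ Ico (0 : ℝ) 1) (θ : ℝ) :
    ∫⁻ t, ENNReal.ofReal ((2 * Real.pi)⁻¹ *
      poissonKernel 0 (circleMap 0 r θ) (circleMap 0 1 t)) ∂circ = 1 := by
  have hi : Integrable (fun t => (2 * Real.pi)⁻¹ *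
      poissonKernel 0 (circleMap 0 r θ) (circleMap 0 1 t)) circ := by
    have := (integrable_poissonKernel_smul hr θ (integrable_const (1 : ℂ))).re
    refine Integrable.const_mul ?_ _
    simpa using this
  rw [← ofReal_integral_eq_lintegral_ofReal hi (Eventually.of_forall fun t =>
    mul_nonneg (by positivity) (poissonKernel_circleMap_nonneg hr θ t)),
    integral_const_mul, integral_poissonKernel_circleMap hr, ENNReal.ofReal_one]

/-- The Poisson kernel is symmetric in the two angles, hence doubly stochastic. -/
theorem lintegral_poisson_rpow_le {p : ℝ} (hp : 1 < p) {r : ℝ} (hr : r ∈ Ico (0 : ℝ) 1)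
    {g : ℝ → ℝ≥0∞} (hg : Measurable g) :
    ∫⁻ θ, (∫⁻ t, ENNReal.ofReal ((2 * Real.pi)⁻¹ *
      poissonKernel 0 (circleMap 0 r θ) (circleMap 0 1 t)) * g t ∂circ) ^ p ∂circ ≤
      ∫⁻ t, g t ^ p ∂circ := by
  refine lintegral_kernel_rpow_le (K := fun θ t => ENNReal.ofReal ((2 * Real.pi)⁻¹ *
      poissonKernel 0 (circleMap 0 r θ) (circleMap 0 1 t))) hp ?_ ?_ ?_ hg
  · exact ((continuous_poissonKernel_circleMap hr).measurable.const_mul _).ennreal_ofReal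
  · exact lintegral_poissonKernel hr
  · intro t
    simp only [poissonKernel_circleMap_swap r _ t]
    exact lintegral_poissonKernel hr t

theorem radNorm_le_of_enorm_le_poisson {p : ℝ} (hp : 1 < p) {r : ℝ} (hr : r ∈ Ico (0 : ℝ) 1)
    {F G : ℂ → ℂ} (hG : ContinuousOn G (Metric.sphere 0 1))
    (hFG : ∀ θ, F (circleMap 0 r θ) = (2 * Real.pi)⁻¹ •
      ∫ t, poissonKernel 0 (circleMap 0 r θ) (circleMap 0 1 t) • G (circleMap 0 1 t) ∂circ) :
    radNorm p F r ≤ radNorm p G 1 := by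
  have hp0 : 0 < p := by linarith
  rw [← ENNReal.rpow_le_rpow_iff hp0, radNorm, radNorm, eLpNorm_circ_rpow hp0,
    eLpNorm_circ_rpow hp0]
  refine le_trans (lintegral_mono fun θ => ?_)
    (lintegral_poisson_rpow_le hp hr (continuous_comp_circleMap_one hG).enorm.measurable)
  simp only
  gcongr
  rw [hFG, ← integral_smul]
  refine (enorm_integral_le_lintegral_enorm _).trans (lintegral_mono fun t => ?_)
  rw [smul_smul, enorm_smul, Real.enorm_of_nonneg
    (mul_nonneg (by positivity) (poissonKernel_circleMap_nonneg hr θ t))]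

theorem eq_poissonIntegral {F : ℂ → ℂ} (hF : DiffContOnCl ℂ F (Metric.ball 0 1)) {z : ℂ}
    (hz : z ∈ Metric.ball (0 : ℂ) 1) :
    F z = (2 * Real.pi)⁻¹ •
      ∫ t, poissonKernel 0 z (circleMap 0 1 t) • F (circleMap 0 1 t) ∂circ := by
  rw [← hF.circleAverage_poissonKernel_smul hz, circleAverage_eq_integral_circ]
  rfl

theorem radNorm_le_radNorm_one {p : ℝ} (hp : 1 < p) {F : ℂ → ℂ}
    (hF : DiffContOnCl ℂ F (Metric.ball 0 1)) {r : ℝ} (hr : r ∈ Ico (0 : ℝ) 1) :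
    radNorm p F r ≤ radNorm p F 1 := by
  refine radNorm_le_of_enorm_le_poisson hp hr (hF.continuousOn_ball.mono ?_) fun θ =>
    eq_poissonIntegral hF (circleMap_mem hr θ)
  exact Metric.sphere_subset_closedBall

theorem diffContOnCl_comp_mul {F : ℂ → ℂ} (hF : DifferentiableOn ℂ F (Metric.ball 0 1)) {s : ℝ}
    (hs : s ∈ Ico (0 : ℝ) 1) : DiffContOnCl ℂ (fun z => F (s * z)) (Metric.ball 0 1) := by
  refine DifferentiableOn.diffContOnCl ?_
  rw [closure_ball (0 : ℂ) one_ne_zero]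
  refine hF.comp (by fun_prop) fun z hz => ?_
  simp only [mem_closedBall_zero_iff, mem_ball_zero_iff, norm_mul, Complex.norm_real,
    Real.norm_of_nonneg hs.1] at *
  nlinarith [hs.1, hs.2, norm_nonneg z]

theorem ofReal_mul_circleMap (s r θ : ℝ) : (s : ℂ) * circleMap 0 r θ = circleMap 0 (s * r) θ := by
  simp [circleMap, mul_assoc]

theorem radNorm_comp_mul (p : ℝ) (F : ℂ → ℂ) (s r : ℝ) :
    radNorm p (fun z => F (s * z)) r = radNorm p F (s * r) := by
  simp only [radNorm, ofReal_mul_circleMap]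

/-- The dilate $z\mapsto F(sz)$ is continuous up to the unit circle, so the comparison with radius
one applies to it at radius $r/s$. -/
theorem radNorm_mono {p : ℝ} (hp : 1 < p) {F : ℂ → ℂ}
    (hF : DifferentiableOn ℂ F (Metric.ball 0 1)) {r s : ℝ} (hr : 0 ≤ r) (hrs : r ≤ s)
    (hs : s < 1) : radNorm p F r ≤ radNorm p F s := by
  rcases hrs.eq_or_lt with rfl | hlt
  · exact le_rfl
  have hs0 : 0 < s := hr.trans_lt hlt
  have := radNorm_le_radNorm_one hp (diffContOnCl_comp_mul hF ⟨hs0.le, hs⟩) (r := r / s)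
    ⟨by positivity, by rwa [div_lt_one hs0]⟩
  rwa [radNorm_comp_mul, radNorm_comp_mul, mul_div_cancel₀ _ hs0.ne', mul_one] at this

/-! ### Uniform convexity -/

/-- Two sources of strictness: if $|a|\ne|b|$ it is the strict convexity of $t^p$, and if $|a|=|b|$
it is that of the Euclidean norm. -/
theorem norm_midpoint_rpow_le {p : ℝ} (hp : 1 < p) (a b : ℂ) :
    ‖(a + b) / 2‖ ^ p ≤ (‖a‖ ^ p + ‖b‖ ^ p) / 2 ∧
      (a ≠ b → ‖(a + b) / 2‖ ^ p < (‖a‖ ^ p + ‖b‖ ^ p) / 2) := by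
  have hp0 : 0 < p := by linarith
  have h1 : ‖(a + b) / 2‖ ≤ (‖a‖ + ‖b‖) / 2 := by
    rw [norm_div, Complex.norm_ofNat]
    gcongr
    exact norm_add_le _ _
  by_cases hab : ‖a‖ = ‖b‖
  · have h2 : (‖a‖ ^ p + ‖b‖ ^ p) / 2 = ‖a‖ ^ p := by rw [hab]; ring
    rw [h2]
    refine ⟨?_, fun hne => ?_⟩
    · gcongr
      linarith
    · refine Real.rpow_lt_rpow (norm_nonneg _) ?_ hp0
      have e : (a + b) / 2 = (1 / 2 : ℝ) • (a + b) := by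
        rw [Complex.real_smul]
        push_cast
        ring
      rw [e]
      exact (norm_midpoint_lt_iff hab).2 hne
  · have h2 := (strictConvexOn_rpow hp).2 (mem_Ici.2 (norm_nonneg a)) (mem_Ici.2 (norm_nonneg b))
      hab (show (0 : ℝ) < 1 / 2 by norm_num) (show (0 : ℝ) < 1 / 2 by norm_num) (by norm_num)
    simp only [smul_eq_mul] at h2
    have h3 : ‖(a + b) / 2‖ ^ p < (‖a‖ ^ p + ‖b‖ ^ p) / 2 := by
      calc ‖(a + b) / 2‖ ^ p ≤ (1 / 2 * ‖a‖ + 1 / 2 * ‖b‖) ^ p := by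
            gcongr
            linarith
        _ < _ := by linarith
    exact ⟨h3.le, fun _ => h3⟩

/-- A quantitative uniform convexity that serves all $p>1$ at once. Both sides are homogeneous of
degree $p$, so compactness of the unit sphere of $\mathbb C\times\mathbb C$ suffices: where
$|a-b|^p\ge\varepsilon(|a|^p+|b|^p)$ one has $a\ne b$, and the midpoint deficit attains a positive
minimum. -/
theorem exists_norm_sub_rpow_le {p : ℝ} (hp : 1 < p) {ε : ℝ} (hε : 0 < ε) :
    ∃ K > 0, ∀ a b : ℂ, ‖a - b‖ ^ p ≤ ε * (‖a‖ ^ p + ‖b‖ ^ p) +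
      K * ((‖a‖ ^ p + ‖b‖ ^ p) / 2 - ‖(a + b) / 2‖ ^ p) := by
  have hp0 : 0 < p := by linarith
  have hc : ∀ {f : ℂ × ℂ → ℂ}, Continuous f → Continuous fun x => ‖f x‖ ^ p := fun hf =>
    hf.norm.rpow_const fun _ => Or.inr hp0.le
  set D : ℂ × ℂ → ℝ := fun x => (‖x.1‖ ^ p + ‖x.2‖ ^ p) / 2 - ‖(x.1 + x.2) / 2‖ ^ p with hD
  have hDc : Continuous D :=
    (((hc continuous_fst).add (hc continuous_snd)).div_const 2).sub (hc (by fun_prop))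
  set T : Set (ℂ × ℂ) := Metric.sphere 0 1 ∩
    {x | ε * (‖x.1‖ ^ p + ‖x.2‖ ^ p) ≤ ‖x.1 - x.2‖ ^ p} with hT
  have hTc : IsCompact T := (isCompact_sphere 0 1).inter_right
    (isClosed_le (continuous_const.mul ((hc continuous_fst).add (hc continuous_snd)))
      (hc (by fun_prop)))
  have hne : ∀ x ∈ Metric.sphere (0 : ℂ × ℂ) 1, 0 < ‖x.1‖ ^ p + ‖x.2‖ ^ p := by
    intro x hx
    rw [mem_sphere_zero_iff_norm, Prod.norm_def] at hx
    rcases max_choice ‖x.1‖ ‖x.2‖ with h | h <;> rw [h] at hx <;> rw [hx] <;> simp <;> positivity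
  obtain ⟨δ, hδ, hδT⟩ : ∃ δ > 0, ∀ x ∈ T, δ ≤ D x := by
    rcases T.eq_empty_or_nonempty with h | h
    · exact ⟨1, one_pos, by simp [h]⟩
    · obtain ⟨x, hx, hmin⟩ := hTc.exists_isMinOn h hDc.continuousOn
      refine ⟨D x, ?_, fun y hy => hmin hy⟩
      refine sub_pos.2 ((norm_midpoint_rpow_le hp x.1 x.2).2 fun heq => ?_)
      have h1 := hx.2
      simp only [mem_ofPred_eq, heq, sub_self, norm_zero, Real.zero_rpow hp0.ne'] at h1
      have := mul_pos hε (hne x hx.1)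
      rw [heq] at this
      linarith
  -- On the sphere $|a-b|\le2$, while the deficit on $T$ is at least $\delta$.
  refine ⟨2 ^ p / δ, by positivity, fun a b => ?_⟩
  have hsphere : ∀ x ∈ Metric.sphere (0 : ℂ × ℂ) 1, ‖x.1 - x.2‖ ^ p ≤
      ε * (‖x.1‖ ^ p + ‖x.2‖ ^ p) + 2 ^ p / δ * D x := by
    intro x hx
    have hD0 : 0 ≤ D x := sub_nonneg.2 (norm_midpoint_rpow_le hp x.1 x.2).1
    by_cases hxT : ε * (‖x.1‖ ^ p + ‖x.2‖ ^ p) ≤ ‖x.1 - x.2‖ ^ p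
    · have h1 := hδT x ⟨hx, hxT⟩
      have h2 : ‖x.1 - x.2‖ ^ p ≤ 2 ^ p := by
        gcongr
        rw [mem_sphere_zero_iff_norm, Prod.norm_def] at hx
        have h3 := le_max_left ‖x.1‖ ‖x.2‖
        have h4 := le_max_right ‖x.1‖ ‖x.2‖
        linarith [norm_sub_le x.1 x.2]
      have h3 : (2 : ℝ) ^ p ≤ 2 ^ p / δ * D x := by
        rw [div_mul_eq_mul_div, le_div_iff₀ hδ]
        gcongr
      have := mul_pos hε (hne x hx)
      linarith
    · have : 0 ≤ 2 ^ p / δ * D x := by positivity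
      linarith
  by_cases h0 : ((a, b) : ℂ × ℂ) = 0
  · obtain ⟨rfl, rfl⟩ := Prod.mk_eq_zero.1 h0
    simp [Real.zero_rpow hp0.ne']
  set m := ‖((a, b) : ℂ × ℂ)‖ with hm
  have hm0 : 0 < m := norm_pos_iff.2 h0
  have h1 := hsphere (m⁻¹ • (a, b)) (by
    rw [mem_sphere_zero_iff_norm, norm_smul, norm_inv, Real.norm_of_nonneg hm0.le, ← hm,
      inv_mul_cancel₀ hm0.ne'])
  have hs : ∀ c : ℂ, ‖m⁻¹ • c‖ ^ p = (m⁻¹) ^ p * ‖c‖ ^ p := fun c => by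
    rw [norm_smul, Real.norm_of_nonneg (by positivity), Real.mul_rpow (by positivity)
      (norm_nonneg _)]
  have e : (m⁻¹ • a + m⁻¹ • b) / 2 = m⁻¹ • ((a + b) / 2) := by
    rw [← smul_add, smul_div_assoc]
  simp only [hD, Prod.smul_mk, ← smul_sub, e, hs] at h1
  have hm1 : 0 < m⁻¹ ^ p := by positivity
  refine le_of_mul_le_mul_left (h1.trans (le_of_eq ?_)) hm1
  ring

/-! ### Boundary functions -/

theorem exists_memLp_tendsto_eLpNorm {α ι : Type*} [MeasurableSpace α] {μ : Measure α} {p : ℝ≥0∞}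
    [Fact (1 ≤ p)] {l : Filter ι} [l.NeBot] {f : ι → α → ℂ} (hf : ∀ i, MemLp (f i) p μ)
    (hc : Tendsto (fun x : ι × ι => eLpNorm (f x.1 - f x.2) p μ) (l ×ˢ l) (𝓝 0)) :
    ∃ g, MemLp g p μ ∧ Tendsto (fun i => eLpNorm (f i - g) p μ) l (𝓝 0) := by
  have hC : Cauchy (map (fun i => (hf i).toLp (f i)) l) := by
    rw [Metric.cauchy_iff]
    refine ⟨inferInstance, fun ε hε => ?_⟩
    have h1 := hc.eventually (gt_mem_nhds (ENNReal.ofReal_pos.2 hε))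
    obtain ⟨s, hs, hs'⟩ := eventually_prod_self_iff
      (r := fun i j => eLpNorm (f i - f j) p μ < ENNReal.ofReal ε).1 h1
    refine ⟨_, image_mem_map hs, ?_⟩
    rintro _ ⟨i, hi, rfl⟩ _ ⟨j, hj, rfl⟩
    have h2 : eLpNorm (f i - f j) p μ < ENNReal.ofReal ε := hs' i hi j hj
    exact edist_lt_ofReal.1 ((Lp.edist_toLp_toLp (f i) (f j) (hf i) (hf j)).trans_lt h2)
  obtain ⟨g, hg⟩ := CompleteSpace.complete hC
  have hg' : Tendsto (fun i => (hf i).toLp (f i)) l (𝓝 ((Lp.memLp g).toLp g)) := by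
    rw [Lp.toLp_coeFn g (Lp.memLp g)]
    exact hg
  exact ⟨g, Lp.memLp g, (Lp.tendsto_Lp_iff_tendsto_eLpNorm'' f hf g (Lp.memLp g)).1 hg'⟩

theorem integrable_circ_of_continuous {u : ℝ → ℝ} (hu : Continuous u) : Integrable u circ :=
  hu.integrableOn_Ioc

theorem eLpNorm_circ_rpow_of_continuous {p : ℝ} (hp : 0 < p) {u : ℝ → ℂ} (hu : Continuous u) :
    eLpNorm u (ENNReal.ofReal p) circ ^ p = ENNReal.ofReal (∫ θ, ‖u θ‖ ^ p ∂circ) := by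
  rw [eLpNorm_circ_rpow hp, ofReal_integral_eq_lintegral_ofReal
    (integrable_circ_of_continuous (hu.norm.rpow_const fun _ => Or.inr hp.le))
    (Eventually.of_forall fun θ => by positivity)]
  refine lintegral_congr fun θ => ?_
  rw [← ENNReal.ofReal_rpow_of_nonneg (norm_nonneg _) hp.le, ofReal_norm]

theorem eventually_mem_Ioo_prod : ∀ᶠ x : ℝ × ℝ in 𝓝[<] 1 ×ˢ 𝓝[<] 1,
    x.1 ∈ Ioo (0 : ℝ) 1 ∧ x.2 ∈ Ioo (0 : ℝ) 1 := by
  have h : ∀ᶠ r in 𝓝[<] (1 : ℝ), r ∈ Ioo (0 : ℝ) 1 := Ioo_mem_nhdsLT one_pos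
  exact h.prod_mk h

theorem integral_norm_sub_rpow_le {p : ℝ} (hp : 0 < p) {ε K : ℝ}
    (h : ∀ a b : ℂ, ‖a - b‖ ^ p ≤ ε * (‖a‖ ^ p + ‖b‖ ^ p) +
      K * ((‖a‖ ^ p + ‖b‖ ^ p) / 2 - ‖(a + b) / 2‖ ^ p))
    {u v : ℝ → ℂ} (hu : Continuous u) (hv : Continuous v) :
    ∫ θ, ‖u θ - v θ‖ ^ p ∂circ ≤
      ε * (∫ θ, ‖u θ‖ ^ p ∂circ + ∫ θ, ‖v θ‖ ^ p ∂circ) +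
      K * ((∫ θ, ‖u θ‖ ^ p ∂circ + ∫ θ, ‖v θ‖ ^ p ∂circ) / 2 -
        ∫ θ, ‖(u θ + v θ) / 2‖ ^ p ∂circ) := by
  have hi : ∀ {w : ℝ → ℂ}, Continuous w → Integrable (fun θ => ‖w θ‖ ^ p) circ := fun hw =>
    integrable_circ_of_continuous (hw.norm.rpow_const fun _ => Or.inr hp.le)
  have i12 := (hi hu).add (hi hv)
  have i3 : Integrable (fun θ => ‖(u θ + v θ) / 2‖ ^ p) circ := hi (by fun_prop)
  have i4 : Integrable (fun θ => ‖u θ - v θ‖ ^ p) circ := hi (by fun_prop)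
  calc _ ≤ ∫ θ, ε * (‖u θ‖ ^ p + ‖v θ‖ ^ p) +
        K * ((‖u θ‖ ^ p + ‖v θ‖ ^ p) / 2 - ‖(u θ + v θ) / 2‖ ^ p) ∂circ :=
        integral_mono i4 ((i12.const_mul ε).add (((i12.div_const 2).sub i3).const_mul K))
          fun θ => h (u θ) (v θ)
    _ = ∫ θ, ε * (‖u θ‖ ^ p + ‖v θ‖ ^ p) ∂circ +
        ∫ θ, K * ((‖u θ‖ ^ p + ‖v θ‖ ^ p) / 2 - ‖(u θ + v θ) / 2‖ ^ p) ∂circ :=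
        integral_add (i12.const_mul ε) (((i12.div_const 2).sub i3).const_mul K)
    _ = ε * ∫ θ, ‖u θ‖ ^ p + ‖v θ‖ ^ p ∂circ +
        K * (∫ θ, (‖u θ‖ ^ p + ‖v θ‖ ^ p) / 2 ∂circ - ∫ θ, ‖(u θ + v θ) / 2‖ ^ p ∂circ) := by
        rw [integral_const_mul, integral_const_mul]
        congr 2
        exact integral_sub (i12.div_const 2) i3
    _ = _ := by
        rw [integral_div, integral_add (hi hu) (hi hv)]

/-- The circle restrictions of a holomorphic function with bounded `L^p` means are Cauchy. -/
theorem tendsto_eLpNorm_circle_sub {p : ℝ} (hp : 1 < p) {F : ℂ → ℂ}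
    (hF : DifferentiableOn ℂ F (Metric.ball 0 1)) {C : ℝ≥0∞} (hC : C ≠ ∞)
    (hb : ∀ r ∈ Ico (0 : ℝ) 1, radNorm p F r ≤ C) :
    Tendsto (fun x : ℝ × ℝ => eLpNorm ((fun θ => F (circleMap 0 x.1 θ)) -
      fun θ => F (circleMap 0 x.2 θ)) (ENNReal.ofReal p) circ) (𝓝[<] 1 ×ˢ 𝓝[<] 1) (𝓝 0) := by
  have hp0 : 0 < p := by linarith
  have hcF : ∀ {r : ℝ}, r ∈ Ico (0 : ℝ) 1 → Continuous fun θ => F (circleMap 0 r θ) :=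
    fun hr => continuous_comp_circleMap hF hr
  set I : ℝ → ℝ := fun r => ∫ θ, ‖F (circleMap 0 r θ)‖ ^ p ∂circ with hI
  set mid : ℝ × ℝ → ℝ := fun x =>
    ∫ θ, ‖(F (circleMap 0 x.1 θ) + F (circleMap 0 x.2 θ)) / 2‖ ^ p ∂circ with hmid
  have hI0 : ∀ r, 0 ≤ I r := fun r => integral_nonneg fun θ => by positivity
  have hIB : ∀ r ∈ Ico (0 : ℝ) 1, I r ≤ (C ^ p).toReal := by
    intro r hr
    rw [← ENNReal.ofReal_le_iff_le_toReal (by simp [hC, hp0.le]),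
      ← eLpNorm_circ_rpow_of_continuous hp0 (hcF hr)]
    gcongr
    exact hb r hr
  have hbdd : BddAbove (I '' Ico (0 : ℝ) 1) := ⟨(C ^ p).toReal, by
    rintro _ ⟨r, hr, rfl⟩
    exact hIB r hr⟩
  set N := sSup (I '' Ico (0 : ℝ) 1)
  have hIN : ∀ r ∈ Ico (0 : ℝ) 1, I r ≤ N := fun r hr => le_csSup hbdd (mem_image_of_mem I hr)
  have hN0 : 0 ≤ N := (hI0 0).trans (hIN 0 ⟨le_rfl, one_pos⟩)
  have hIcont : ∀ {u : ℝ → ℂ}, Continuous u → Integrable (fun θ => ‖u θ‖ ^ p) circ := fun hu =>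
    integrable_circ_of_continuous (hu.norm.rpow_const fun _ => Or.inr hp0.le)
  -- The midpoint $(F(rz)+F(sz))/2$ is itself holomorphic, so its means increase with the radius.
  have hmid_mono : ∀ ρ ∈ Ico (0 : ℝ) 1, ∀ r ∈ Ico (0 : ℝ) 1, ∀ s ∈ Ico (0 : ℝ) 1,
      mid (r * ρ, s * ρ) ≤ mid (r, s) := by
    intro ρ hρ r hr s hs
    have hG : DiffContOnCl ℂ (fun z => (F (r * z) + F (s * z)) / 2) (Metric.ball 0 1) := by
      simp only [div_eq_mul_inv, mul_comm _ (2 : ℂ)⁻¹]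
      exact ((diffContOnCl_comp_mul hF hr).add (diffContOnCl_comp_mul hF hs)).const_smul (2 : ℂ)⁻¹
    have h1 := radNorm_le_radNorm_one hp hG hρ
    have hrρ : r * ρ ∈ Ico (0 : ℝ) 1 :=
      ⟨mul_nonneg hr.1 hρ.1, by nlinarith [hr.1, hr.2, hρ.1, hρ.2]⟩
    have hsρ : s * ρ ∈ Ico (0 : ℝ) 1 :=
      ⟨mul_nonneg hs.1 hρ.1, by nlinarith [hs.1, hs.2, hρ.1, hρ.2]⟩
    rw [← ENNReal.rpow_le_rpow_iff hp0] at h1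
    simp only [radNorm, ofReal_mul_circleMap, mul_one] at h1
    have hc : ∀ {r s : ℝ}, r ∈ Ico (0 : ℝ) 1 → s ∈ Ico (0 : ℝ) 1 →
        Continuous fun θ => (F (circleMap 0 r θ) + F (circleMap 0 s θ)) / 2 :=
      fun hr hs => ((hcF hr).add (hcF hs)).div_const 2
    rw [eLpNorm_circ_rpow_of_continuous hp0 (hc hrρ hsρ),
      eLpNorm_circ_rpow_of_continuous hp0 (hc hr hs)] at h1
    exact (ENNReal.ofReal_le_ofReal_iff (integral_nonneg fun θ => by positivity)).1 h1
  -- On the fixed circle of radius $\rho$ both dilates tend to $F$. Hence the midpoint means near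
  -- the boundary are eventually almost as large as $I(\rho)$, and $I(\rho)$ can be taken close to
  -- the supremum $N$.
  have hmid_lim : ∀ ρ ∈ Ico (0 : ℝ) 1, Tendsto (fun x : ℝ × ℝ => mid (x.1 * ρ, x.2 * ρ))
      (𝓝[<] 1 ×ˢ 𝓝[<] 1) (𝓝 (I ρ)) := by
    intro ρ hρ
    have hsub : Metric.closedBall (0 : ℂ) ρ ⊆ Metric.ball 0 1 :=
      Metric.closedBall_subset_ball hρ.2
    obtain ⟨M, hM⟩ := (isCompact_closedBall (0 : ℂ) ρ).exists_bound_of_continuousOn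
      (hF.continuousOn.mono hsub)
    have hin : ∀ r ∈ Ioo (0 : ℝ) 1, ∀ θ, circleMap 0 (r * ρ) θ ∈ Metric.closedBall (0 : ℂ) ρ := by
      intro r hr θ
      rw [mem_closedBall_zero_iff, norm_circleMap_zero, abs_of_nonneg (mul_nonneg hr.1.le hρ.1)]
      nlinarith [hr.1, hr.2, hρ.1]
    refine tendsto_integral_filter_of_dominated_convergence (fun _ => M ^ p) ?_ ?_
      (integrable_const _) ?_
    · filter_upwards [eventually_mem_Ioo_prod] with x hx
      have h1 : x.1 * ρ ∈ Ico (0 : ℝ) 1 :=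
        ⟨mul_nonneg hx.1.1.le hρ.1, by nlinarith [hx.1.1, hx.1.2, hρ.1, hρ.2]⟩
      have h2 : x.2 * ρ ∈ Ico (0 : ℝ) 1 :=
        ⟨mul_nonneg hx.2.1.le hρ.1, by nlinarith [hx.2.1, hx.2.2, hρ.1, hρ.2]⟩
      exact (hIcont (((hcF h1).add (hcF h2)).div_const 2)).aestronglyMeasurable
    · filter_upwards [eventually_mem_Ioo_prod] with x hx
      refine Eventually.of_forall fun θ => ?_
      rw [Real.norm_of_nonneg (by positivity)]
      gcongr
      rw [norm_div, Complex.norm_ofNat, div_le_iff₀ two_pos]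
      linarith [norm_add_le (F (circleMap 0 (x.1 * ρ) θ)) (F (circleMap 0 (x.2 * ρ) θ)),
        hM _ (hin _ hx.1 θ), hM _ (hin _ hx.2 θ)]
    · refine Eventually.of_forall fun θ => ?_
      have hat : Tendsto (fun r : ℝ => F (circleMap 0 (r * ρ) θ)) (𝓝[<] 1)
          (𝓝 (F (circleMap 0 ρ θ))) := by
        have h1 : ContinuousAt F (circleMap 0 ρ θ) :=
          (hF.differentiableAt (Metric.isOpen_ball.mem_nhds (circleMap_mem hρ θ))).continuousAt
        have h2 : Continuous fun r : ℝ => circleMap 0 (r * ρ) θ := by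
          simp only [circleMap]
          fun_prop
        have h3 := (h2.tendsto 1).mono_left (nhdsWithin_le_nhds (s := Iio 1))
        rw [one_mul] at h3
        exact h1.tendsto.comp h3
      have h1 := ((hat.comp (tendsto_fst (g := 𝓝[<] (1 : ℝ)))).add
        (hat.comp (tendsto_snd (f := 𝓝[<] (1 : ℝ))))).div_const (2 : ℂ)
      rw [add_self_div_two] at h1
      exact (h1.norm).rpow_const (Or.inr hp0.le)
  have hJ : Tendsto (fun x : ℝ × ℝ =>
      ∫ θ, ‖F (circleMap 0 x.1 θ) - F (circleMap 0 x.2 θ)‖ ^ p ∂circ)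
      (𝓝[<] 1 ×ˢ 𝓝[<] 1) (𝓝 0) := by
    rw [tendsto_order]
    refine ⟨fun a ha => Eventually.of_forall fun x =>
      ha.trans_le (integral_nonneg fun θ => by positivity), fun ε hε => ?_⟩
    -- As $I\le N$, the first term stays below $\varepsilon/2$. Two losses of $\varepsilon/(4K)$, in
    -- choosing $\rho$ and in passing to the limit, bound the midpoint deficit by
    -- $\varepsilon/(2K)$.
    obtain ⟨K, hK, hKin⟩ := exists_norm_sub_rpow_le hp (ε := ε / (4 * (N + 1))) (by positivity)
    obtain ⟨_, ⟨ρ, hρ, rfl⟩, hρN⟩ := exists_lt_of_lt_csSup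
      (s := I '' Ico (0 : ℝ) 1) ⟨_, mem_image_of_mem I ⟨le_rfl, one_pos⟩⟩
      (show N - ε / (4 * K) < N by
        have : 0 < ε / (4 * K) := by positivity
        linarith)
    filter_upwards [eventually_mem_Ioo_prod, (hmid_lim ρ hρ).eventually (lt_mem_nhds (show I ρ - ε / (4 * K) < I ρ by
        have : 0 < ε / (4 * K) := by positivity
        linarith))] with x hx hx'
    have hx1 : x.1 ∈ Ico (0 : ℝ) 1 := ⟨hx.1.1.le, hx.1.2⟩
    have hx2 : x.2 ∈ Ico (0 : ℝ) 1 := ⟨hx.2.1.le, hx.2.2⟩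
    have h1 : mid (x.1 * ρ, x.2 * ρ) ≤ mid x := hmid_mono ρ hρ x.1 hx1 x.2 hx2
    have h2 : ∫ θ, ‖F (circleMap 0 x.1 θ) - F (circleMap 0 x.2 θ)‖ ^ p ∂circ ≤
        ε / (4 * (N + 1)) * (I x.1 + I x.2) + K * ((I x.1 + I x.2) / 2 - mid x) :=
      integral_norm_sub_rpow_le hp0 hKin (hcF hx1) (hcF hx2)
    have h3 : ε / (4 * (N + 1)) * (I x.1 + I x.2) < ε / 2 := by
      rw [div_mul_eq_mul_div, div_lt_iff₀ (by positivity)]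
      nlinarith [hIN _ hx1, hIN _ hx2]
    have h4 : K * ((I x.1 + I x.2) / 2 - mid x) ≤ ε / 2 := by
      have h5 : (I x.1 + I x.2) / 2 - mid x ≤ ε / (2 * K) := by
        have : ε / (4 * K) + ε / (4 * K) = ε / (2 * K) := by field_simp; ring
        linarith [hIN _ hx1, hIN _ hx2]
      calc _ ≤ K * (ε / (2 * K)) := by gcongr
        _ = ε / 2 := by field_simp
    linarith
  have hJ2 : Tendsto (fun x : ℝ × ℝ => (ENNReal.ofReal
      (∫ θ, ‖F (circleMap 0 x.1 θ) - F (circleMap 0 x.2 θ)‖ ^ p ∂circ)) ^ (1 / p))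
      (𝓝[<] 1 ×ˢ 𝓝[<] 1) (𝓝 0) := by
    have h1 := (ENNReal.continuous_rpow_const (y := 1 / p)).tendsto 0
    rw [ENNReal.zero_rpow_of_pos (by positivity)] at h1
    have h2 := (ENNReal.continuous_ofReal.tendsto 0).comp hJ
    rw [ENNReal.ofReal_zero] at h2
    exact h1.comp h2
  refine hJ2.congr' ?_
  filter_upwards [eventually_mem_Ioo_prod] with x hx
  rw [← eLpNorm_circ_rpow_of_continuous hp0 (u := fun θ => F (circleMap 0 x.1 θ) -
    F (circleMap 0 x.2 θ)) ((hcF ⟨hx.1.1.le, hx.1.2⟩).sub (hcF ⟨hx.2.1.le, hx.2.2⟩)),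
    ← ENNReal.rpow_mul, mul_one_div_cancel hp0.ne', ENNReal.rpow_one]
  rfl

theorem tendsto_integral_mul {α ι : Type*} [MeasurableSpace α] {μ : Measure α} {p q : ℝ≥0∞}
    [Fact (1 ≤ p)] [Fact (1 ≤ q)] [p.HolderConjugate q] {l : Filter ι} {f h : ι → α → ℂ}
    {g k : α → ℂ} (hf : ∀ i, MemLp (f i) p μ) (hg : MemLp g p μ) (hh : ∀ i, MemLp (h i) q μ)
    (hk : MemLp k q μ) (hfg : Tendsto (fun i => eLpNorm (f i - g) p μ) l (𝓝 0))
    (hhk : Tendsto (fun i => eLpNorm (h i - k) q μ) l (𝓝 0)) :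
    Tendsto (fun i => ∫ x, f i x * h i x ∂μ) l (𝓝 (∫ x, g x * k x ∂μ)) := by
  have key : ∀ {f h : α → ℂ} (hf : MemLp f p μ) (hh : MemLp h q μ),
      (ContinuousLinearMap.mul ℂ ℂ).lpPairing μ p q (hf.toLp f) (hh.toLp h) =
        ∫ x, f x * h x ∂μ := by
    intro f h hf hh
    rw [ContinuousLinearMap.lpPairing_eq_integral]
    refine integral_congr_ae ?_
    filter_upwards [hf.coeFn_toLp, hh.coeFn_toLp] with x h1 h2
    rw [h1, h2]
    rfl
  have h1 := (Lp.tendsto_Lp_iff_tendsto_eLpNorm'' f hf g hg).2 hfg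
  have h2 := (Lp.tendsto_Lp_iff_tendsto_eLpNorm'' h hh k hk).2 hhk
  have h3 := (((ContinuousLinearMap.mul ℂ ℂ).lpPairing μ p q).continuous₂.tendsto
    (hg.toLp g, hk.toLp k)).comp (h1.prodMk_nhds h2)
  simp only [Function.uncurry, key hg hk] at h3
  exact h3.congr fun i => key (hf i) (hh i)

/-- Since $F$ is zero off the disc, all real radii are allowed, and the family of restrictions lies
in $L^p$ with no side condition. -/
theorem memLp_comp_circleMap {F : ℂ → ℂ} (hF : DifferentiableOn ℂ F (Metric.ball 0 1))
    (hF0 : ∀ z ∉ Metric.ball (0 : ℂ) 1, F z = 0) (p : ℝ≥0∞) (r : ℝ) :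
    MemLp (fun θ => F (circleMap 0 r θ)) p circ := by
  by_cases hr : |r| < 1
  · exact memLp_circ_of_continuous
      (hF.continuousOn.comp_continuous (continuous_circleMap 0 r) fun θ => by simpa using hr) p
  · have : (fun θ => F (circleMap 0 r θ)) = fun _ => 0 := by
      ext θ
      exact hF0 _ (by simpa using hr)
    rw [this]
    exact MemLp.zero

theorem fact_one_le_ofReal {p : ℝ} (hp : 1 ≤ p) : Fact (1 ≤ ENNReal.ofReal p) :=
  ⟨by simpa using hp⟩

theorem tendsto_ofReal_mul (z : ℂ) : Tendsto (fun s : ℝ => (s : ℂ) * z) (𝓝[<] 1) (𝓝 z) := by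
  have : Continuous fun s : ℝ => (s : ℂ) * z := by fun_prop
  simpa using (this.tendsto 1).mono_left (nhdsWithin_le_nhds (s := Iio 1))

/-- A holomorphic function with bounded `L^p` means converges on the boundary, both in `L^p` and
radially almost everywhere. -/
theorem exists_boundary {p : ℝ} (hp : 1 < p) {F : ℂ → ℂ}
    (hF : DifferentiableOn ℂ F (Metric.ball 0 1)) (hF0 : ∀ z ∉ Metric.ball (0 : ℂ) 1, F z = 0)
    {C : ℝ≥0∞} (hC : C ≠ ∞) (hb : ∀ r ∈ Ico (0 : ℝ) 1, radNorm p F r ≤ C) :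
    ∃ g, MemLp g (ENNReal.ofReal p) circ ∧
      Tendsto (fun r : ℝ => eLpNorm ((fun θ => F (circleMap 0 r θ)) - g) (ENNReal.ofReal p) circ)
        (𝓝[<] 1) (𝓝 0) ∧
      ∀ᵐ θ ∂circ, Tendsto (fun r : ℝ => F (circleMap 0 r θ)) (𝓝[<] 1) (𝓝 (g θ)) := by
  have hpq := Real.HolderConjugate.conjExponent hp
  have := fact_one_le_ofReal hp.le
  have := fact_one_le_ofReal hpq.symm.lt.le
  have := hpq.ennrealOfReal
  obtain ⟨g, hg, hlim⟩ := exists_memLp_tendsto_eLpNorm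
    (memLp_comp_circleMap hF hF0 (ENNReal.ofReal p)) (tendsto_eLpNorm_circle_sub hp hF hC hb)
  refine ⟨g, hg, hlim, ?_⟩
  -- Poisson's formula for the dilate $F(s\,\cdot)$, as $s\to1$: the kernel at an interior point is
  -- bounded, so $L^p$ convergence passes through the integral.
  have hrep : ∀ r ∈ Ico (0 : ℝ) 1, ∀ θ, F (circleMap 0 r θ) = (2 * Real.pi)⁻¹ •
      ∫ t, poissonKernel 0 (circleMap 0 r θ) (circleMap 0 1 t) • g t ∂circ := by
    intro r hr θ
    set z := circleMap 0 r θ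
    have hz : z ∈ Metric.ball (0 : ℂ) 1 := circleMap_mem hr θ
    have hcont : Continuous fun t => ((poissonKernel 0 z (circleMap 0 1 t) : ℝ) : ℂ) :=
      Complex.continuous_ofReal.comp (Continuous.comp
        (g := fun x : ℝ × ℝ => poissonKernel 0 (circleMap 0 r x.1) (circleMap 0 1 x.2))
        (f := fun t => (θ, t)) (continuous_poissonKernel_circleMap hr) (by fun_prop))
    have hk := memLp_circ_of_continuous hcont (ENNReal.ofReal p.conjExponent)
    have h1 := tendsto_integral_mul (memLp_comp_circleMap hF hF0 (ENNReal.ofReal p)) hg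
      (fun _ => hk) hk hlim (by simp)
    have h2 := h1.const_smul (2 * Real.pi)⁻¹
    have h3 : Tendsto (fun s : ℝ => F (s * z)) (𝓝[<] 1) (𝓝 (F z)) :=
      (hF.differentiableAt (Metric.isOpen_ball.mem_nhds hz)).continuousAt.tendsto.comp
        (tendsto_ofReal_mul z)
    have h4 : (fun s : ℝ => F (s * z)) =ᶠ[𝓝[<] 1] fun s => (2 * Real.pi)⁻¹ •
        ∫ t, F (circleMap 0 s t) * ((poissonKernel 0 z (circleMap 0 1 t) : ℝ) : ℂ) ∂circ := by
      filter_upwards [Ioo_mem_nhdsLT (zero_lt_one (α := ℝ))] with s hs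
      rw [eq_poissonIntegral (diffContOnCl_comp_mul hF ⟨hs.1.le, hs.2⟩) hz]
      simp only [ofReal_mul_circleMap, mul_one, Complex.real_smul, mul_comm]
    rw [tendsto_nhds_unique h3 (h2.congr' h4.symm)]
    simp only [Complex.real_smul, mul_comm]
  have hint : Integrable g circ := hg.integrable (Fact.out)
  filter_upwards [ae_tendsto_poissonIntegral hint] with θ hθ
  refine hθ.congr' ?_
  filter_upwards [Ioo_mem_nhdsLT (zero_lt_one (α := ℝ))] with r hr
  exact (hrep r ⟨hr.1.le, hr.2⟩ θ).symm

/-- Every real is a translate of a point of $(0,2\pi]$ by one of countably many periods, and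
translations preserve null sets. -/
theorem ae_of_ae_circ {P : ℝ → Prop} (hP : ∀ θ, ∀ n : ℤ, P (θ + n • (2 * Real.pi)) → P θ)
    (h : ∀ᵐ θ ∂circ, P θ) : ∀ᵐ θ : ℝ, P θ := by
  rw [ae_restrict_iff' measurableSet_Ioc] at h
  have h1 : ∀ n : ℤ, ∀ᵐ θ : ℝ, θ + n • (2 * Real.pi) ∈ Ioc 0 (2 * Real.pi) →
      P (θ + n • (2 * Real.pi)) := fun n =>
    (quasiMeasurePreserving_add_right volume (n • (2 * Real.pi))).ae h
  filter_upwards [ae_all_iff.2 h1] with θ hθ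
  obtain ⟨n, hn, -⟩ := existsUnique_add_zsmul_mem_Ioc Real.two_pi_pos θ 0
  rw [zero_add] at hn
  exact hP θ n (hθ n hn)

theorem circleMap_add_zsmul (r θ : ℝ) (n : ℤ) :
    circleMap 0 r (θ + n • (2 * Real.pi)) = circleMap 0 r θ :=
  (periodic_circleMap 0 r).zsmul n θ

theorem ae_hasRadialLimit_of_circ {F : ℂ → ℂ} (h : ∀ᵐ θ ∂circ, HasRadialLimit F θ) :
    ∀ᵐ θ : ℝ, HasRadialLimit F θ := by
  refine ae_of_ae_circ (fun θ n hn => ?_) h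
  simpa only [HasRadialLimit, circleMap_add_zsmul] using hn

/-! ### The M. Riesz theorem -/

/-- The angle $\delta=\pi/(1+p)$ satisfies $p\delta=\pi-\delta$. For $|\varphi|\ge\delta$, the bound
$p\le2$ keeps $p|\varphi|$ in $[\pi-\delta,\pi]$, so $\cos p\varphi\le-\cos\delta$ and the term with
$a$ suffices. For $|\varphi|\le\delta$ the cosine is at least $\cos\delta$, and a large $b$
suffices. -/
theorem exists_one_le_cos_rpow {p : ℝ} (hp : 1 < p) (hp2 : p ≤ 2) :
    ∃ a > 0, ∃ b > 0, ∀ φ : ℝ, |φ| < Real.pi / 2 →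
      1 ≤ b * Real.cos φ ^ p - a * Real.cos (p * φ) := by
  have hπ := Real.pi_pos
  set δ := Real.pi / (1 + p) with hδ
  have hδ0 : 0 < δ := by positivity
  have hδ2 : δ < Real.pi / 2 := by
    rw [hδ]
    gcongr
    linarith
  have hpδ : p * δ = Real.pi - δ := by
    rw [hδ]
    field_simp
    ring
  have hc : 0 < Real.cos δ := Real.cos_pos_of_mem_Ioo ⟨by linarith, hδ2⟩
  refine ⟨1 / Real.cos δ, by positivity, (1 + 1 / Real.cos δ) / Real.cos δ ^ p, by positivity,
    fun φ hφ => ?_⟩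
  rw [← Real.cos_abs φ, ← Real.cos_abs (p * φ), abs_mul, abs_of_pos (by linarith : 0 < p)]
  have hcφ : 0 < Real.cos |φ| :=
    Real.cos_pos_of_mem_Ioo ⟨by linarith [abs_nonneg φ], hφ⟩
  rcases le_total δ |φ| with h | h
  · have h1 : Real.cos (p * |φ|) ≤ -Real.cos δ := by
      rw [← Real.cos_pi_sub, ← hpδ]
      refine Real.cos_le_cos_of_nonneg_of_le_pi (by positivity) ?_ (by gcongr)
      nlinarith [abs_nonneg φ]
    have h2 : 1 / Real.cos δ * Real.cos (p * |φ|) ≤ -1 := by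
      calc _ ≤ 1 / Real.cos δ * -Real.cos δ := by gcongr
        _ = -1 := by field_simp
    have h3 : 0 ≤ (1 + 1 / Real.cos δ) / Real.cos δ ^ p * Real.cos |φ| ^ p := by positivity
    linarith
  · have h1 : Real.cos δ ≤ Real.cos |φ| :=
      Real.cos_le_cos_of_nonneg_of_le_pi (abs_nonneg _) (by linarith) h
    have h2 : 1 + 1 / Real.cos δ ≤ (1 + 1 / Real.cos δ) / Real.cos δ ^ p * Real.cos |φ| ^ p := by
      rw [div_mul_eq_mul_div, le_div_iff₀ (by positivity)]
      gcongr
    have h3 : 1 / Real.cos δ * Real.cos (p * |φ|) ≤ 1 / Real.cos δ * 1 := by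
      gcongr
      exact Real.cos_le_one _
    linarith

/-- The trigonometric inequality in polar form. The term $\operatorname{Re}z^p$ is harmonic, so its
circle means can be evaluated at the centre. -/
theorem exists_norm_rpow_le_re {p : ℝ} (hp : 1 < p) (hp2 : p ≤ 2) :
    ∃ a > 0, ∃ b > 0, ∀ z : ℂ, 0 < z.re →
      ‖z‖ ^ p ≤ b * z.re ^ p - a * (z ^ (p : ℂ)).re := by
  obtain ⟨a, ha, b, hb, h⟩ := exists_one_le_cos_rpow hp hp2
  refine ⟨a, ha, b, hb, fun z hz => ?_⟩
  have hz0 : z ≠ 0 := by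
    rintro rfl
    simp at hz
  have hn : 0 < ‖z‖ := norm_pos_iff.2 hz0
  have h1 := h z.arg (Complex.abs_arg_lt_pi_div_two_iff.2 (Or.inl hz))
  have hre : z.re = ‖z‖ * Real.cos z.arg := (Complex.norm_mul_cos_arg z).symm
  have hcos : 0 < Real.cos z.arg := by
    rw [hre] at hz
    exact pos_of_mul_pos_right hz hn.le
  have hpow : (z ^ (p : ℂ)).re = ‖z‖ ^ p * Real.cos (p * z.arg) := by
    rw [Complex.cpow_def_of_ne_zero hz0, Complex.exp_re, Real.rpow_def_of_pos hn]
    congr 2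
    · simp [Complex.log_re]
    · simp [Complex.log_im, mul_comm]
  rw [hpow, hre, Real.mul_rpow hn.le hcos.le]
  have hnp : 0 < ‖z‖ ^ p := by positivity
  nlinarith

/-! ### The Herglotz transform of a positive function. -/

theorem re_herglotzRieszKernel_pos {r : ℝ} (hr : r ∈ Ico (0 : ℝ) 1) (θ t : ℝ) :
    0 < poissonKernel 0 (circleMap 0 r θ) (circleMap 0 1 t) := by
  rw [poissonKernel_circleMap]
  have h1 := one_sub_sq_le_poisson_denom r (θ - t) hr.1
  have h2 : 0 < (1 - r) ^ 2 := pow_pos (by linarith [hr.2]) 2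
  exact div_pos (by nlinarith [hr.1, hr.2]) (by linarith)

/-- The Herglotz transform of a function on the unit circle. -/
def herglotz (G : ℂ → ℝ) (z : ℂ) : ℂ :=
  Real.circleAverage (fun ζ => herglotzRieszKernel 0 z ζ • (G ζ : ℂ)) 0 1

theorem circleIntegrable_of_continuousOn_sphere {E : Type*} [NormedAddCommGroup E]
    {G : ℂ → E} (hG : ContinuousOn G (Metric.sphere 0 1)) : CircleIntegrable G 0 1 :=
  hG.circleIntegrable zero_le_one

theorem differentiableOn_herglotz {G : ℂ → ℝ} (hG : ContinuousOn G (Metric.sphere 0 1)) :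
    DifferentiableOn ℂ (herglotz G) (Metric.ball 0 1) :=
  differentiableOn_circleAverage_herglotzRieszKernel_smul
    (circleIntegrable_of_continuousOn_sphere
      (Complex.continuous_ofReal.comp_continuousOn hG))

theorem re_herglotz {G : ℂ → ℝ} (hG : ContinuousOn G (Metric.sphere 0 1)) {z : ℂ}
    (hz : z ∈ Metric.ball (0 : ℂ) 1) :
    (herglotz G z).re = (2 * Real.pi)⁻¹ *
      ∫ t, poissonKernel 0 z (circleMap 0 1 t) * G (circleMap 0 1 t) ∂circ := by
  rw [herglotz, re_circleAverage_herglotzRieszKernel_smul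
    (circleIntegrable_of_continuousOn_sphere hG) hz, ← poissonKernel_eq_re_herglotzRieszKernel,
    circleAverage_eq_integral_circ]
  rfl

theorem re_herglotz_pos {G : ℂ → ℝ} (hG : ContinuousOn G (Metric.sphere 0 1))
    (hpos : ∀ z ∈ Metric.sphere (0 : ℂ) 1, 0 < G z) {r : ℝ} (hr : r ∈ Ico (0 : ℝ) 1) (θ : ℝ) :
    0 < (herglotz G (circleMap 0 r θ)).re := by
  rw [re_herglotz hG (circleMap_mem hr θ)]
  refine mul_pos (by positivity) ?_
  have hc : Continuous fun t => poissonKernel 0 (circleMap 0 r θ) (circleMap 0 1 t) *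
      G (circleMap 0 1 t) := by
    refine Continuous.mul ?_ ?_
    · exact Continuous.comp
        (g := fun x : ℝ × ℝ => poissonKernel 0 (circleMap 0 r x.1) (circleMap 0 1 x.2))
        (f := fun t => (θ, t)) (continuous_poissonKernel_circleMap hr) (by fun_prop)
    · exact hG.comp_continuous (continuous_circleMap 0 1)
        fun θ => circleMap_mem_sphere 0 zero_le_one θ
  rw [← intervalIntegral.integral_of_le Real.two_pi_pos.le]
  exact intervalIntegral.intervalIntegral_pos_of_pos (hc.intervalIntegrable _ _) (fun t =>
    mul_pos (re_herglotzRieszKernel_pos hr θ t)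
      (hpos _ (circleMap_mem_sphere 0 zero_le_one t))) Real.two_pi_pos

theorem im_herglotz_zero {G : ℂ → ℝ} : (herglotz G 0).im = 0 := by
  have : ∀ θ, herglotzRieszKernel 0 0 (circleMap 0 1 θ) • ((G (circleMap 0 1 θ) : ℝ) : ℂ) =
      ((G (circleMap 0 1 θ) : ℝ) : ℂ) := by
    intro θ
    have h0 : circleMap 0 1 θ ≠ 0 := circleMap_ne_center one_ne_zero
    simp [herglotzRieszKernel_def, h0]
  rw [herglotz, circleAverage_eq_integral_circ]
  simp only [this]
  rw [integral_complex_ofReal, Complex.real_smul, ← Complex.ofReal_mul, Complex.ofReal_im]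

theorem radNorm_re_herglotz_le {p : ℝ} (hp : 1 < p) {G : ℂ → ℝ}
    (hG : ContinuousOn G (Metric.sphere 0 1)) {r : ℝ} (hr : r ∈ Ico (0 : ℝ) 1) :
    radNorm p (fun z => ((herglotz G z).re : ℂ)) r ≤ radNorm p (fun z => (G z : ℂ)) 1 := by
  refine radNorm_le_of_enorm_le_poisson hp hr
    (Complex.continuous_ofReal.comp_continuousOn hG) fun θ => ?_
  rw [re_herglotz hG (circleMap_mem hr θ), Complex.ofReal_mul, ← integral_complex_ofReal,
    Complex.real_smul]
  simp

/-- For $G>0$ the transform $H$ maps into the right half-plane, where $H^p$ is holomorphic.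
Integrating the pointwise inequality over a circle, the term $-a\operatorname{Re}H^p$ is nonpositive
and drops. What remains is the mean of $(\operatorname{Re}H)^p$, and $\operatorname{Re}H$ is the
Poisson integral of $G$. -/
theorem exists_radNorm_herglotz_le {p : ℝ} (hp : 1 < p) (hp2 : p ≤ 2) :
    ∃ B : ℝ≥0∞, B ≠ ∞ ∧ ∀ G : ℂ → ℝ, ContinuousOn G (Metric.sphere 0 1) →
      (∀ z ∈ Metric.sphere (0 : ℂ) 1, 0 < G z) → ∀ r ∈ Ico (0 : ℝ) 1,
      radNorm p (herglotz G) r ≤ B * radNorm p (fun z => (G z : ℂ)) 1 := by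
  obtain ⟨a, ha, b, hb, hab⟩ := exists_norm_rpow_le_re hp hp2
  have hp0 : 0 < p := by linarith
  refine ⟨ENNReal.ofReal b ^ (1 / p), ENNReal.rpow_ne_top_of_nonneg (by positivity)
    ENNReal.ofReal_ne_top, fun G hG hpos r hr => ?_⟩
  refine le_trans ?_ (mul_le_mul_right (radNorm_re_herglotz_le hp hG hr) _)
  have hH := differentiableOn_herglotz hG
  have hcH : Continuous fun θ => herglotz G (circleMap 0 r θ) := continuous_comp_circleMap hH hr
  have hcre : Continuous fun θ => (((herglotz G (circleMap 0 r θ)).re : ℝ) : ℂ) := by fun_prop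
  have hre : ∀ z ∈ Metric.ball (0 : ℂ) 1, 0 < (herglotz G z).re := by
    intro z hz
    have h1 := re_herglotz_pos hG hpos (r := ‖z‖) ⟨norm_nonneg z, by simpa using hz⟩ z.arg
    rwa [circleMap_zero, Complex.norm_mul_exp_arg_mul_I] at h1
  have hW : DifferentiableOn ℂ (fun z => herglotz G z ^ (p : ℂ)) (Metric.ball 0 1) := by
    intro z hz
    exact (hH z hz).cpow (differentiableWithinAt_const _) (Or.inl (hre z hz))
  have hcW : Continuous fun θ => herglotz G (circleMap 0 r θ) ^ (p : ℂ) :=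
    continuous_comp_circleMap hW hr
  -- The mean value property gives $2\pi\operatorname{Re}H(0)^p$, and $H(0)$ is a positive real.
  have hmean : 0 ≤ ∫ θ, (herglotz G (circleMap 0 r θ) ^ (p : ℂ)).re ∂circ := by
    have h1 : Real.circleAverage (fun z => herglotz G z ^ (p : ℂ)) 0 r =
        herglotz G 0 ^ (p : ℂ) := by
      have h2 := (diffContOnCl_comp_mul hW hr)
      have h3 := DiffContOnCl.circleAverage (c := 0) (R := 1) (by rwa [abs_one])
      rw [mul_zero] at h3
      rw [← h3, Real.circleAverage_eq_circleAverage_zero_one]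
      simp
    have h4 : ∫ θ, (herglotz G (circleMap 0 r θ) ^ (p : ℂ)).re ∂circ =
        2 * Real.pi * (herglotz G 0 ^ (p : ℂ)).re := by
      rw [← h1, circleAverage_eq_integral_circ, Complex.smul_re, smul_eq_mul, ← mul_assoc,
        mul_inv_cancel₀ Real.two_pi_pos.ne', one_mul]
      exact integral_re (memLp_one_iff_integrable.1 (memLp_circ_of_continuous hcW 1))
    have h5 : herglotz G 0 = ((herglotz G 0).re : ℂ) :=
      Complex.ext rfl (by rw [im_herglotz_zero, Complex.ofReal_im])
    rw [h4, h5, ← Complex.ofReal_cpow (hre 0 (by simp)).le, Complex.ofReal_re]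
    have := (hre 0 (by simp)).le
    positivity
  have hmain : ∫ θ, ‖herglotz G (circleMap 0 r θ)‖ ^ p ∂circ ≤
      b * ∫ θ, ‖(((herglotz G (circleMap 0 r θ)).re : ℝ) : ℂ)‖ ^ p ∂circ := by
    have i1 : Integrable (fun θ => ‖herglotz G (circleMap 0 r θ)‖ ^ p) circ :=
      integrable_circ_of_continuous (hcH.norm.rpow_const fun _ => Or.inr hp0.le)
    have i2 : Integrable (fun θ => ‖(((herglotz G (circleMap 0 r θ)).re : ℝ) : ℂ)‖ ^ p) circ :=
      integrable_circ_of_continuous (hcre.norm.rpow_const fun _ => Or.inr hp0.le)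
    have i3 : Integrable (fun θ => (herglotz G (circleMap 0 r θ) ^ (p : ℂ)).re) circ :=
      integrable_circ_of_continuous (Complex.continuous_re.comp hcW)
    have h1 : ∫ θ, ‖herglotz G (circleMap 0 r θ)‖ ^ p ∂circ ≤
        ∫ θ, b * ‖(((herglotz G (circleMap 0 r θ)).re : ℝ) : ℂ)‖ ^ p -
          a * (herglotz G (circleMap 0 r θ) ^ (p : ℂ)).re ∂circ := by
      refine integral_mono i1 ((i2.const_mul b).sub (i3.const_mul a)) fun θ => ?_
      have h2 := hre _ (circleMap_mem hr θ)
      simp only [Complex.norm_real, Real.norm_of_nonneg h2.le]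
      exact hab _ h2
    rw [integral_sub (i2.const_mul b) (i3.const_mul a), integral_const_mul,
      integral_const_mul] at h1
    nlinarith
  rw [← ENNReal.rpow_le_rpow_iff hp0, ENNReal.mul_rpow_of_nonneg _ _ hp0.le, ← ENNReal.rpow_mul,
    one_div_mul_cancel hp0.ne', ENNReal.rpow_one, radNorm, radNorm,
    eLpNorm_circ_rpow_of_continuous hp0 hcH, eLpNorm_circ_rpow_of_continuous hp0 hcre,
    ← ENNReal.ofReal_mul hb.le]
  exact ENNReal.ofReal_le_ofReal hmain

/-- The Cauchy transform (Riesz projection) of a function on the unit circle. -/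
def cauchyTransform (g : ℂ → ℂ) (z : ℂ) : ℂ :=
  Real.circleAverage (fun ζ => ζ / (ζ - z) * g ζ) 0 1

/-! ### The Cauchy transform for exponents at most two. -/

theorem sub_ne_zero_of_mem_sphere {ζ z : ℂ} (hζ : ζ ∈ Metric.sphere (0 : ℂ) 1)
    (hz : z ∈ Metric.ball (0 : ℂ) 1) : ζ - z ≠ 0 := by
  rw [sub_ne_zero]
  rintro rfl
  simp at hζ hz
  linarith

theorem continuousOn_cauchy_integrand {g : ℂ → ℂ} (hg : ContinuousOn g (Metric.sphere 0 1)) {z : ℂ}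
    (hz : z ∈ Metric.ball (0 : ℂ) 1) :
    ContinuousOn (fun ζ => ζ / (ζ - z) * g ζ) (Metric.sphere 0 1) :=
  (continuousOn_id.div (continuousOn_id.sub continuousOn_const)
    fun _ hζ => sub_ne_zero_of_mem_sphere hζ hz).mul hg

theorem cauchyTransform_add {g k : ℂ → ℂ} (hg : ContinuousOn g (Metric.sphere 0 1))
    (hk : ContinuousOn k (Metric.sphere 0 1)) {z : ℂ} (hz : z ∈ Metric.ball (0 : ℂ) 1) :
    cauchyTransform (fun ζ => g ζ + k ζ) z = cauchyTransform g z + cauchyTransform k z := by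
  simp only [cauchyTransform, mul_add]
  exact Real.circleAverage_fun_add
    (circleIntegrable_of_continuousOn_sphere (continuousOn_cauchy_integrand hg hz))
    (circleIntegrable_of_continuousOn_sphere (continuousOn_cauchy_integrand hk hz))

theorem cauchyTransform_const_mul (c : ℂ) (g : ℂ → ℂ) (z : ℂ) :
    cauchyTransform (fun ζ => c * g ζ) z = c * cauchyTransform g z := by
  simp only [cauchyTransform, mul_left_comm _ c]
  exact Real.circleAverage_fun_smul (a := c) (f := fun ζ => ζ / (ζ - z) * g ζ)

/-- $\zeta/(\zeta-z)=\tfrac12\bigl((\zeta+z)/(\zeta-z)+1\bigr)$, and the Herglotz kernel at $0$ is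
$1$. -/
theorem cauchyTransform_eq_herglotz {g : ℂ → ℂ} (hg : ContinuousOn g (Metric.sphere 0 1)) {z : ℂ}
    (hz : z ∈ Metric.ball (0 : ℂ) 1) :
    cauchyTransform g z = (1 / 2 : ℂ) *
      (Real.circleAverage (fun ζ => herglotzRieszKernel 0 z ζ • g ζ) 0 1 +
        Real.circleAverage (fun ζ => herglotzRieszKernel 0 0 ζ • g ζ) 0 1) := by
  have hi : ∀ {w : ℂ}, w ∈ Metric.ball (0 : ℂ) 1 →
      CircleIntegrable (fun ζ => herglotzRieszKernel 0 w ζ • g ζ) 0 1 := by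
    intro w hw
    have := continuousOn_herglotzRieszKernel_sphere hw
    rw [abs_one] at this
    exact circleIntegrable_of_continuousOn_sphere (this.smul hg)
  rw [← Real.circleAverage_fun_add (hi hz) (hi (by simp)), ← smul_eq_mul,
    ← Real.circleAverage_fun_smul]
  refine Real.circleAverage_congr_sphere fun ζ hζ => ?_
  rw [abs_one] at hζ
  have h1 := sub_ne_zero_of_mem_sphere hζ hz
  have h2 : ζ ≠ 0 := by
    have := sub_ne_zero_of_mem_sphere hζ (z := 0) (by simp)
    rwa [sub_zero] at this
  simp only [herglotzRieszKernel_def, sub_zero, add_zero, smul_eq_mul]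
  field_simp
  ring

theorem cauchyTransform_ofReal {G : ℂ → ℝ} (hG : ContinuousOn G (Metric.sphere 0 1)) {z : ℂ}
    (hz : z ∈ Metric.ball (0 : ℂ) 1) :
    cauchyTransform (fun ζ => (G ζ : ℂ)) z = (1 / 2 : ℂ) * (herglotz G z + herglotz G 0) :=
  cauchyTransform_eq_herglotz (Complex.continuous_ofReal.comp_continuousOn hG) hz

theorem differentiableOn_cauchyTransform {g : ℂ → ℂ} (hg : ContinuousOn g (Metric.sphere 0 1)) :
    DifferentiableOn ℂ (cauchyTransform g) (Metric.ball 0 1) :=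
  (((differentiableOn_circleAverage_herglotzRieszKernel_smul
    (circleIntegrable_of_continuousOn_sphere hg)).add_const _).const_mul _).congr
    fun _ hz => cauchyTransform_eq_herglotz hg hz

theorem continuous_cauchy_kernel {r : ℝ} (hr : r ∈ Ico (0 : ℝ) 1) :
    Continuous fun x : ℝ × ℝ => circleMap 0 1 x.2 / (circleMap 0 1 x.2 - circleMap 0 r x.1) := by
  have h1 : ∀ r : ℝ, Continuous (circleMap 0 r) := continuous_circleMap 0
  refine ((h1 1).comp continuous_snd).div
    (((h1 1).comp continuous_snd).sub ((h1 r).comp continuous_fst)) fun x => ?_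
  exact sub_ne_zero_of_mem_sphere (circleMap_mem_sphere 0 zero_le_one _) (circleMap_mem hr _)

theorem cauchyTransform_eq_integral (g : ℂ → ℂ) (z : ℂ) :
    cauchyTransform g z = (2 * Real.pi : ℂ)⁻¹ *
      ∫ t, circleMap 0 1 t / (circleMap 0 1 t - z) * g (circleMap 0 1 t) ∂circ := by
  rw [cauchyTransform, circleAverage_eq_integral_circ, Complex.real_smul]
  push_cast
  rfl

theorem continuous_cauchyTransform_circleMap {g : ℂ → ℂ} (hg : ContinuousOn g (Metric.sphere 0 1))
    {r : ℝ} (hr : r ∈ Ico (0 : ℝ) 1) :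
    Continuous fun θ => cauchyTransform g (circleMap 0 r θ) :=
  continuous_comp_circleMap (differentiableOn_cauchyTransform hg) hr

theorem radNorm_add_le {p : ℝ} (hp : 1 ≤ p) {F G : ℂ → ℂ} {r : ℝ}
    (hF : Continuous fun θ => F (circleMap 0 r θ)) (hG : Continuous fun θ => G (circleMap 0 r θ)) :
    radNorm p (fun z => F z + G z) r ≤ radNorm p F r + radNorm p G r :=
  eLpNorm_add_le hF.aestronglyMeasurable hG.aestronglyMeasurable (by simpa using hp)

theorem radNorm_const_mul (p : ℝ) (c : ℂ) (F : ℂ → ℂ) (r : ℝ) :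
    radNorm p (fun z => c * F z) r = ‖c‖ₑ * radNorm p F r :=
  eLpNorm_const_smul c (fun θ => F (circleMap 0 r θ)) _ _

theorem radNorm_congr {p r : ℝ} {F G : ℂ → ℂ}
    (h : ∀ θ, F (circleMap 0 r θ) = G (circleMap 0 r θ)) : radNorm p F r = radNorm p G r := by
  simp only [radNorm, h]

theorem radNorm_mono_norm {p r : ℝ} {F G : ℂ → ℂ}
    (h : ∀ θ, ‖F (circleMap 0 r θ)‖ ≤ ‖G (circleMap 0 r θ)‖) : radNorm p F r ≤ radNorm p G r :=
  eLpNorm_mono h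

theorem radNorm_cauchyTransform_add_const_mul_le {p : ℝ} (hp : 1 ≤ p) {g k : ℂ → ℂ} (c : ℂ)
    (hg : ContinuousOn g (Metric.sphere 0 1)) (hk : ContinuousOn k (Metric.sphere 0 1))
    {r : ℝ} (hr : r ∈ Ico (0 : ℝ) 1) :
    radNorm p (cauchyTransform fun ζ => g ζ + c * k ζ) r ≤
      radNorm p (cauchyTransform g) r + ‖c‖ₑ * radNorm p (cauchyTransform k) r := by
  rw [← radNorm_const_mul]
  refine le_trans (le_of_eq (radNorm_congr fun θ => ?_)) (radNorm_add_le hp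
    (continuous_cauchyTransform_circleMap hg hr)
    (continuous_const.mul (continuous_cauchyTransform_circleMap hk hr)))
  rw [← cauchyTransform_const_mul]
  exact cauchyTransform_add hg (continuousOn_const.mul hk) (circleMap_mem hr θ)

theorem radNorm_const_ne_top (p : ℝ) (c : ℂ) (r : ℝ) : radNorm p (fun _ => c) r ≠ ∞ :=
  (memLp_const c).2.ne

theorem exists_radNorm_cauchyTransform_pos_le {p : ℝ} (hp : 1 < p) (hp2 : p ≤ 2) :
    ∃ B : ℝ≥0∞, B ≠ ∞ ∧ ∀ G : ℂ → ℝ, ContinuousOn G (Metric.sphere 0 1) →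
      (∀ z ∈ Metric.sphere (0 : ℂ) 1, 0 < G z) → ∀ r ∈ Ico (0 : ℝ) 1,
      radNorm p (cauchyTransform fun z => (G z : ℂ)) r ≤
        B * radNorm p (fun z => (G z : ℂ)) 1 := by
  obtain ⟨B, hB, h⟩ := exists_radNorm_herglotz_le hp hp2
  refine ⟨B, hB, fun G hG hpos r hr => ?_⟩
  have hH := differentiableOn_herglotz hG
  -- The constant $H(0)$ is the restriction of $H$ to the circle of radius zero, so the bound for
  -- $H$ covers it too.
  have h0 : radNorm p (fun _ => herglotz G 0) r = radNorm p (herglotz G) 0 := by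
    simp only [radNorm, circleMap_zero_radius, Function.const_apply]
  calc radNorm p (cauchyTransform fun z => (G z : ℂ)) r
      = radNorm p (fun z => (1 / 2 : ℂ) * (herglotz G z + herglotz G 0)) r :=
        radNorm_congr fun θ => cauchyTransform_ofReal hG (circleMap_mem hr θ)
    _ = ‖(1 / 2 : ℂ)‖ₑ * radNorm p (fun z => herglotz G z + herglotz G 0) r :=
        radNorm_const_mul _ _ _ _
    _ ≤ ‖(1 / 2 : ℂ)‖ₑ * (radNorm p (herglotz G) r + radNorm p (fun _ => herglotz G 0) r) := by
        gcongr
        exact radNorm_add_le hp.le (continuous_comp_circleMap hH hr) continuous_const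
    _ ≤ ‖(1 / 2 : ℂ)‖ₑ * (B * radNorm p (fun z => (G z : ℂ)) 1 +
          B * radNorm p (fun z => (G z : ℂ)) 1) := by
        rw [h0]
        gcongr
        · exact h G hG hpos r hr
        · exact h G hG hpos 0 ⟨le_rfl, one_pos⟩
    _ = B * radNorm p (fun z => (G z : ℂ)) 1 := by
        rw [← two_mul, ← mul_assoc]
        have : ‖(1 / 2 : ℂ)‖ₑ * 2 = 1 := by
          rw [one_div, enorm_inv two_ne_zero]
          have : ‖(2 : ℂ)‖ₑ = 2 := by
            rw [← ofReal_norm, Complex.norm_ofNat, ENNReal.ofReal_ofNat]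
          rw [this, ENNReal.inv_mul_cancel (by simp) (by simp)]
        rw [this, one_mul]

/-- Split $G$ into positive and negative parts, each shifted by $\eta>0$ to become strictly
positive. The shifts cancel in the difference, and $\eta\to0$ removes them from the bound. -/
theorem exists_radNorm_cauchyTransform_real_le {p : ℝ} (hp : 1 < p) (hp2 : p ≤ 2) :
    ∃ B : ℝ≥0∞, B ≠ ∞ ∧ ∀ G : ℂ → ℝ, ContinuousOn G (Metric.sphere 0 1) →
      ∀ r ∈ Ico (0 : ℝ) 1, radNorm p (cauchyTransform fun z => (G z : ℂ)) r ≤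
        B * radNorm p (fun z => (G z : ℂ)) 1 := by
  obtain ⟨B, hB, h⟩ := exists_radNorm_cauchyTransform_pos_le hp hp2
  refine ⟨B * 2, ENNReal.mul_ne_top hB (by simp), fun G hG r hr => ?_⟩
  set N := radNorm p (fun z => (G z : ℂ)) 1
  set c := radNorm p (fun _ => (1 : ℂ)) 1 with hc
  have key : ∀ η : ℝ, 0 < η → radNorm p (cauchyTransform fun z => (G z : ℂ)) r ≤
      B * (2 * (N + ENNReal.ofReal η * c)) := by
    intro η hη
    have hpart : ∀ U : ℂ → ℝ, ContinuousOn U (Metric.sphere 0 1) → (∀ z, ‖U z‖ = ‖G z‖) →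
        radNorm p (cauchyTransform fun z => ((max (U z) 0 + η : ℝ) : ℂ)) r ≤
          B * (N + ENNReal.ofReal η * c) := by
      intro U hU hUG
      have hcU : Continuous fun θ => U (circleMap 0 1 θ) :=
        hU.comp_continuous (continuous_circleMap 0 1) fun θ => circleMap_mem_sphere 0 zero_le_one θ
      refine (h (fun z => max (U z) 0 + η) ((hU.sup continuousOn_const).add continuousOn_const) (fun z _ =>
        add_pos_of_nonneg_of_pos (le_max_right _ _) hη) r hr).trans ?_
      gcongr
      have e : ∀ z, ((max (U z) 0 + η : ℝ) : ℂ) = ((max (U z) 0 : ℝ) : ℂ) + (η : ℂ) * 1 := by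
        intro z
        push_cast
        ring
      refine le_trans (le_of_eq (radNorm_congr
        (G := fun z => ((max (U z) 0 : ℝ) : ℂ) + (η : ℂ) * 1) fun θ => e _)) ?_
      refine (radNorm_add_le hp.le (F := fun z => ((max (U z) 0 : ℝ) : ℂ))
        (G := fun _ => (η : ℂ) * 1)
        (Complex.continuous_ofReal.comp (hcU.max continuous_const)) continuous_const).trans (add_le_add ?_ ?_)
      · refine radNorm_mono_norm fun θ => ?_
        rw [Complex.norm_real, Complex.norm_real, ← hUG, Real.norm_eq_abs, Real.norm_eq_abs,
          abs_of_nonneg (le_max_right _ _)]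
        exact max_le (le_abs_self _) (abs_nonneg _)
      · rw [radNorm_const_mul p (η : ℂ) (fun _ => 1), ← ofReal_norm, Complex.norm_real,
          Real.norm_of_nonneg hη.le]
    have hd : ∀ U : ℂ → ℝ, ContinuousOn U (Metric.sphere 0 1) →
        ContinuousOn (fun z => ((max (U z) 0 + η : ℝ) : ℂ)) (Metric.sphere 0 1) := fun U hU =>
      Complex.continuous_ofReal.comp_continuousOn
        ((hU.sup continuousOn_const).add continuousOn_const)
    have hsplit : ∀ ζ, (G ζ : ℂ) = ((max (G ζ) 0 + η : ℝ) : ℂ) +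
        (-1) * ((max (-G ζ) 0 + η : ℝ) : ℂ) := by
      intro ζ
      rw [← Complex.ofReal_one, ← Complex.ofReal_neg, ← Complex.ofReal_mul, ← Complex.ofReal_add]
      congr 1
      rcases le_total 0 (G ζ) with h | h
      · rw [max_eq_left h, max_eq_right (by linarith)]
        ring
      · rw [max_eq_right h, max_eq_left (by linarith)]
        ring
    have hsum := radNorm_cauchyTransform_add_const_mul_le hp.le (-1) (hd G hG) (hd _ hG.neg) hr
    rw [enorm_neg, enorm_one, one_mul] at hsum
    calc radNorm p (cauchyTransform fun z => (G z : ℂ)) r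
        ≤ _ := by
          simp only [hsplit]
          exact hsum
      _ ≤ B * (N + ENNReal.ofReal η * c) + B * (N + ENNReal.ofReal η * c) :=
          add_le_add (hpart G hG fun _ => rfl) (hpart (fun z => -G z) hG.neg fun z => norm_neg _)
      _ = _ := by ring
  have hlim : Tendsto (fun η : ℝ => B * (2 * (N + ENNReal.ofReal η * c))) (𝓝[>] 0)
      (𝓝 (B * (2 * (N + 0 * c)))) := by
    refine ENNReal.Tendsto.const_mul (ENNReal.Tendsto.const_mul (tendsto_const_nhds.add
      (ENNReal.Tendsto.mul_const ?_ (Or.inr (radNorm_const_ne_top _ _ _)))) (Or.inr (by simp)))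
      (Or.inr hB)
    have := (ENNReal.continuous_ofReal.tendsto 0).mono_left (nhdsWithin_le_nhds (s := Ioi 0))
    rwa [ENNReal.ofReal_zero] at this
  rw [zero_mul, add_zero, ← mul_assoc] at hlim
  refine ge_of_tendsto hlim ?_
  filter_upwards [self_mem_nhdsWithin] with η hη
  exact key η hη

theorem exists_radNorm_cauchyTransform_le_of_le_two {p : ℝ} (hp : 1 < p) (hp2 : p ≤ 2) :
    ∃ B : ℝ≥0∞, B ≠ ∞ ∧ ∀ g : ℂ → ℂ, ContinuousOn g (Metric.sphere 0 1) →
      ∀ r ∈ Ico (0 : ℝ) 1, radNorm p (cauchyTransform g) r ≤ B * radNorm p g 1 := by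
  obtain ⟨B, hB, h⟩ := exists_radNorm_cauchyTransform_real_le hp hp2
  refine ⟨2 * B, ENNReal.mul_ne_top (by simp) hB, fun g hg r hr => ?_⟩
  have hre : ContinuousOn (fun z => (g z).re) (Metric.sphere 0 1) :=
    Complex.continuous_re.comp_continuousOn hg
  have him : ContinuousOn (fun z => (g z).im) (Metric.sphere 0 1) :=
    Complex.continuous_im.comp_continuousOn hg
  have hsum := radNorm_cauchyTransform_add_const_mul_le hp.le Complex.I
    (g := fun z => ((g z).re : ℂ)) (k := fun z => ((g z).im : ℂ))
    (Complex.continuous_ofReal.comp_continuousOn hre)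
    (Complex.continuous_ofReal.comp_continuousOn him) hr
  rw [← ofReal_norm, Complex.norm_I, ENNReal.ofReal_one, one_mul] at hsum
  calc radNorm p (cauchyTransform g) r
      ≤ radNorm p (cauchyTransform (fun z => ((g z).re : ℂ))) r +
        radNorm p (cauchyTransform (fun z => ((g z).im : ℂ))) r := by
        convert hsum using 3
        ext z
        simp [mul_comm Complex.I, Complex.re_add_im]
    _ ≤ B * radNorm p g 1 + B * radNorm p g 1 := by
        refine add_le_add ((h _ hre r hr).trans ?_) ((h _ him r hr).trans ?_)
        · gcongr
          exact radNorm_mono_norm fun θ => by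
            rw [Complex.norm_real]
            exact Complex.abs_re_le_norm _
        · gcongr
          exact radNorm_mono_norm fun θ => by
            rw [Complex.norm_real]
            exact Complex.abs_im_le_norm _
    _ = _ := by ring

/-! ### Hölder duality and the Cauchy transform for large exponents. -/

theorem enorm_integral_mul_conj_le {α : Type*} [MeasurableSpace α] {μ : Measure α} {p q : ℝ≥0∞}
    [p.HolderConjugate q] {f g : α → ℂ} (hf : AEStronglyMeasurable f μ)
    (hg : AEStronglyMeasurable g μ) :
    ‖∫ x, f x * starRingEnd ℂ (g x) ∂μ‖ₑ ≤ eLpNorm f p μ * eLpNorm g q μ := by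
  have hg' : AEStronglyMeasurable (fun x => starRingEnd ℂ (g x)) μ :=
    Complex.continuous_conj.comp_aestronglyMeasurable hg
  have h1 : eLpNorm (fun x => starRingEnd ℂ (g x)) q μ = eLpNorm g q μ :=
    eLpNorm_congr_norm_ae (Eventually.of_forall fun x => by simp)
  rw [← h1]
  refine (enorm_integral_le_lintegral_enorm _).trans ?_
  rw [← eLpNorm_one_eq_lintegral_enorm]
  have h2 := eLpNorm_smul_le_mul_eLpNorm (p := p) (q := q) (r := 1) hg' hf
  simp only [smul_eq_mul, Pi.mul_def] at h2
  exact h2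

/-- Needed at $s=p-2$, possibly negative, for the continuity of the Hölder extremizer. At the origin
the modulus is $|z|^{1+s}$, which still tends to zero. -/
theorem continuous_mul_norm_rpow {s : ℝ} (hs : -1 < s) :
    Continuous fun z : ℂ => z * ((‖z‖ ^ s : ℝ) : ℂ) := by
  rw [continuous_iff_continuousAt]
  intro z
  rcases eq_or_ne z 0 with rfl | hz
  · rw [ContinuousAt, zero_mul, tendsto_zero_iff_norm_tendsto_zero]
    have h1 : Continuous fun z : ℂ => ‖z‖ ^ (1 + s) :=
      continuous_norm.rpow_const fun _ => Or.inr (by linarith)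
    have h2 := h1.tendsto 0
    rw [norm_zero, Real.zero_rpow (by linarith)] at h2
    refine squeeze_zero (fun _ => norm_nonneg _) (fun z => ?_) h2
    rw [norm_mul, Complex.norm_real, Real.norm_of_nonneg (by positivity)]
    rcases eq_or_ne z 0 with rfl | hz
    · simp [Real.zero_rpow (by linarith : 1 + s ≠ 0)]
    · rw [Real.rpow_add (norm_pos_iff.2 hz), Real.rpow_one]
  · exact continuousAt_id.mul (Complex.continuous_ofReal.continuousAt.comp
      (continuous_norm.continuousAt.rpow_const (Or.inl (norm_ne_zero_iff.2 hz))))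

/-- The converse of Hölder's inequality, tested on continuous functions. -/
theorem radNorm_le_of_forall_integral_le {p q : ℝ} (hpq : p.HolderConjugate q) {F : ℂ → ℂ}
    (hF : ContinuousOn F (Metric.sphere 0 1)) {A : ℝ≥0∞}
    (h : ∀ k : ℂ → ℂ, ContinuousOn k (Metric.sphere 0 1) →
      ‖∫ θ, F (circleMap 0 1 θ) * starRingEnd ℂ (k (circleMap 0 1 θ)) ∂circ‖ₑ ≤
        A * radNorm q k 1) : radNorm p F 1 ≤ A := by
  have hp0 := hpq.pos
  have hp1 := hpq.lt
  have hcF := continuous_comp_circleMap_one hF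
  -- The extremizer $k=F|F|^{p-2}$ satisfies $F\bar k=|F|^p=|k|^q$.
  have hk := (continuous_mul_norm_rpow (s := p - 2) (by linarith)).comp_continuousOn hF
  have hck := continuous_comp_circleMap_one hk
  have h1 := h _ hk
  have h2 : ∀ z : ℂ, z * starRingEnd ℂ (z * ((‖z‖ ^ (p - 2) : ℝ) : ℂ)) = ((‖z‖ ^ p : ℝ) : ℂ) := by
    intro z
    rw [map_mul, Complex.conj_ofReal, ← mul_assoc, Complex.mul_conj, ← Complex.ofReal_mul,
      Complex.normSq_eq_norm_sq]
    rcases eq_or_ne z 0 with rfl | hz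
    · simp [Real.zero_rpow hp0.ne']
    · rw [← Real.rpow_natCast, ← Real.rpow_add (norm_pos_iff.2 hz)]
      norm_num
  have h3 : ∀ z : ℂ, ‖z * ((‖z‖ ^ (p - 2) : ℝ) : ℂ)‖ ^ q = ‖z‖ ^ p := by
    intro z
    rcases eq_or_ne z 0 with rfl | hz
    · simp [Real.zero_rpow hp0.ne', Real.zero_rpow hpq.symm.ne_zero]
    · have hn := norm_pos_iff.2 hz
      rw [norm_mul, Complex.norm_real, Real.norm_of_nonneg (by positivity)]
      nth_rewrite 1 [← Real.rpow_one ‖z‖]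
      rw [← Real.rpow_add hn, ← Real.rpow_mul hn.le]
      congr 1
      rw [show 1 + (p - 2) = p - 1 by ring, hpq.sub_one_mul_conj]
  set J := ∫ θ, ‖F (circleMap 0 1 θ)‖ ^ p ∂circ with hJ
  have hJ0 : 0 ≤ J := integral_nonneg fun θ => by positivity
  have hN : radNorm p F 1 ^ p = ENNReal.ofReal J := eLpNorm_circ_rpow_of_continuous hp0 hcF
  have hK : radNorm q ((fun z => z * ((‖z‖ ^ (p - 2) : ℝ) : ℂ)) ∘ F) 1 ^ q = ENNReal.ofReal J := by
    rw [radNorm, eLpNorm_circ_rpow_of_continuous hpq.symm.pos hck]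
    simp only [Function.comp_apply, h3, hJ]
  simp only [Function.comp_apply, h2] at h1
  rw [integral_complex_ofReal, ← ofReal_norm, Complex.norm_real, Real.norm_of_nonneg hJ0] at h1
  have hJp : ENNReal.ofReal J = ENNReal.ofReal J ^ (1 / p) * ENNReal.ofReal J ^ (1 / q) := by
    rw [← ENNReal.rpow_add_of_nonneg _ _ (one_div_nonneg.2 hp0.le)
      (one_div_nonneg.2 hpq.symm.nonneg), one_div, one_div, hpq.inv_add_inv_eq_one,
      ENNReal.rpow_one]
  have hN' : radNorm p F 1 = ENNReal.ofReal J ^ (1 / p) := by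
    rw [← hN, ← ENNReal.rpow_mul, mul_one_div_cancel hp0.ne', ENNReal.rpow_one]
  have hK' : radNorm q ((fun z => z * ((‖z‖ ^ (p - 2) : ℝ) : ℂ)) ∘ F) 1 =
      ENNReal.ofReal J ^ (1 / q) := by
    rw [← hK, ← ENNReal.rpow_mul, mul_one_div_cancel hpq.symm.ne_zero, ENNReal.rpow_one]
  rw [hN']
  -- Cancelling $J^{1/q}$ requires $J\ne0$.
  rcases hJ0.eq_or_lt with h0 | h0
  · rw [← h0, ENNReal.ofReal_zero, ENNReal.zero_rpow_of_pos (one_div_pos.2 hp0)]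
    exact zero_le
  · change ENNReal.ofReal J ≤ A * radNorm q ((fun z => z * ((‖z‖ ^ (p - 2) : ℝ) : ℂ)) ∘ F) 1 at h1
    rw [hK'] at h1
    refine (ENNReal.mul_le_mul_iff_left ?_ ?_).1 (hJp.ge.trans h1)
    · exact (ENNReal.rpow_pos (ENNReal.ofReal_pos.2 h0) ENNReal.ofReal_ne_top).ne'
    · exact ENNReal.rpow_ne_top_of_nonneg (one_div_nonneg.2 hpq.symm.nonneg) ENNReal.ofReal_ne_top

theorem integral_circ_swap {f : ℝ × ℝ → ℂ} (hf : Continuous f) :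
    ∫ θ, ∫ t, f (θ, t) ∂circ ∂circ = ∫ t, ∫ θ, f (θ, t) ∂circ ∂circ := by
  refine integral_integral_swap (f := fun θ t => f (θ, t)) ?_
  rw [Measure.prod_restrict]
  exact (hf.continuousOn.integrableOn_compact (isCompact_Icc.prod isCompact_Icc)).mono_set
    (prod_mono Ioc_subset_Icc_self Ioc_subset_Icc_self)

/-- Conjugation inverts points of the unit circle. The dilated Cauchy kernel is thus Hermitian,
which underlies the self-adjointness of the transform. -/
theorem conj_cauchy_kernel (r θ t : ℝ) :
    starRingEnd ℂ (circleMap 0 1 t / (circleMap 0 1 t - circleMap 0 r θ)) =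
      circleMap 0 1 θ / (circleMap 0 1 θ - circleMap 0 r t) := by
  have h1 : ∀ x : ℝ, Complex.exp (x * Complex.I) ≠ 0 := fun x => Complex.exp_ne_zero _
  have h2 : ∀ x : ℝ, starRingEnd ℂ (Complex.exp (x * Complex.I)) =
      (Complex.exp (x * Complex.I))⁻¹ := by
    intro x
    rw [← Complex.exp_conj, ← Complex.exp_neg]
    simp
  simp only [circleMap_zero, map_div₀, map_sub, map_mul, Complex.conj_ofReal, h2,
    Complex.ofReal_one, one_mul]
  have h3 : (Complex.exp (t * Complex.I))⁻¹ - r * (Complex.exp (θ * Complex.I))⁻¹ =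
      (Complex.exp (t * Complex.I))⁻¹ * (Complex.exp (θ * Complex.I))⁻¹ *
        (Complex.exp (θ * Complex.I) - r * Complex.exp (t * Complex.I)) := by
    have := h1 t
    have := h1 θ
    field_simp
  rw [h3, mul_assoc, ← div_div, div_self (inv_ne_zero (h1 t)), ← div_div, one_div, inv_inv]

theorem integral_cauchyTransform_mul_conj {g k : ℂ → ℂ} (hg : ContinuousOn g (Metric.sphere 0 1))
    (hk : ContinuousOn k (Metric.sphere 0 1)) {r : ℝ} (hr : r ∈ Ico (0 : ℝ) 1) :
    ∫ θ, cauchyTransform g (circleMap 0 r θ) * starRingEnd ℂ (k (circleMap 0 1 θ)) ∂circ =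
      ∫ t, g (circleMap 0 1 t) * starRingEnd ℂ (cauchyTransform k (circleMap 0 r t)) ∂circ := by
  have hf : Continuous fun x : ℝ × ℝ => circleMap 0 1 x.2 / (circleMap 0 1 x.2 - circleMap 0 r x.1) *
      g (circleMap 0 1 x.2) * starRingEnd ℂ (k (circleMap 0 1 x.1)) :=
    ((continuous_cauchy_kernel hr).mul
      ((continuous_comp_circleMap_one hg).comp continuous_snd)).mul
      (Complex.continuous_conj.comp ((continuous_comp_circleMap_one hk).comp continuous_fst))
  have h2π : starRingEnd ℂ (2 * Real.pi : ℂ)⁻¹ = (2 * Real.pi : ℂ)⁻¹ := by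
    rw [map_inv₀, map_mul, Complex.conj_ofReal, map_ofNat]
  simp only [cauchyTransform_eq_integral, map_mul, h2π, ← integral_conj, conj_cauchy_kernel]
  calc _ = (2 * Real.pi : ℂ)⁻¹ * ∫ θ, ∫ t, circleMap 0 1 t / (circleMap 0 1 t - circleMap 0 r θ) *
      g (circleMap 0 1 t) * starRingEnd ℂ (k (circleMap 0 1 θ)) ∂circ ∂circ := by
        rw [← integral_const_mul]
        congr 1
        ext θ
        rw [mul_assoc, integral_mul_const]
    _ = (2 * Real.pi : ℂ)⁻¹ * ∫ t, ∫ θ, circleMap 0 1 t / (circleMap 0 1 t - circleMap 0 r θ) *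
      g (circleMap 0 1 t) * starRingEnd ℂ (k (circleMap 0 1 θ)) ∂circ ∂circ := by
        rw [integral_circ_swap hf]
    _ = _ := by
        rw [← integral_const_mul]
        refine integral_congr_ae (Eventually.of_forall fun t => ?_)
        simp only
        rw [mul_left_comm, ← integral_const_mul (g (circleMap 0 1 t))]
        congr 1
        refine integral_congr_ae (Eventually.of_forall fun θ => ?_)
        simp only
        ring

/-- **M. Riesz's theorem**: the Cauchy transform is bounded in the `L^p` norm. -/
theorem exists_radNorm_cauchyTransform_le {p : ℝ} (hp : 1 < p) :
    ∃ B : ℝ≥0∞, B ≠ ∞ ∧ ∀ g : ℂ → ℂ, ContinuousOn g (Metric.sphere 0 1) →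
      ∀ r ∈ Ico (0 : ℝ) 1, radNorm p (cauchyTransform g) r ≤ B * radNorm p g 1 := by
  rcases le_total p 2 with hp2 | hp2
  · exact exists_radNorm_cauchyTransform_le_of_le_two hp hp2
  have hpq := Real.HolderConjugate.conjExponent hp
  set q := p.conjExponent with hq_def
  have hq2 : q ≤ 2 := by
    have h1 := hpq.sub_one_mul_conj
    have h2 := hpq.symm.pos
    nlinarith
  obtain ⟨B, hB, h⟩ := exists_radNorm_cauchyTransform_le_of_le_two hpq.symm.lt hq2
  refine ⟨B, hB, fun g hg r hr => ?_⟩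
  have := hpq.ennrealOfReal
  have hscale : ContinuousOn (fun z => cauchyTransform g (r * z)) (Metric.sphere 0 1) :=
    (diffContOnCl_comp_mul (differentiableOn_cauchyTransform hg) hr).continuousOn_ball.mono
      Metric.sphere_subset_closedBall
  -- Self-adjointness moves the transform onto the test function $k$, whose exponent $q\le2$ is
  -- already settled.
  have h1 : radNorm p (fun z => cauchyTransform g (r * z)) 1 ≤ B * radNorm p g 1 := by
    refine radNorm_le_of_forall_integral_le hpq hscale fun k hk => ?_
    simp only [ofReal_mul_circleMap, mul_one]
    rw [integral_cauchyTransform_mul_conj hg hk hr]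
    refine (enorm_integral_mul_conj_le (p := ENNReal.ofReal p) (q := ENNReal.ofReal q)
      (continuous_comp_circleMap_one hg).aestronglyMeasurable
      (continuous_cauchyTransform_circleMap hk hr).aestronglyMeasurable).trans ?_
    calc _ ≤ radNorm p g 1 * (B * radNorm q k 1) := by
          gcongr
          · exact le_rfl
          · exact h k hk r hr
      _ = _ := by ring
  rwa [radNorm_comp_mul, mul_one] at h1

/-! ### Elements of the Hardy space -/

theorem hardyENorm_congr {p β : ℝ} {F G : ℂ → ℂ} (h : ∀ z ∈ Metric.ball (0 : ℂ) 1, F z = G z) :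
    hardyENorm p β F = hardyENorm p β G := by
  have : ∀ r ∈ Ico (0 : ℝ) 1, circleMean p β F r = circleMean p β G r := fun r hr => by
    simp only [circleMean, h _ (circleMap_mem hr _)]
  simp only [hardyENorm]
  congr 1
  exact iSup_congr fun r => iSup_congr fun hr => this r hr

/-- The element of the Hardy space given by a holomorphic function on the disc. -/
def HardySpace.of (p β : ℝ) [Fact (1 ≤ p)] (F : ℂ → ℂ)
    (hF : DifferentiableOn ℂ F (Metric.ball 0 1)) (hn : hardyENorm p β F < ∞) : HardySpace p β :=
  ⟨(Metric.ball (0 : ℂ) 1).indicator F,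
    hF.congr fun z hz => by rw [indicator_of_mem hz],
    fun z hz => by rw [indicator_of_notMem hz], by
      rwa [hardyENorm_congr (G := F) fun z hz => by rw [indicator_of_mem hz]]⟩

theorem HardySpace.of_apply {p β : ℝ} [Fact (1 ≤ p)] {F : ℂ → ℂ}
    (hF : DifferentiableOn ℂ F (Metric.ball 0 1)) (hn : hardyENorm p β F < ∞) {z : ℂ}
    (hz : z ∈ Metric.ball (0 : ℂ) 1) : HardySpace.of p β F hF hn z = F z :=
  indicator_of_mem hz F

theorem HardySpace.ext_ball {p β : ℝ} [Fact (1 ≤ p)] {f g : HardySpace p β}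
    (h : ∀ z ∈ Metric.ball (0 : ℂ) 1, f z = g z) : f = g := by
  refine Subtype.ext (funext fun z => ?_)
  by_cases hz : z ∈ Metric.ball (0 : ℂ) 1
  · exact h z hz
  · exact (f.2.2.1 z hz).trans (g.2.2.1 z hz).symm

theorem HardySpace.differentiableOn {p β : ℝ} [Fact (1 ≤ p)] (f : HardySpace p β) :
    DifferentiableOn ℂ f (Metric.ball 0 1) := f.2.1

theorem HardySpace.eq_zero {p β : ℝ} [Fact (1 ≤ p)] (f : HardySpace p β) :
    ∀ z ∉ Metric.ball (0 : ℂ) 1, f z = 0 := f.2.2.1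

theorem HardySpace.norm_def {p β : ℝ} [Fact (1 ≤ p)] (f : HardySpace p β) :
    ‖f‖ = (hardyENorm p β f).toReal := rfl

theorem HardySpace.enorm_eq {p β : ℝ} [Fact (1 ≤ p)] (f : HardySpace p β) :
    ‖f‖ₑ = hardyENorm p β f := by
  rw [← ofReal_norm, HardySpace.norm_def, ENNReal.ofReal_toReal f.2.2.2.ne]

theorem HardySpace.add_apply {p β : ℝ} [Fact (1 ≤ p)] (f g : HardySpace p β) (z : ℂ) :
    (f + g : HardySpace p β) z = f z + g z := rfl

theorem HardySpace.sub_apply {p β : ℝ} [Fact (1 ≤ p)] (f g : HardySpace p β) (z : ℂ) :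
    (f - g : HardySpace p β) z = f z - g z := rfl

theorem HardySpace.smul_apply {p β : ℝ} [Fact (1 ≤ p)] (c : ℂ) (f : HardySpace p β) (z : ℂ) :
    (c • f : HardySpace p β) z = c * f z := rfl

theorem hardyENorm_le_of_norm_le {p : ℝ} (hp : 0 < p) {F : ℂ → ℂ} {M : ℝ}
    (hM : ∀ z ∈ Metric.ball (0 : ℂ) 1, ‖F z‖ ≤ M) :
    hardyENorm p 0 F ≤ radNorm p (fun _ => 1) 1 * ENNReal.ofReal M := by
  rw [hardyENorm_zero_weight_le_iff hp]
  intro r hr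
  have hM0 : 0 ≤ M := (norm_nonneg _).trans (hM 0 (by simp))
  calc radNorm p F r ≤ radNorm p (fun _ => (M : ℂ) * 1) r := by
        refine radNorm_mono_norm fun θ => ?_
        rw [mul_one, Complex.norm_real, Real.norm_of_nonneg hM0]
        exact hM _ (circleMap_mem hr θ)
    _ = ‖(M : ℂ)‖ₑ * radNorm p (fun _ => 1) r := radNorm_const_mul p (M : ℂ) (fun _ => 1) r
    _ = _ := by
        rw [mul_comm, ← ofReal_norm, Complex.norm_real, Real.norm_of_nonneg hM0]
        rfl

theorem hardyENorm_lt_top_of_norm_le {p : ℝ} (hp : 0 < p) {F : ℂ → ℂ} {M : ℝ}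
    (hM : ∀ z ∈ Metric.ball (0 : ℂ) 1, ‖F z‖ ≤ M) : hardyENorm p 0 F < ∞ :=
  (hardyENorm_le_of_norm_le hp hM).trans_lt
    (ENNReal.mul_lt_top (radNorm_const_ne_top _ _ _).lt_top ENNReal.ofReal_lt_top)

theorem norm_pow_le_one_of_mem_ball {z : ℂ} (hz : z ∈ Metric.ball (0 : ℂ) 1) (n : ℕ) :
    ‖z ^ n‖ ≤ 1 := by
  rw [norm_pow]
  exact pow_le_one₀ (norm_nonneg z) (mem_ball_zero_iff.1 hz).le

theorem fact_pos (p : ℝ) [hp : Fact (1 ≤ p)] : 0 < p := by linarith [hp.out]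

/-- The monomial `z ^ n` in the unweighted Hardy space. -/
def monomial (p : ℝ) [Fact (1 ≤ p)] (n : ℕ) : HardySpace p 0 :=
  HardySpace.of p 0 (fun z => z ^ n) (by fun_prop)
    (hardyENorm_lt_top_of_norm_le (fact_pos p) fun _ hz => norm_pow_le_one_of_mem_ball hz n)

theorem monomial_apply (p : ℝ) [Fact (1 ≤ p)] (n : ℕ) {z : ℂ} (hz : z ∈ Metric.ball (0 : ℂ) 1) :
    monomial p n z = z ^ n :=
  HardySpace.of_apply _ _ hz

theorem HardySpace.norm_le_of_norm_le {p : ℝ} [Fact (1 ≤ p)] {f : HardySpace p 0} {M : ℝ}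
    (hM : ∀ z ∈ Metric.ball (0 : ℂ) 1, ‖f z‖ ≤ M) :
    ‖f‖ ≤ (radNorm p (fun _ => 1) 1).toReal * M := by
  have hM0 : 0 ≤ M := (norm_nonneg _).trans (hM 0 (by simp))
  rw [HardySpace.norm_def]
  refine (ENNReal.toReal_mono (ENNReal.mul_ne_top (radNorm_const_ne_top _ _ _)
    ENNReal.ofReal_ne_top) (hardyENorm_le_of_norm_le (fact_pos p) hM)).trans ?_
  rw [ENNReal.toReal_mul, ENNReal.toReal_ofReal hM0]

theorem norm_monomial_le (p : ℝ) [Fact (1 ≤ p)] (n : ℕ) :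
    ‖monomial p n‖ ≤ (radNorm p (fun _ => 1) 1).toReal := by
  refine (HardySpace.norm_le_of_norm_le fun z hz => ?_).trans_eq (mul_one _)
  rw [monomial_apply p n hz]
  exact norm_pow_le_one_of_mem_ball hz n

theorem HardySpace.sum_apply {p β : ℝ} [Fact (1 ≤ p)] {ι : Type*} (s : Finset ι)
    (f : ι → HardySpace p β) (z : ℂ) : (∑ i ∈ s, f i : HardySpace p β) z = ∑ i ∈ s, f i z := by
  induction s using Finset.cons_induction with
  | empty => rfl
  | cons a s ha ih => rw [Finset.sum_cons, Finset.sum_cons, HardySpace.add_apply, ih]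

/-- A functional on the Hardy space acts term by term on absolutely convergent power series. -/
theorem hasSum_apply_monomial {p : ℝ} [Fact (1 ≤ p)] (φ : StrongDual ℂ (HardySpace p 0))
    {f : HardySpace p 0} {a : ℕ → ℂ} (ha : Summable fun n => ‖a n‖)
    (hf : ∀ z ∈ Metric.ball (0 : ℂ) 1, HasSum (fun n => a n * z ^ n) (f z)) :
    HasSum (fun n => a n * φ (monomial p n)) (φ f) := by
  set c := (radNorm p (fun _ => (1 : ℂ)) 1).toReal
  have hs : Summable fun n => a n * φ (monomial p n) := by
    refine Summable.of_norm_bounded (g := fun n => ‖a n‖ * (‖φ‖ * c)) (ha.mul_right _) fun n => ?_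
    rw [norm_mul]
    gcongr
    exact (φ.le_opNorm _).trans (by gcongr; exact norm_monomial_le p n)
  -- The partial sums converge uniformly on the disc, hence in the Hardy norm.
  have hlim : Tendsto (fun N => ∑ n ∈ Finset.range N, a n • monomial p n) atTop (𝓝 f) := by
    rw [tendsto_iff_norm_sub_tendsto_zero]
    have h0 : Tendsto (fun N => c * ∑' n, ‖a (n + N)‖) atTop (𝓝 0) := by
      simpa using (tendsto_sum_nat_add fun n => ‖a n‖).const_mul c
    refine squeeze_zero (fun _ => norm_nonneg _) (fun N => ?_) h0
    rw [norm_sub_rev]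
    refine HardySpace.norm_le_of_norm_le fun z hz => ?_
    have h1 : (f - ∑ n ∈ Finset.range N, a n • monomial p n : HardySpace p 0) z =
        ∑' n, a (n + N) * z ^ (n + N) := by
      rw [HardySpace.sub_apply, HardySpace.sum_apply, ← (hf z hz).tsum_eq,
        ← (hf z hz).summable.sum_add_tsum_nat_add N, add_sub_assoc, add_comm, sub_add_eq_add_sub]
      rw [sub_eq_iff_eq_add]
      congr 1
      refine Finset.sum_congr rfl fun n _ => ?_
      rw [HardySpace.smul_apply, monomial_apply p n hz]
    have h2 : Summable fun n => ‖a (n + N)‖ := (summable_nat_add_iff N).2 ha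
    have h3 : ∀ n, ‖a (n + N) * z ^ (n + N)‖ ≤ ‖a (n + N)‖ := fun n => by
      rw [norm_mul]
      exact mul_le_of_le_one_right (norm_nonneg _) (norm_pow_le_one_of_mem_ball hz _)
    rw [h1]
    exact tsum_of_norm_bounded h2.hasSum h3
  have h4 := (φ.continuous.tendsto f).comp hlim
  have h5 := hs.hasSum.tendsto_sum_nat
  have h6 : φ f = ∑' n, a n * φ (monomial p n) := by
    refine tendsto_nhds_unique h4 (h5.congr fun N => ?_)
    simp [map_sum]
  rw [h6]
  exact hs.hasSum

/-- Integration of an absolutely convergent Fourier series of nonpositive frequencies. -/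
theorem hasSum_integral_mul_conj_pow {g : ℝ → ℂ} (hg : Integrable g circ) {a : ℕ → ℂ}
    (ha : Summable fun n => ‖a n‖) :
    HasSum (fun n => a n * ∫ t, g t * starRingEnd ℂ (circleMap 0 1 t) ^ n ∂circ)
      (∫ t, g t * ∑' n, a n * starRingEnd ℂ (circleMap 0 1 t) ^ n ∂circ) := by
  have hu : ∀ n t, ‖starRingEnd ℂ (circleMap 0 1 t) ^ n‖ = 1 := fun n t => by
    rw [norm_pow, RCLike.norm_conj, norm_circleMap_zero, abs_one, one_pow]
  have hc : ∀ n, Continuous fun t => starRingEnd ℂ (circleMap 0 1 t) ^ n := fun n =>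
    (Complex.continuous_conj.comp (continuous_circleMap 0 1)).pow n
  have hi : ∀ n, Integrable (fun t => g t * (a n * starRingEnd ℂ (circleMap 0 1 t) ^ n)) circ :=
    fun n => hg.mul_bdd (c := ‖a n‖) (continuous_const.mul (hc n)).aestronglyMeasurable
      (Eventually.of_forall fun t => by rw [norm_mul, hu, mul_one])
  have h := hasSum_integral_of_summable_integral_norm hi (by
    simp only [norm_mul, hu, mul_one, integral_mul_const]
    exact ha.mul_left _)
  convert! h using 1
  · ext n
    rw [← integral_const_mul]
    congr 1
    ext t
    ring
  · congr 1
    ext t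
    exact tsum_mul_left.symm

/-! ### Power series of functionals and of Cauchy integrals -/

theorem tsum_pow_mul_conj_circleMap {w : ℂ} (hw : w ∈ Metric.ball (0 : ℂ) 1) (t : ℝ) :
    ∑' n, w ^ n * starRingEnd ℂ (circleMap 0 1 t) ^ n =
      circleMap 0 1 t / (circleMap 0 1 t - w) := by
  have h1 : starRingEnd ℂ (circleMap 0 1 t) = (circleMap 0 1 t)⁻¹ := by
    rw [Complex.inv_eq_conj (by simp)]
  have h2 : circleMap 0 1 t ≠ 0 := circleMap_ne_center one_ne_zero
  have h3 : circleMap 0 1 t - w ≠ 0 := sub_ne_zero_of_mem_sphere (by simp) hw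
  simp_rw [← mul_pow, h1]
  rw [tsum_geometric_of_norm_lt_one]
  · field_simp
  · rw [norm_mul, norm_inv, norm_circleMap_zero]
    simpa using hw

theorem summable_norm_pow {w : ℂ} (hw : w ∈ Metric.ball (0 : ℂ) 1) :
    Summable fun n : ℕ => ‖w ^ n‖ := by
  simp_rw [norm_pow]
  exact summable_geometric_of_lt_one (norm_nonneg w) (mem_ball_zero_iff.1 hw)

/-- The Cauchy integral of `g` has the nonnegative Fourier coefficients of `g` as its
Taylor coefficients. -/
theorem hasSum_cauchy_integral {g : ℝ → ℂ} (hg : Integrable g circ) {w : ℂ}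
    (hw : w ∈ Metric.ball (0 : ℂ) 1) :
    HasSum (fun n => w ^ n * ∫ t, g t * starRingEnd ℂ (circleMap 0 1 t) ^ n ∂circ)
      (∫ t, g t * (circleMap 0 1 t / (circleMap 0 1 t - w)) ∂circ) := by
  have h := hasSum_integral_mul_conj_pow hg (summable_norm_pow hw)
  simp_rw [tsum_pow_mul_conj_circleMap hw] at h
  exact h

theorem norm_integral_mul_conj_pow_le (g : ℝ → ℂ) (n : ℕ) :
    ‖∫ t, g t * starRingEnd ℂ (circleMap 0 1 t) ^ n ∂circ‖ ≤ ∫ t, ‖g t‖ ∂circ := by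
  refine (norm_integral_le_integral_norm _).trans_eq (integral_congr_ae
    (Eventually.of_forall fun t => ?_))
  simp

/-- The holomorphic function on the disc that represents the functional `φ`. -/
def representer {p : ℝ} [Fact (1 ≤ p)] (φ : StrongDual ℂ (HardySpace p 0)) (z : ℂ) : ℂ :=
  (2 * Real.pi : ℂ)⁻¹ * ∑' n, starRingEnd ℂ (φ (monomial p n)) * z ^ n

theorem exists_norm_apply_monomial_le {p : ℝ} [Fact (1 ≤ p)]
    (φ : StrongDual ℂ (HardySpace p 0)) : ∃ c, ∀ n, ‖φ (monomial p n)‖ ≤ c :=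
  ⟨‖φ‖ * (radNorm p (fun _ => (1 : ℂ)) 1).toReal, fun n =>
    (φ.le_opNorm _).trans (by gcongr; exact norm_monomial_le p n)⟩

/-- The monomials have uniformly bounded Hardy norm, so the Taylor coefficients are bounded and the
series converges locally uniformly on the disc. -/
theorem differentiableOn_representer {p : ℝ} [Fact (1 ≤ p)]
    (φ : StrongDual ℂ (HardySpace p 0)) :
    DifferentiableOn ℂ (representer φ) (Metric.ball 0 1) := by
  obtain ⟨c, hc⟩ := exists_norm_apply_monomial_le φ
  have hc0 : 0 ≤ c := (norm_nonneg _).trans (hc 0)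
  intro z hz
  obtain ⟨ρ, hzρ, hρ⟩ := exists_between (mem_ball_zero_iff.1 hz)
  have hρ0 : 0 ≤ ρ := (norm_nonneg z).trans hzρ.le
  have hd : DifferentiableOn ℂ (fun z => ∑' n, starRingEnd ℂ (φ (monomial p n)) * z ^ n)
      (Metric.ball 0 ρ) := by
    refine Complex.differentiableOn_tsum_of_summable_norm (u := fun n => c * ρ ^ n)
      ((summable_geometric_of_lt_one hρ0 hρ).mul_left c) (fun n => by fun_prop)
      Metric.isOpen_ball fun n w hw => ?_
    rw [norm_mul, RCLike.norm_conj, norm_pow]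
    have := (mem_ball_zero_iff.1 hw).le
    gcongr
    exact hc n
  have := (hd.differentiableAt (Metric.isOpen_ball.mem_nhds (mem_ball_zero_iff.2 hzρ))).const_mul
    (2 * Real.pi : ℂ)⁻¹
  exact this.differentiableWithinAt

theorem hasSum_cauchyTransform {g : ℂ → ℂ} (hg : ContinuousOn g (Metric.sphere 0 1)) {w : ℂ}
    (hw : w ∈ Metric.ball (0 : ℂ) 1) :
    HasSum (fun n => (2 * Real.pi : ℂ)⁻¹ *
      (∫ t, g (circleMap 0 1 t) * starRingEnd ℂ (circleMap 0 1 t) ^ n ∂circ) * w ^ n)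
      (cauchyTransform g w) := by
  have hgi : Integrable (fun t => g (circleMap 0 1 t)) circ :=
    (memLp_circ_of_continuous (continuous_comp_circleMap_one hg) 1).integrable le_rfl
  convert! (hasSum_cauchy_integral hgi hw).mul_left (2 * Real.pi : ℂ)⁻¹ using 1
  · ext n
    ring
  · rw [cauchyTransform_eq_integral]
    simp_rw [mul_comm (g _)]

theorem mem_ball_ofReal_mul {r : ℝ} (hr : r ∈ Ico (0 : ℝ) 1) {z : ℂ}
    (hz : z ∈ Metric.closedBall (0 : ℂ) 1) : (r : ℂ) * z ∈ Metric.ball (0 : ℂ) 1 := by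
  rw [mem_ball_zero_iff, norm_mul, Complex.norm_real, Real.norm_of_nonneg hr.1]
  exact (mul_le_of_le_one_right hr.1 (mem_closedBall_zero_iff.1 hz)).trans_lt hr.2

/-- A functional applied to a dilated Cauchy integral is the integral against its representer. -/
theorem apply_eq_integral_representer {p : ℝ} [Fact (1 ≤ p)] (φ : StrongDual ℂ (HardySpace p 0))
    {g : ℂ → ℂ} (hg : ContinuousOn g (Metric.sphere 0 1)) {r : ℝ} (hr : r ∈ Ico (0 : ℝ) 1)
    {f : HardySpace p 0} (hf : ∀ z ∈ Metric.ball (0 : ℂ) 1, f z = cauchyTransform g (r * z)) :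
    φ f = ∫ t, g (circleMap 0 1 t) *
      starRingEnd ℂ (representer φ (circleMap 0 r t)) ∂circ := by
  have hgi : Integrable (fun t => g (circleMap 0 1 t)) circ :=
    (memLp_circ_of_continuous (continuous_comp_circleMap_one hg) 1).integrable le_rfl
  obtain ⟨c, hc⟩ := exists_norm_apply_monomial_le φ
  have hgeo : Summable fun n : ℕ => r ^ n := summable_geometric_of_lt_one hr.1 hr.2
  set m : ℕ → ℂ := fun n => ∫ t, g (circleMap 0 1 t) * starRingEnd ℂ (circleMap 0 1 t) ^ n ∂circ

  -- The dilation supplies the factor $r^n$: the Fourier coefficients $m_n$ and the numbers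
  -- $\varphi(z^n)$ are merely bounded, and this makes both series converge absolutely.
  have ha : Summable fun n => ‖(2 * Real.pi : ℂ)⁻¹ * m n * (r : ℂ) ^ n‖ := by
    refine Summable.of_nonneg_of_le (fun _ => norm_nonneg _) (fun n => ?_)
      (hgeo.mul_left (‖(2 * Real.pi : ℂ)⁻¹‖ * ∫ t, ‖g (circleMap 0 1 t)‖ ∂circ))
    rw [norm_mul, norm_mul, norm_pow, Complex.norm_real, Real.norm_of_nonneg hr.1]
    have := pow_nonneg hr.1 n
    gcongr
    exact norm_integral_mul_conj_pow_le _ n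
  have h1 := hasSum_apply_monomial φ (f := f) ha fun z hz => by
    rw [hf z hz]
    convert! hasSum_cauchyTransform hg
      (mem_ball_ofReal_mul hr (Metric.ball_subset_closedBall hz)) using 2 with n
    rw [mul_pow]
    ring
  have hb : Summable fun n => ‖φ (monomial p n) * (r : ℂ) ^ n‖ := by
    refine Summable.of_nonneg_of_le (fun _ => norm_nonneg _) (fun n => ?_) (hgeo.mul_left c)
    rw [norm_mul, norm_pow, Complex.norm_real, Real.norm_of_nonneg hr.1]
    have := pow_nonneg hr.1 n
    gcongr
    exact hc n
  have h2 := (hasSum_integral_mul_conj_pow hgi hb).mul_left (2 * Real.pi : ℂ)⁻¹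
  -- Both sides of the claim are sums of the same terms $(2\pi)^{-1}m_n r^n\varphi(z^n)$.
  have h3 : (fun n => (2 * Real.pi : ℂ)⁻¹ * (φ (monomial p n) * (r : ℂ) ^ n * m n)) =
      fun n => (2 * Real.pi : ℂ)⁻¹ * m n * (r : ℂ) ^ n * φ (monomial p n) := by
    ext n
    ring
  change HasSum (fun n => (2 * Real.pi : ℂ)⁻¹ * (φ (monomial p n) * (r : ℂ) ^ n * m n)) _ at h2
  rw [h3] at h2
  rw [h1.unique h2, ← integral_const_mul]
  refine integral_congr_ae (Eventually.of_forall fun t => ?_)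
  have h4 : starRingEnd ℂ (representer φ (circleMap 0 r t)) = (2 * Real.pi : ℂ)⁻¹ *
      ∑' n, φ (monomial p n) * (r : ℂ) ^ n * starRingEnd ℂ (circleMap 0 1 t) ^ n := by
    rw [representer, map_mul, Complex.conj_tsum, map_inv₀, map_mul, Complex.conj_ofReal,
      map_ofNat]
    congr 2
    ext n
    rw [map_mul, Complex.conj_conj, map_pow, ← mul_one r, ← ofReal_mul_circleMap, map_mul,
      Complex.conj_ofReal, mul_one, mul_pow, mul_assoc]
  simp only [h4]
  ring

/-- The representer of a functional on `H^p` lies in `H^q`. -/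
theorem exists_hardyENorm_representer_le {p q : ℝ} [Fact (1 ≤ p)] (hp : 1 < p)
    (hpq : p.HolderConjugate q) :
    ∃ B : ℝ≥0∞, B ≠ ∞ ∧ ∀ φ : StrongDual ℂ (HardySpace p 0),
      hardyENorm q 0 (representer φ) ≤ B * ‖φ‖ₑ := by
  obtain ⟨B, hB, h⟩ := exists_radNorm_cauchyTransform_le hp
  refine ⟨B, hB, fun φ => ?_⟩
  rw [hardyENorm_zero_weight_le_iff hpq.symm.pos]
  intro r hr
  have hd := differentiableOn_representer φ
  have hc := (diffContOnCl_comp_mul hd hr).continuousOn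
  rw [closure_ball _ one_ne_zero] at hc
  rw [← mul_one r, ← radNorm_comp_mul]
  refine radNorm_le_of_forall_integral_le hpq.symm (hc.mono Metric.sphere_subset_closedBall)
    fun k hk => ?_
  have hCk : DifferentiableOn ℂ (fun z => cauchyTransform k (r * z)) (Metric.ball 0 1) :=
    (diffContOnCl_comp_mul (differentiableOn_cauchyTransform hk) hr).differentiableOn
  have hn : hardyENorm p 0 (fun z => cauchyTransform k (r * z)) ≤ B * radNorm p k 1 := by
    rw [hardyENorm_zero_weight_le_iff (by linarith)]
    intro s hs
    rw [radNorm_comp_mul]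
    exact h k hk _ ⟨mul_nonneg hr.1 hs.1, mul_lt_one_of_nonneg_of_lt_one_left hr.1 hr.2 hs.2.le⟩
  have hk1 : radNorm p k 1 ≠ ∞ :=
    (memLp_circ_of_continuous (continuous_comp_circleMap_one hk) _).2.ne
  set f := HardySpace.of p 0 _ hCk (hn.trans_lt (ENNReal.mul_lt_top hB.lt_top hk1.lt_top)) with hfd
  have hφf := apply_eq_integral_representer φ hk hr (f := f) fun z hz =>
    HardySpace.of_apply _ _ hz
  -- The test integral is a value of the functional at $f$, the dilated Cauchy transform of $k$,
  -- whose norm Riesz's theorem controls.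
  have hconj : ∫ θ, representer φ (r * circleMap 0 1 θ) * starRingEnd ℂ (k (circleMap 0 1 θ)) ∂circ
      = starRingEnd ℂ (φ f) := by
    rw [hφf, ← integral_conj]
    refine integral_congr_ae (Eventually.of_forall fun t => ?_)
    simp only [ofReal_mul_circleMap, mul_one, map_mul, Complex.conj_conj]
    ring
  rw [hconj, ← ofReal_norm, RCLike.norm_conj, ofReal_norm]
  calc ‖φ f‖ₑ ≤ ‖φ‖ₑ * ‖f‖ₑ := φ.le_opENorm f
    _ ≤ ‖φ‖ₑ * (B * radNorm p k 1) := by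
        gcongr
        rw [HardySpace.enorm_eq]
        refine le_trans (le_of_eq (hardyENorm_congr fun z hz => ?_)) hn
        exact HardySpace.of_apply _ _ hz
    _ = B * ‖φ‖ₑ * radNorm p k 1 := by ring

theorem hardyENorm_representer_lt_top {p q : ℝ} [Fact (1 ≤ p)] (hpq : p.HolderConjugate q)
    (φ : StrongDual ℂ (HardySpace p 0)) : hardyENorm q 0 (representer φ) < ∞ := by
  obtain ⟨B, hB, h⟩ := exists_hardyENorm_representer_le hpq.lt hpq
  exact (h φ).trans_lt (ENNReal.mul_lt_top hB.lt_top enorm_lt_top)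

/-! ### Boundary values in the unweighted Hardy space -/

section

variable {p q : ℝ} [Fact (1 ≤ p)] [Fact (1 ≤ q)]

theorem HardySpace.radNorm_le (f : HardySpace p 0) :
    ∀ r ∈ Ico (0 : ℝ) 1, radNorm p f r ≤ ‖f‖ₑ :=
  (hardyENorm_zero_weight_le_iff (fact_pos p)).1 (HardySpace.enorm_eq f).ge

/-- `boundaryValue` is a `limUnder`, meaningful only where the limit exists; almost everywhere it
agrees with the function from `exists_boundary`, whose properties it inherits. -/
theorem HardySpace.memLp_boundaryValue_and_tendsto (hp : 1 < p) (f : HardySpace p 0) :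
    MemLp (boundaryValue f) (ENNReal.ofReal p) circ ∧
      Tendsto (fun r : ℝ => eLpNorm ((fun θ => f (circleMap 0 r θ)) - boundaryValue f)
        (ENNReal.ofReal p) circ) (𝓝[<] 1) (𝓝 0) ∧
      ∀ᵐ θ ∂circ, Tendsto (fun r : ℝ => f (circleMap 0 r θ)) (𝓝[<] 1) (𝓝 (boundaryValue f θ)) := by
  obtain ⟨g, hg, hlim, hae⟩ := exists_boundary hp f.differentiableOn f.eq_zero
    (enorm_lt_top (x := f)).ne f.radNorm_le
  have h : g =ᵐ[circ] boundaryValue f := hae.mono fun θ hθ => hθ.limUnder_eq.symm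
  refine ⟨(memLp_congr_ae h).1 hg, hlim.congr fun r => eLpNorm_congr_ae ?_, ?_⟩
  · filter_upwards [h] with θ hθ
    simp [hθ]
  · filter_upwards [h, hae] with θ hθ h1
    rwa [← hθ]

theorem HardySpace.eLpNorm_boundaryValue_le (hp : 1 < p) (f : HardySpace p 0) :
    eLpNorm (boundaryValue f) (ENNReal.ofReal p) circ ≤ ‖f‖ₑ := by
  obtain ⟨hm, hlim, -⟩ := f.memLp_boundaryValue_and_tendsto hp
  have h1 : (1 : ℝ≥0∞) ≤ ENNReal.ofReal p := (fact_one_le_ofReal hp.le).out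
  have h2 : Tendsto (fun r : ℝ => ‖f‖ₑ + eLpNorm ((fun θ => f (circleMap 0 r θ)) -
      boundaryValue f) (ENNReal.ofReal p) circ) (𝓝[<] 1) (𝓝 (‖f‖ₑ + 0)) := hlim.const_add _
  rw [add_zero] at h2
  refine ge_of_tendsto h2 ?_
  filter_upwards [Ioo_mem_nhdsLT (zero_lt_one' ℝ)] with r hr
  have hfr := memLp_comp_circleMap f.differentiableOn f.eq_zero (ENNReal.ofReal p) r
  have h3 : boundaryValue f = (fun θ => f (circleMap 0 r θ)) -
      ((fun θ => f (circleMap 0 r θ)) - boundaryValue f) := by simp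
  calc eLpNorm (boundaryValue f) (ENNReal.ofReal p) circ
      = eLpNorm ((fun θ => f (circleMap 0 r θ)) -
          ((fun θ => f (circleMap 0 r θ)) - boundaryValue f)) (ENNReal.ofReal p) circ := by
        rw [← h3]
    _ ≤ _ := eLpNorm_sub_le hfr.1 (hfr.1.sub hm.1) h1
    _ ≤ _ := by
        gcongr
        exact f.radNorm_le r ⟨hr.1.le, hr.2⟩

theorem HardySpace.boundaryValue_add (hp : 1 < p) (f g : HardySpace p 0) :
    boundaryValue (f + g : HardySpace p 0) =ᵐ[circ]
      fun θ => boundaryValue f θ + boundaryValue g θ := by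
  filter_upwards [(f.memLp_boundaryValue_and_tendsto hp).2.2,
    (g.memLp_boundaryValue_and_tendsto hp).2.2] with θ hf hg
  exact (hf.add hg).limUnder_eq

theorem HardySpace.boundaryValue_smul (hp : 1 < p) (c : ℂ) (f : HardySpace p 0) :
    boundaryValue (c • f : HardySpace p 0) =ᵐ[circ] fun θ => c * boundaryValue f θ := by
  filter_upwards [(f.memLp_boundaryValue_and_tendsto hp).2.2] with θ hf
  exact (hf.const_mul c).limUnder_eq

theorem boundaryValue_monomial (n : ℕ) :
    boundaryValue (monomial p n) = fun θ => circleMap 0 1 θ ^ n := by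
  ext θ
  refine Tendsto.limUnder_eq ?_
  have h : Tendsto (fun r : ℝ => circleMap 0 r θ ^ n) (𝓝[<] 1) (𝓝 (circleMap 0 1 θ ^ n)) := by
    have := (tendsto_ofReal_mul (circleMap 0 1 θ)).pow n
    simpa only [ofReal_mul_circleMap, mul_one] using this
  refine h.congr' ?_
  filter_upwards [Ioo_mem_nhdsLT (zero_lt_one' ℝ)] with r hr
  exact (monomial_apply p n (circleMap_mem ⟨hr.1.le, hr.2⟩ θ)).symm

/-! ### Dilations -/

theorem HardySpace.hardyENorm_dilate_lt_top (f : HardySpace p 0) {r : ℝ}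
    (hr : r ∈ Ico (0 : ℝ) 1) : hardyENorm p 0 (fun z => f (r * z)) < ∞ := by
  refine lt_of_le_of_lt ?_ (enorm_lt_top (x := f))
  rw [hardyENorm_zero_weight_le_iff (fact_pos p)]
  intro s hs
  rw [radNorm_comp_mul]
  exact f.radNorm_le _
    ⟨mul_nonneg hr.1 hs.1, mul_lt_one_of_nonneg_of_lt_one_left hr.1 hr.2 hs.2.le⟩

/-- The dilation `z ↦ f (r z)`. -/
def HardySpace.dilate (f : HardySpace p 0) (r : Ico (0 : ℝ) 1) : HardySpace p 0 :=
  HardySpace.of p 0 (fun z => f ((r : ℝ) * z))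
    (diffContOnCl_comp_mul f.differentiableOn r.2).differentiableOn
    (f.hardyENorm_dilate_lt_top r.2)

theorem HardySpace.dilate_apply (f : HardySpace p 0) (r : Ico (0 : ℝ) 1) {z : ℂ}
    (hz : z ∈ Metric.ball (0 : ℂ) 1) : f.dilate r z = f ((r : ℝ) * z) :=
  HardySpace.of_apply _ _ hz

/-- The Hardy norm is a supremum over all radii $r$, but the means of $f-f(s\,\cdot)$ increase with
the radius. So $r$ may be replaced by an $x>r$ so near $1$ that both $x$ and $sx$ lie in the range
of the Cauchy estimate. -/
theorem HardySpace.eventually_enorm_sub_dilate_le (hp : 1 < p) (f : HardySpace p 0) {ε : ℝ≥0∞}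
    (hε : 0 < ε) : ∀ᶠ s : ℝ in 𝓝[<] 1, ∀ hs : s ∈ Ico (0 : ℝ) 1,
      ‖f - f.dilate ⟨s, hs⟩‖ₑ ≤ ε := by
  have h := (tendsto_eLpNorm_circle_sub hp f.differentiableOn (enorm_lt_top (x := f)).ne
    f.radNorm_le).eventually_le_const hε
  obtain ⟨t, ht, hst⟩ := Filter.eventually_prod_self_iff'.1 h
  obtain ⟨δ, hδ, hδt⟩ := (mem_nhdsLT_iff_exists_Ioo_subset' (zero_lt_one' ℝ)).1 ht
  filter_upwards [Ioo_mem_nhdsLT hδ] with s hs hs01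
  rw [HardySpace.enorm_eq, hardyENorm_zero_weight_le_iff (fact_pos p)]
  intro r hr
  have hsr : Tendsto (fun x : ℝ => s * x) (𝓝[<] 1) (𝓝 s) := by
    have : Tendsto (fun x : ℝ => s * x) (𝓝 1) (𝓝 (s * 1)) := (continuous_const_mul s).tendsto 1
    rw [mul_one] at this
    exact this.mono_left nhdsWithin_le_nhds
  have h1 : ∀ᶠ x : ℝ in 𝓝[<] 1, x ∈ Ioo δ 1 := Ioo_mem_nhdsLT hδ
  have h2 : ∀ᶠ x : ℝ in 𝓝[<] 1, x ∈ Ioo r 1 := Ioo_mem_nhdsLT hr.2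
  obtain ⟨x, hx1, hx2, hx3⟩ :=
    (h1.and (h2.and (hsr.eventually (Ioo_mem_nhds hs.1 hs.2)))).exists
  have hx0 : x ∈ Ico (0 : ℝ) 1 := ⟨hr.1.trans hx2.1.le, hx2.2⟩
  refine (radNorm_mono hp (f - f.dilate ⟨s, hs01⟩).differentiableOn hr.1 hx2.1.le hx2.2).trans ?_
  refine le_trans (le_of_eq ?_) (hst x (hδt hx1) (s * x) (hδt hx3))
  refine congrArg (fun u => eLpNorm u (ENNReal.ofReal p) circ) (funext fun θ => ?_)
  rw [HardySpace.sub_apply, HardySpace.dilate_apply _ _ (circleMap_mem hx0 θ),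
    ofReal_mul_circleMap, Pi.sub_apply]

/-! ### The duality in the unweighted case -/

/-- The pairing of two boundary functions. -/
def pairing (f : HardySpace p 0) (h : HardySpace q 0) : ℂ :=
  ∫ θ, boundaryValue f θ * starRingEnd ℂ (boundaryValue h θ) ∂circ

theorem memLp_conj {g : ℝ → ℂ} {r : ℝ≥0∞} (hg : MemLp g r circ) :
    MemLp (fun θ => starRingEnd ℂ (g θ)) r circ :=
  hg.star

theorem integrable_boundaryValue_mul (hpq : p.HolderConjugate q) (f : HardySpace p 0)
    (h : HardySpace q 0) :
    Integrable (fun θ => boundaryValue f θ * starRingEnd ℂ (boundaryValue h θ)) circ := by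
  have := hpq.ennrealOfReal
  exact (f.memLp_boundaryValue_and_tendsto hpq.lt).1.integrable_mul
    (memLp_conj (h.memLp_boundaryValue_and_tendsto hpq.symm.lt).1)

theorem enorm_pairing_le (hpq : p.HolderConjugate q) (f : HardySpace p 0) (h : HardySpace q 0) :
    ‖pairing f h‖ₑ ≤ ‖f‖ₑ * ‖h‖ₑ := by
  have := hpq.ennrealOfReal
  refine (enorm_integral_mul_conj_le (f.memLp_boundaryValue_and_tendsto hpq.lt).1.1
    (h.memLp_boundaryValue_and_tendsto hpq.symm.lt).1.1 (p := ENNReal.ofReal p)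
    (q := ENNReal.ofReal q)).trans ?_
  gcongr
  · exact f.eLpNorm_boundaryValue_le hpq.lt
  · exact h.eLpNorm_boundaryValue_le hpq.symm.lt

theorem norm_pairing_le (hpq : p.HolderConjugate q) (f : HardySpace p 0) (h : HardySpace q 0) :
    ‖pairing f h‖ ≤ ‖h‖ * ‖f‖ := by
  have := ENNReal.toReal_mono (ENNReal.mul_ne_top enorm_ne_top enorm_ne_top)
    (enorm_pairing_le hpq f h)
  rwa [ENNReal.toReal_mul, toReal_enorm, toReal_enorm, toReal_enorm, mul_comm] at this

theorem pairing_add_left (hpq : p.HolderConjugate q) (f g : HardySpace p 0) (h : HardySpace q 0) :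
    pairing (f + g) h = pairing f h + pairing g h := by
  rw [pairing, pairing, pairing, ← integral_add (integrable_boundaryValue_mul hpq f h)
    (integrable_boundaryValue_mul hpq g h)]
  refine integral_congr_ae ?_
  filter_upwards [f.boundaryValue_add hpq.lt g] with θ hθ
  rw [hθ, add_mul]

theorem pairing_smul_left (hpq : p.HolderConjugate q) (c : ℂ) (f : HardySpace p 0)
    (h : HardySpace q 0) : pairing (c • f) h = c * pairing f h := by
  rw [pairing, pairing, ← integral_const_mul]
  refine integral_congr_ae ?_
  filter_upwards [f.boundaryValue_smul hpq.lt c] with θ hθ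
  rw [hθ, mul_assoc]

/-- Transfers facts about the first argument to the second, with the exponents interchanged. -/
theorem pairing_conj_symm (f : HardySpace p 0) (h : HardySpace q 0) :
    pairing f h = starRingEnd ℂ (pairing h f) := by
  rw [pairing, pairing, ← integral_conj]
  simp [mul_comm]

/-- The functional on `H^p` given by pairing with an element of `H^q`. -/
def pairingFunctional (hpq : p.HolderConjugate q) (h : HardySpace q 0) :
    StrongDual ℂ (HardySpace p 0) :=
  LinearMap.mkContinuous
    { toFun := fun f => pairing f h
      map_add' := fun f g => pairing_add_left hpq f g h
      map_smul' := fun c f => pairing_smul_left hpq c f h } ‖h‖ fun f => norm_pairing_le hpq f h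

theorem pairingFunctional_apply (hpq : p.HolderConjugate q) (h : HardySpace q 0)
    (f : HardySpace p 0) : pairingFunctional hpq h f = pairing f h := rfl

theorem norm_pairingFunctional_le (hpq : p.HolderConjugate q) (h : HardySpace q 0) :
    ‖pairingFunctional hpq h‖ ≤ ‖h‖ :=
  LinearMap.mkContinuous_norm_le _ (norm_nonneg h) _

theorem cauchyTransform_eq_self {F : ℂ → ℂ} (hF : DiffContOnCl ℂ F (Metric.ball 0 1)) {z : ℂ}
    (hz : z ∈ Metric.ball (0 : ℂ) 1) : cauchyTransform F z = F z := by
  have hF' : DiffContOnCl ℂ F (Metric.ball 0 |1|) := by rwa [abs_one]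
  simpa [cauchyTransform] using hF'.circleAverage_smul_div (by simpa using hz)

/-- Pairing with `h` is represented by `h` itself. -/
theorem representer_pairingFunctional (hpq : p.HolderConjugate q) (h : HardySpace q 0) {z : ℂ}
    (hz : z ∈ Metric.ball (0 : ℂ) 1) : representer (pairingFunctional hpq h) z = h z := by
  have hq := hpq.symm.lt
  obtain ⟨hm, hlim, -⟩ := h.memLp_boundaryValue_and_tendsto hq
  have := fact_one_le_ofReal hpq.lt.le
  have := fact_one_le_ofReal hq.le
  have := hpq.symm.ennrealOfReal
  have hmi : Integrable (boundaryValue h) circ :=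
    hm.integrable (fact_one_le_ofReal hq.le).out
  -- The Taylor coefficients are the nonnegative Fourier coefficients of the boundary values of $h$,
  -- so the representer is their Cauchy integral.
  have h1 : representer (pairingFunctional hpq h) z = (2 * Real.pi : ℂ)⁻¹ *
      ∫ t, boundaryValue h t * (circleMap 0 1 t / (circleMap 0 1 t - z)) ∂circ := by
    rw [← (hasSum_cauchy_integral hmi hz).tsum_eq, representer]
    congr 2
    ext n
    rw [pairingFunctional_apply, pairing_conj_symm, Complex.conj_conj, pairing,
      boundaryValue_monomial, mul_comm]
    simp
  have hk : Continuous fun t => circleMap 0 1 t / (circleMap 0 1 t - z) :=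
    (continuous_circleMap 0 1).div ((continuous_circleMap 0 1).sub continuous_const)
      fun t => sub_ne_zero_of_mem_sphere (by simp) hz
  have h2 := tendsto_integral_mul (p := ENNReal.ofReal q) (q := ENNReal.ofReal p) (l := 𝓝[<] 1)
    (f := fun (r : ℝ) θ => h (circleMap 0 r θ))
    (h := fun _ t => circleMap 0 1 t / (circleMap 0 1 t - z))
    (fun r => memLp_comp_circleMap h.differentiableOn h.eq_zero _ r) hm
    (fun _ => memLp_circ_of_continuous hk _) (memLp_circ_of_continuous hk _) hlim
    (by simp)
  have h3 : Tendsto (fun r : ℝ => h (r * z)) (𝓝[<] 1) (𝓝 (h z)) :=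
    (h.differentiableOn.continuousOn.continuousAt (Metric.isOpen_ball.mem_nhds hz)).tendsto.comp
      (tendsto_ofReal_mul z)
  rw [h1]
  -- Cauchy's formula for the dilates $h(r\,\cdot)$ yields $h(z)$ as $r\to1$.
  refine tendsto_nhds_unique ((h2.const_mul (2 * Real.pi : ℂ)⁻¹).congr' ?_) h3
  filter_upwards [Ioo_mem_nhdsLT (zero_lt_one' ℝ)] with r hr
  have hd := diffContOnCl_comp_mul h.differentiableOn ⟨hr.1.le, hr.2⟩
  rw [← cauchyTransform_eq_self hd hz, cauchyTransform_eq_integral]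
  simp_rw [ofReal_mul_circleMap, mul_one, mul_comm (h _)]

/-- A functional is the pairing with its representer. -/
theorem apply_eq_pairing (hpq : p.HolderConjugate q) (φ : StrongDual ℂ (HardySpace p 0))
    {h : HardySpace q 0} (hh : ∀ z ∈ Metric.ball (0 : ℂ) 1, h z = representer φ z)
    (f : HardySpace p 0) : φ f = pairing f h := by
  have hp := hpq.lt
  obtain ⟨hm, hlim, -⟩ := f.memLp_boundaryValue_and_tendsto hp
  obtain ⟨hmh, hlimh, -⟩ := h.memLp_boundaryValue_and_tendsto hpq.symm.lt
  have := fact_one_le_ofReal hp.le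
  have := fact_one_le_ofReal hpq.symm.lt.le
  have := hpq.ennrealOfReal
  have h2 := tendsto_integral_mul (p := ENNReal.ofReal p) (q := ENNReal.ofReal q) (l := 𝓝[<] 1)
    (f := fun (r : ℝ) θ => f (circleMap 0 r θ))
    (h := fun (r : ℝ) θ => starRingEnd ℂ (h (circleMap 0 r θ)))
    (k := fun θ => starRingEnd ℂ (boundaryValue h θ))
    (fun r => memLp_comp_circleMap f.differentiableOn f.eq_zero _ r) hm
    (fun r => memLp_conj (memLp_comp_circleMap h.differentiableOn h.eq_zero _ r))
    (memLp_conj hmh) hlim (hlimh.congr fun r => eLpNorm_congr_norm_ae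
      (Eventually.of_forall fun θ => by simp [← map_sub]))
  have h3 : ∀ᶠ r : ℝ in 𝓝[<] 1, r ∈ Ioo (0 : ℝ) 1 := Ioo_mem_nhdsLT zero_lt_one
  have hsq : Tendsto (fun r : ℝ => r * r) (𝓝[<] 1) (𝓝[<] 1) := by
    refine tendsto_nhdsWithin_iff.2 ⟨?_, h3.mono fun r hr =>
      mul_lt_one_of_nonneg_of_lt_one_left hr.1.le hr.2 hr.2.le⟩
    have : Tendsto (fun r : ℝ => r * r) (𝓝 1) (𝓝 (1 * 1)) := tendsto_id.mul tendsto_id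
    rw [mul_one] at this
    exact this.mono_left nhdsWithin_le_nhds
  -- Taking $g=f(r\,\cdot)$ in the integral formula at radius $r$ dilates twice: the integral is
  -- $\varphi$ at the dilate of $f$ by $r^2$, and these dilates tend to $f$ in norm.
  have h4 : Tendsto (fun r : ℝ => ∫ θ, f (circleMap 0 r θ) *
      starRingEnd ℂ (h (circleMap 0 r θ)) ∂circ) (𝓝[<] 1) (𝓝 (φ f)) := by
    rw [EMetric.tendsto_nhds]
    intro ε hε
    obtain ⟨δ, hδ, hδε⟩ : ∃ δ : ℝ≥0∞, 0 < δ ∧ ‖φ‖ₑ * δ < ε := by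
      have : Tendsto (fun δ : ℝ≥0∞ => ‖φ‖ₑ * δ) (𝓝[>] 0) (𝓝 (‖φ‖ₑ * 0)) :=
        (ENNReal.Tendsto.const_mul tendsto_id (Or.inr enorm_ne_top)).mono_left nhdsWithin_le_nhds
      rw [mul_zero] at this
      obtain ⟨δ, h1, h2⟩ := ((this.eventually_lt_const hε).and self_mem_nhdsWithin).exists
      exact ⟨δ, h2, h1⟩
    filter_upwards [h3, hsq.eventually (f.eventually_enorm_sub_dilate_le hp hδ)] with r hr hrδ
    have hr' : r ∈ Ico (0 : ℝ) 1 := ⟨hr.1.le, hr.2⟩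
    have hrr : r * r ∈ Ico (0 : ℝ) 1 :=
      ⟨mul_nonneg hr.1.le hr.1.le, mul_lt_one_of_nonneg_of_lt_one_left hr.1.le hr.2 hr.2.le⟩
    have hd := diffContOnCl_comp_mul f.differentiableOn hr'
    have hc := hd.continuousOn
    rw [closure_ball _ one_ne_zero] at hc
    have h5 := apply_eq_integral_representer φ (hc.mono Metric.sphere_subset_closedBall) hr'
      (f := f.dilate ⟨r * r, hrr⟩) fun z hz => by
        rw [HardySpace.dilate_apply _ _ hz, cauchyTransform_eq_self hd
          (mem_ball_ofReal_mul hr' (Metric.ball_subset_closedBall hz))]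
        push_cast
        rw [mul_assoc]
    have h6 : ∫ θ, f (circleMap 0 r θ) * starRingEnd ℂ (h (circleMap 0 r θ)) ∂circ =
        φ (f.dilate ⟨r * r, hrr⟩) := by
      rw [h5]
      simp_rw [ofReal_mul_circleMap, mul_one, hh _ (circleMap_mem hr' _)]
    rw [h6, edist_comm, edist_eq_enorm_sub, ← map_sub]
    exact ((φ.le_opENorm _).trans (by gcongr; exact hrδ hrr)).trans_lt hδε
  exact tendsto_nhds_unique h4 h2

theorem pairingFunctional_add (hpq : p.HolderConjugate q) (g h : HardySpace q 0) :
    pairingFunctional hpq (g + h) = pairingFunctional hpq g + pairingFunctional hpq h := by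
  ext f
  simp only [pairingFunctional_apply, add_apply]
  rw [pairing_conj_symm, pairing_add_left hpq.symm, map_add, ← pairing_conj_symm,
    ← pairing_conj_symm]

theorem pairingFunctional_smul (hpq : p.HolderConjugate q) (c : ℂ) (h : HardySpace q 0) :
    pairingFunctional hpq (c • h) = starRingEnd ℂ c • pairingFunctional hpq h := by
  ext f
  simp only [pairingFunctional_apply, smul_apply, smul_eq_mul]
  rw [pairing_conj_symm, pairing_smul_left hpq.symm, map_mul, ← pairing_conj_symm]

/-- The pairing as a conjugate-linear bijection onto the dual. -/
def pairingLinearEquiv (hpq : p.HolderConjugate q) :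
    HardySpace q 0 ≃ₛₗ[starRingEnd ℂ] StrongDual ℂ (HardySpace p 0) where
  toFun := pairingFunctional hpq
  map_add' := pairingFunctional_add hpq
  map_smul' := pairingFunctional_smul hpq
  invFun φ := HardySpace.of q 0 (representer φ) (differentiableOn_representer φ)
    (hardyENorm_representer_lt_top hpq φ)
  left_inv h := HardySpace.ext_ball fun z hz => by
    rw [HardySpace.of_apply _ _ hz, representer_pairingFunctional hpq h hz]
  right_inv φ := by
    ext f
    rw [pairingFunctional_apply]
    exact (apply_eq_pairing hpq φ (fun z hz => HardySpace.of_apply _ _ hz) f).symm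

/-- The constant of Riesz's theorem bounds the inverse directly, so neither completeness of the
Hardy space nor the open mapping theorem is needed. -/
theorem exists_norm_pairingLinearEquiv_symm_le (hpq : p.HolderConjugate q) :
    ∃ B : ℝ, ∀ φ, ‖(pairingLinearEquiv hpq).symm φ‖ ≤ B * ‖φ‖ := by
  obtain ⟨B, hB, h⟩ := exists_hardyENorm_representer_le hpq.lt hpq
  refine ⟨B.toReal, fun φ => ?_⟩
  have h1 : ‖(pairingLinearEquiv hpq).symm φ‖ₑ ≤ B * ‖φ‖ₑ := by
    rw [HardySpace.enorm_eq]
    refine le_trans (le_of_eq (hardyENorm_congr fun z hz => ?_)) (h φ)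
    exact HardySpace.of_apply (differentiableOn_representer φ)
      (hardyENorm_representer_lt_top hpq φ) hz
  have := ENNReal.toReal_mono (ENNReal.mul_ne_top hB enorm_ne_top) h1
  rwa [ENNReal.toReal_mul, toReal_enorm, toReal_enorm] at this

/-- Duality for the unweighted Hardy spaces. -/
def pairingEquiv (hpq : p.HolderConjugate q) :
    HardySpace q 0 ≃L⋆[ℂ] StrongDual ℂ (HardySpace p 0) :=
  (pairingLinearEquiv hpq).toContinuousLinearEquivOfBounds 1
    (exists_norm_pairingLinearEquiv_symm_le hpq).choose
    (fun h => by rw [one_mul]; exact norm_pairingFunctional_le hpq h)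
    (exists_norm_pairingLinearEquiv_symm_le hpq).choose_spec

end

/-! ### Removing the weight -/

/-- The power `(1 - z) ^ a`, holomorphic on the disc. -/
def weightPow (a : ℝ) (z : ℂ) : ℂ := (1 - z) ^ (a : ℂ)

/-- $\operatorname{Re}(1-z)>0$ on the closed disc away from $1$, so the principal branch of the
power is also continuous at the boundary points other than $1$. -/
theorem one_sub_mem_slitPlane {z : ℂ} (hz : z ∈ Metric.closedBall (0 : ℂ) 1) (h1 : z ≠ 1) :
    1 - z ∈ Complex.slitPlane := by
  rw [mem_closedBall_zero_iff] at hz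
  refine Complex.mem_slitPlane_iff.2 (Or.inl ?_)
  rw [Complex.sub_re, Complex.one_re, sub_pos]
  refine lt_of_le_of_ne ((Complex.re_le_norm z).trans hz) fun h => h1 ?_
  have h2 : ‖z‖ ^ 2 ≤ 1 := by nlinarith [norm_nonneg z]
  rw [← Complex.normSq_eq_norm_sq, Complex.normSq_apply, h] at h2
  exact Complex.ext h (by simpa using (by nlinarith : z.im * z.im ≤ 0).antisymm (mul_self_nonneg _))

theorem ne_one_of_mem_ball {z : ℂ} (hz : z ∈ Metric.ball (0 : ℂ) 1) : z ≠ 1 := by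
  rintro rfl
  simp at hz

theorem continuousAt_weightPow (a : ℝ) {z : ℂ} (hz : z ∈ Metric.closedBall (0 : ℂ) 1)
    (h1 : z ≠ 1) : ContinuousAt (weightPow a) z :=
  ContinuousAt.cpow (continuous_sub_left 1).continuousAt continuousAt_const
    (one_sub_mem_slitPlane hz h1)

theorem differentiableOn_weightPow (a : ℝ) :
    DifferentiableOn ℂ (weightPow a) (Metric.ball 0 1) := fun _ hz =>
  ((differentiableAt_const 1).sub differentiableAt_id).cpow_const
    (one_sub_mem_slitPlane (Metric.ball_subset_closedBall hz)
      (ne_one_of_mem_ball hz)) |>.differentiableWithinAt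

theorem norm_weightPow (a : ℝ) (z : ℂ) : ‖weightPow a z‖ = ‖z - 1‖ ^ a := by
  rw [weightPow, Complex.norm_cpow_real, norm_sub_rev]

theorem weightPow_mul_weightPow_neg (a : ℝ) {z : ℂ} (h1 : z ≠ 1) :
    weightPow a z * weightPow (-a) z = 1 := by
  rw [weightPow, weightPow, ← Complex.cpow_add _ _ (sub_ne_zero.2 h1.symm)]
  simp

/-- $|(1-z)^a|^p=|z-1|^{ap}$ pointwise on every circle, so equality already holds for each mean. -/
theorem hardyENorm_weightPow_mul {p : ℝ} (hp : 0 < p) (β a : ℝ) (F : ℂ → ℂ) :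
    hardyENorm p β (fun z => weightPow a z * F z) = hardyENorm p (a * p + β) F := by
  have h : ∀ r ∈ Ico (0 : ℝ) 1, circleMean p β (fun z => weightPow a z * F z) r =
      circleMean p (a * p + β) F r := fun r hr => by
    refine lintegral_congr fun θ => ?_
    have h0 : 0 < ‖circleMap 0 r θ - 1‖ :=
      norm_pos_iff.2 (sub_ne_zero.2 (ne_one_of_mem_ball (circleMap_mem hr θ)))
    rw [enorm_mul, ENNReal.mul_rpow_of_nonneg _ _ hp.le, ← ofReal_norm (weightPow _ _),
      norm_weightPow, ENNReal.ofReal_rpow_of_nonneg (by positivity) hp.le, ← Real.rpow_mul h0.le,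
      Real.rpow_add h0, ENNReal.ofReal_mul (by positivity)]
    ring
  simp only [hardyENorm]
  congr 1
  exact iSup_congr fun r => iSup_congr fun hr => h r hr

/-- Multiplication by `(1 - z) ^ a` as a map between Hardy spaces. -/
def HardySpace.mulWeight {p : ℝ} [Fact (1 ≤ p)] {β γ : ℝ} (a : ℝ) (h : γ = a * p + β)
    (f : HardySpace p γ) : HardySpace p β :=
  HardySpace.of p β (fun z => weightPow a z * f z)
    ((differentiableOn_weightPow a).mul f.differentiableOn) (by
      rw [hardyENorm_weightPow_mul (fact_pos p), ← h]
      exact f.2.2.2)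

theorem HardySpace.mulWeight_apply {p : ℝ} [Fact (1 ≤ p)] {β γ : ℝ} (a : ℝ) (h : γ = a * p + β)
    (f : HardySpace p γ) {z : ℂ} (hz : z ∈ Metric.ball (0 : ℂ) 1) :
    f.mulWeight a h z = weightPow a z * f z :=
  HardySpace.of_apply _ _ hz

/-- Multiplication by `(1 - z) ^ α` removes the weight isometrically. -/
def removeWeight (α p : ℝ) [Fact (1 ≤ p)] : HardySpace p (α * p) ≃ₗᵢ[ℂ] HardySpace p 0 where
  toFun f := f.mulWeight α (add_zero _).symm
  map_add' f g := HardySpace.ext_ball fun z hz => by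
    simp only [HardySpace.add_apply, HardySpace.mulWeight_apply _ _ _ hz]
    ring
  map_smul' c f := HardySpace.ext_ball fun z hz => by
    simp only [HardySpace.smul_apply, HardySpace.mulWeight_apply _ _ _ hz, RingHom.id_apply]
    ring
  invFun f := f.mulWeight (-α) (by ring)
  left_inv f := HardySpace.ext_ball fun z hz => by
    rw [HardySpace.mulWeight_apply _ _ _ hz, HardySpace.mulWeight_apply _ _ _ hz, ← mul_assoc,
      mul_comm (weightPow _ _), weightPow_mul_weightPow_neg _ (ne_one_of_mem_ball hz), one_mul]
  right_inv f := HardySpace.ext_ball fun z hz => by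
    rw [HardySpace.mulWeight_apply _ _ _ hz, HardySpace.mulWeight_apply _ _ _ hz, ← mul_assoc,
      weightPow_mul_weightPow_neg _ (ne_one_of_mem_ball hz), one_mul]
  norm_map' f := by
    rw [HardySpace.norm_def, HardySpace.norm_def]
    congr 1
    refine (hardyENorm_congr (G := fun z => weightPow α z * f z) fun z hz =>
      HardySpace.mulWeight_apply α (add_zero _).symm f hz).trans ?_
    rw [hardyENorm_weightPow_mul (fact_pos p), add_zero]

theorem removeWeight_apply {α p : ℝ} [Fact (1 ≤ p)] (f : HardySpace p (α * p)) {z : ℂ}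
    (hz : z ∈ Metric.ball (0 : ℂ) 1) : removeWeight α p f z = weightPow α z * f z :=
  HardySpace.mulWeight_apply α (add_zero _).symm f hz

theorem ae_circleMap_ne_one : ∀ᵐ θ ∂circ, circleMap 0 1 θ ≠ 1 := by
  have h1 : ∀ᵐ θ ∂circ, θ ≠ 2 * Real.pi := by
    rw [ae_iff]
    simp
  filter_upwards [h1, ae_restrict_mem measurableSet_Ioc] with θ hθ hmem h
  rw [circleMap_zero, Complex.ofReal_one, one_mul, Complex.exp_eq_one_iff] at h
  obtain ⟨n, hn⟩ := h
  have h2 : (θ : ℂ) = ((n * (2 * Real.pi) : ℝ) : ℂ) := by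
    apply mul_right_cancel₀ Complex.I_ne_zero
    rw [hn]
    push_cast
    ring
  have h3 : θ = n * (2 * Real.pi) := Complex.ofReal_injective h2
  have hπ : 0 < 2 * Real.pi := Real.two_pi_pos
  have h4 : θ < 2 * Real.pi := lt_of_le_of_ne hmem.2 hθ
  have h5 : (0 : ℝ) < n := by
    by_contra hn0
    nlinarith [hmem.1]
  have h6 : (n : ℝ) < 1 := by
    by_contra hn0
    nlinarith
  norm_cast at h5 h6
  omega

/-- Weighted Hardy functions have radial limits almost everywhere. -/
theorem ae_tendsto_of_removeWeight {α p : ℝ} [Fact (1 ≤ p)] (hp : 1 < p)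
    (f : HardySpace p (α * p)) :
    ∀ᵐ θ ∂circ, Tendsto (fun r : ℝ => f (circleMap 0 r θ)) (𝓝[<] 1)
      (𝓝 (weightPow (-α) (circleMap 0 1 θ) * boundaryValue (removeWeight α p f) θ)) := by
  filter_upwards [ae_circleMap_ne_one,
    ((removeWeight α p f).memLp_boundaryValue_and_tendsto hp).2.2] with θ hθ h
  have h1 : Tendsto (fun r : ℝ => circleMap 0 r θ) (𝓝[<] 1) (𝓝 (circleMap 0 1 θ)) := by
    simpa only [ofReal_mul_circleMap, mul_one] using tendsto_ofReal_mul (circleMap 0 1 θ)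
  -- Inside the disc $f$ is $(1-z)^{-\alpha}$ times its unweighted image, and both factors have
  -- radial limits at $e^{i\theta}$.
  refine ((((continuousAt_weightPow (-α) (by simp) hθ).tendsto.comp h1).mul h)).congr' ?_
  filter_upwards [Ioo_mem_nhdsLT (zero_lt_one' ℝ)] with r hr
  have hz := circleMap_mem ⟨hr.1.le, hr.2⟩ θ
  rw [Function.comp_apply, removeWeight_apply _ hz, ← mul_assoc, mul_comm (weightPow _ _),
    weightPow_mul_weightPow_neg _ (ne_one_of_mem_ball hz), one_mul]

theorem ae_hasRadialLimit {α p : ℝ} [Fact (1 ≤ p)] (hp : 1 < p) (f : HardySpace p (α * p)) :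
    ∀ᵐ θ : ℝ, HasRadialLimit f θ :=
  ae_hasRadialLimit_of_circ ((ae_tendsto_of_removeWeight hp f).mono fun _ h => ⟨_, h⟩)

/-- At boundary points other than $1$ the two factors $(1-z)^{-\alpha}$ and its conjugate cancel the
weight $|z-1|^{2\alpha}$. -/
theorem pairingIntegrand_ae_eq {α p q : ℝ} [Fact (1 ≤ p)] [Fact (1 ≤ q)] (hp : 1 < p)
    (hq : 1 < q) (f : HardySpace p (α * p)) (h : HardySpace q (α * q)) :
    pairingIntegrand α f h =ᵐ[circ] fun θ => boundaryValue (removeWeight α p f) θ *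
      starRingEnd ℂ (boundaryValue (removeWeight α q h) θ) := by
  filter_upwards [ae_circleMap_ne_one, ae_tendsto_of_removeWeight hp f,
    ae_tendsto_of_removeWeight hq h] with θ hθ h1 h2
  have h3 : weightPow (-α) (circleMap 0 1 θ) * starRingEnd ℂ (weightPow (-α) (circleMap 0 1 θ)) *
      ((‖circleMap 0 1 θ - 1‖ ^ (2 * α) : ℝ) : ℂ) = 1 := by
    have h0 : 0 < ‖circleMap 0 1 θ - 1‖ := norm_pos_iff.2 (sub_ne_zero.2 hθ)
    rw [Complex.mul_conj, Complex.normSq_eq_norm_sq, norm_weightPow, ← Complex.ofReal_mul,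
      ← Real.rpow_mul_natCast h0.le, ← Real.rpow_add h0]
    rw [show -α * (2 : ℕ) + 2 * α = 0 by push_cast; ring, Real.rpow_zero, Complex.ofReal_one]
  have h4 : boundaryValue f θ = _ := h1.limUnder_eq
  have h5 : boundaryValue h θ = _ := h2.limUnder_eq
  rw [pairingIntegrand, h4, h5, map_mul]
  linear_combination boundaryValue (removeWeight α p f) θ *
    starRingEnd ℂ (boundaryValue (removeWeight α q h) θ) * h3

/-- Duality for the weighted Hardy spaces. -/
def weightedPairingEquiv (α : ℝ) {p q : ℝ} [Fact (1 ≤ p)] [Fact (1 ≤ q)]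
    (hpq : p.HolderConjugate q) :
    HardySpace q (α * q) ≃L⋆[ℂ] StrongDual ℂ (HardySpace p (α * p)) :=
  ((removeWeight α q).toContinuousLinearEquiv.trans (pairingEquiv hpq)).trans
    ((removeWeight α p).symm.toContinuousLinearEquiv.arrowCongr (ContinuousLinearEquiv.refl ℂ ℂ))

theorem weightedPairingEquiv_apply (α : ℝ) {p q : ℝ} [Fact (1 ≤ p)] [Fact (1 ≤ q)]
    (hpq : p.HolderConjugate q) (h : HardySpace q (α * q)) (f : HardySpace p (α * p)) :
    weightedPairingEquiv α hpq h f = pairing (removeWeight α p f) (removeWeight α q h) := rfl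

end WeightedHardy

end

/-! ### The weighted duality theorem. -/

theorem theorem3p3 (α p q : ℝ) [Fact (1 ≤ p)] [Fact (1 ≤ q)] (hα : 0 ≤ α) (hp : 1 < p)
    (hpq : 1 / p + 1 / q = 1) :
    (∀ f : WeightedHardy.HardySpace p (α * p), ∀ᵐ θ : ℝ, WeightedHardy.HasRadialLimit f θ) ∧
    (∀ h : WeightedHardy.HardySpace q (α * q), ∀ᵐ θ : ℝ, WeightedHardy.HasRadialLimit h θ) ∧
    (∀ (f : WeightedHardy.HardySpace p (α * p)) (h : WeightedHardy.HardySpace q (α * q)),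
      IntegrableOn (WeightedHardy.pairingIntegrand α f h) (Ioc 0 (2 * Real.pi))) ∧
    ∃ Φ : WeightedHardy.HardySpace q (α * q) ≃L⋆[ℂ]
        StrongDual ℂ (WeightedHardy.HardySpace p (α * p)),
      ∀ (h : WeightedHardy.HardySpace q (α * q)) (f : WeightedHardy.HardySpace p (α * p)),
        Φ h f = ∫ θ in Ioc 0 (2 * Real.pi), WeightedHardy.pairingIntegrand α f h θ := by
  have hH : p.HolderConjugate q := Real.holderConjugate_iff.2 ⟨hp, by simpa using hpq⟩
  have hq : 1 < q := hH.symm.lt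
  refine ⟨WeightedHardy.ae_hasRadialLimit hp, WeightedHardy.ae_hasRadialLimit hq, fun f h => ?_,
    WeightedHardy.weightedPairingEquiv α hH, fun h f => ?_⟩
  · exact (integrable_congr (WeightedHardy.pairingIntegrand_ae_eq hp hq f h)).2
      (WeightedHardy.integrable_boundaryValue_mul hH _ _)
  · rw [WeightedHardy.weightedPairingEquiv_apply]
    exact (integral_congr_ae (WeightedHardy.pairingIntegrand_ae_eq hp hq f h)).symm
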